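/- Work in class theory; $\langle M,A\rangle$ denotes the structure $\langle M,\in,A\rangle$ for classes $M,A$, and "definable" means first-order definable with parameters. A class $A\subseteq M$ is $M$-amenable if $A\cap x\in M$ for every $x\in M$. A generic extension of $L$ is an inner model (a transitive class containing all ordinals and satisfying ZF) of the form $L[G]=\{\sigma^G:\sigma\in L\}$, where $\sigma^G=\{\pi^G:\langle\pi,r\rangle\in\sigma \text{ for some } r\in G\}$, such that for some forcing notion (preordered class) $\mathcal P\subseteq L$: (a) $\mathcal P$ (with its order) is $L$-amenable, and for every $\Delta_0$ formula $\varphi$ of set theory the relation $p\Vdash_{\mathcal P}\varphi(\sigma_1,\dots,\sigma_n)$ (for $p\in\mathcal P$ and names $\sigma_i\in L$) is definable over $\langle L,\mathcal P\rangle$; (b) $G\subseteq\mathcal P$ is pairwise compatible, closed upwards, and meets every dense class $D\subseteq\mathcal P$ definable over $\langle L,\mathcal P\rangle$. A set is generic over $L$ if it is an element of some generic extension of $L$. Let $\mathrm{Sat}\langle L,A\rangle$ be the canonical satisfaction predicate of $\langle L,A\rangle$: the class of pairs $\langle\ulcorner\varphi\urcorner,s\rangle$ where $\varphi$ is a first-order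 formula in the language of $\langle L,A\rangle$, $s$ is a finite sequence from $L$ assigning values to its free variables, and $\langle L,A\rangle\models\varphi[s]$. Lemma 1. Suppose $R\subseteq\omega$ is generic over $L$. Then there is an $L$-amenable class $A$ such that $\mathrm{Sat}\langle L,A\rangle$ is not definable with parameters over $\langle L[R],A\rangle$. -/

import Mathlib

open FirstOrder

universe u

/-! ## Structures `⟨M, ∈, A⟩` for classes `M` and `A`

The ambient universe of sets is `ZFSet`, and a class is any `Set ZFSet`. -/

/-- Relation symbols of the language of set theory with one extra unary predicate. -/
inductive SetSymbol : ℕ → Type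
  | mem : SetSymbol 2
  | pred : SetSymbol 1

/-- The first-order language `{∈, A}` with `A` a unary predicate symbol. -/
def setLang : FirstOrder.Language.{0, 0} := ⟨fun _ => Empty, SetSymbol⟩

/-- The underlying type of the structure `⟨M, ∈, A⟩`. -/
def ClassStr (M _A : Set ZFSet.{u}) : Type (u + 1) := {x : ZFSet.{u} // x ∈ M}

/-- `⟨M, ∈, A⟩`; the predicate symbol is interpreted by `A ∩ M`. -/
instance ClassStr.instStructure (M A : Set ZFSet.{u}) : setLang.Structure (ClassStr M A) where
  funMap := fun f _ => Empty.elim f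
  RelMap := fun {_} r => match r with
    | SetSymbol.mem => fun v => (v 0).1 ∈ (v 1).1
    | SetSymbol.pred => fun v => (v 0).1 ∈ A

/-- `D ∩ M` is definable, with parameters from `M`, over `⟨M, ∈, A⟩`. -/
def DefinableOver (M A D : Set ZFSet.{u}) : Prop :=
  (Set.univ : Set (ClassStr M A)).Definable₁ setLang {x | x.1 ∈ D}

/-- The restriction to `M` of the `n`-ary relation `D` is definable, with parameters from `M`,
over `⟨M, ∈, A⟩`. -/
def RelDefinableOver (M A : Set ZFSet.{u}) {n : ℕ} (D : (Fin n → ZFSet.{u}) → Prop) : Prop :=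
  (Set.univ : Set (ClassStr M A)).Definable setLang
    {v : Fin n → ClassStr M A | D (fun i => (v i).1)}

/-- `A` is an `M`-amenable class: `A ⊆ M`, and `x ∩ A ∈ M` for all `x ∈ M`. -/
def IsAmenable (M A : Set ZFSet.{u}) : Prop :=
  A ⊆ M ∧ ∀ x ∈ M, ZFSet.sep (fun z => z ∈ A) x ∈ M

/-! ## Constructibility -/

/-- The set of all subsets of `x` that are definable with parameters over `⟨x, ∈, A ∩ x⟩`. -/
noncomputable def defPowerset (A : Set ZFSet.{u}) (x : ZFSet.{u}) : ZFSet.{u} :=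
  ZFSet.sep (fun y => DefinableOver {z | z ∈ x} A {z | z ∈ y}) x.powerset

/-- The hierarchy `L_α[A] = ⋃_{β < α} Def(⟨L_β[A], ∈, A ∩ L_β[A]⟩)`, that is
`L_0[A] = ∅`, `L_{α+1}[A] = Def(⟨L_α[A], ∈, A ∩ L_α[A]⟩)`, with unions at limits. -/
noncomputable def constrLevel (A : Set ZFSet.{u}) (o : Ordinal.{u}) : ZFSet.{u} :=
  ZFSet.iUnion fun a : Set.Iio o => defPowerset A (constrLevel A a.1)
termination_by o
decreasing_by exact a.2

/-- The class `L[A]` of all sets constructible relative to `A`. -/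
def relConstructible (A : Set ZFSet.{u}) : Set ZFSet.{u} :=
  {x | ∃ o : Ordinal.{u}, x ∈ constrLevel A o}

/-- Gödel's constructible universe `L`. -/
def constructible : Set ZFSet.{u} := relConstructible ∅

/-- An inner model: a transitive class containing all ordinals and satisfying `ZF`.
For a transitive class with all the ordinals, extensionality, foundation and infinity hold, and the
remaining axioms take the form below. -/
structure IsInnerModel (N : Set ZFSet.{u}) : Prop where
  transitive : ∀ x ∈ N, ∀ y ∈ x, y ∈ N
  ordinals : ∀ o : Ordinal.{u}, o.toZFSet ∈ N
  pairing : ∀ x ∈ N, ∀ y ∈ N, ({x, y} : ZFSet.{u}) ∈ N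
  union : ∀ x ∈ N, ZFSet.sUnion x ∈ N
  powerset : ∀ x ∈ N, ZFSet.sep (fun y => y ∈ N) x.powerset ∈ N
  separation : ∀ D : Set ZFSet.{u}, DefinableOver N ∅ D →
    ∀ x ∈ N, ZFSet.sep (fun z => z ∈ D) x ∈ N
  replacement : ∀ F : ZFSet.{u} → ZFSet.{u} → Prop,
    RelDefinableOver N ∅ (fun v : Fin 2 → ZFSet.{u} => F (v 0) (v 1)) →
    ∀ x ∈ N, (∀ a ∈ x, ∃! b, b ∈ N ∧ F a b) →
      ∃ y ∈ N, ∀ b, b ∈ y ↔ b ∈ N ∧ ∃ a ∈ x, F a b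

/-! ## The satisfaction predicate -/

/-- The natural number `n` as a set. -/
noncomputable def natSet (n : ℕ) : ZFSet.{u} := (n : Ordinal.{u}).toZFSet

/-- The index of a variable (the only terms of the language are variables). -/
def varIndex {n : ℕ} : setLang.Term (Empty ⊕ Fin n) → ℕ
  | .var (Sum.inl e) => e.elim
  | .var (Sum.inr i) => i
  | .func f _ => Empty.elim f

/-- The Gödel code `⌜φ⌝` of a formula, a hereditarily finite set. -/
noncomputable def fmlCode : {n : ℕ} → setLang.BoundedFormula Empty n → ZFSet.{u}
  | _, .falsum => ZFSet.pair (natSet 0) (natSet 0)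
  | _, .equal s t => ZFSet.pair (natSet 1) (ZFSet.pair (natSet (varIndex s)) (natSet (varIndex t)))
  | _, .rel SetSymbol.mem ts =>
      ZFSet.pair (natSet 2)
        (ZFSet.pair (natSet (varIndex (ts 0))) (natSet (varIndex (ts 1))))
  | _, .rel SetSymbol.pred ts => ZFSet.pair (natSet 3) (natSet (varIndex (ts 0)))
  | _, .imp φ ψ => ZFSet.pair (natSet 4) (ZFSet.pair (fmlCode φ) (fmlCode ψ))
  | _, .all φ => ZFSet.pair (natSet 5) (fmlCode φ)

/-- The finite sequence `s` as a set, namely as a function with domain the natural number `n`. -/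
noncomputable def seqSet {n : ℕ} (s : Fin n → ZFSet.{u}) : ZFSet.{u} :=
  ZFSet.range fun i : Fin n => ZFSet.pair (natSet i) (s i)

/-- `Sat⟨M, A⟩`: the class of all pairs `⟨⌜φ⌝, s⟩` such that `φ` is a formula in the variables
`v_0, …, v_{n-1}`, `s` is an `n`-sequence of elements of `M`, and `⟨M, ∈, A⟩ ⊨ φ[s]`. -/
def Sat (M A : Set ZFSet.{u}) : Set ZFSet.{u} :=
  {x | ∃ (n : ℕ) (φ : setLang.BoundedFormula Empty n) (s : Fin n → ClassStr M A),
    φ.Realize Empty.elim s ∧ x = ZFSet.pair (fmlCode φ) (seqSet fun i => (s i).1)}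

/-! ## Class forcing -/

/-- A forcing notion: a class of conditions, preordered by `le`. -/
structure ForcingNotion where
  carrier : Set ZFSet.{u}
  le : ZFSet.{u} → ZFSet.{u} → Prop
  left_mem : ∀ {p q}, le p q → p ∈ carrier
  right_mem : ∀ {p q}, le p q → q ∈ carrier
  refl : ∀ p ∈ carrier, le p p
  trans : ∀ {p q r}, le p q → le q r → le p r

/-- The forcing notion as a single class: its order, as a class of ordered pairs. Since the order is
reflexive, this determines the conditions. -/
def ForcingNotion.graph (P : ForcingNotion.{u}) : Set ZFSet.{u} :=
  {x | ∃ p q, P.le p q ∧ x = ZFSet.pair p q}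

theorem rank_lt_of_pair_mem {x r s : ZFSet.{u}} (h : ZFSet.pair x r ∈ s) : x.rank < s.rank := by
  have h1 : x ∈ ({x} : ZFSet.{u}) := by simp
  have h2 : ({x} : ZFSet.{u}) ∈ ZFSet.pair x r := by simp [ZFSet.pair]
  exact (ZFSet.rank_lt_of_mem h1).trans
    ((ZFSet.rank_lt_of_mem h2).trans (ZFSet.rank_lt_of_mem h))

/-- Any set `σ` serves as a name; only its elements of the form `⟨π, r⟩` with `r` a condition
matter. `P.forcesEq p σ τ` is `p ⊩ σ = τ`: for every `⟨π, r⟩ ∈ σ`, each `q ≤ p, r` forces `π ∈ τ`, and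
for every `⟨π, r⟩ ∈ τ`, each `q ≤ p, r` forces `π ∈ σ`. -/
def ForcingNotion.forcesEq (P : ForcingNotion.{u}) (p σ τ : ZFSet.{u}) : Prop :=
  (∀ π r, (_ : ZFSet.pair π r ∈ σ) → ∀ q, P.le q p → P.le q r →
    ∀ q', P.le q' q → ∃ t, P.le t q' ∧
      ∃ π' r', ZFSet.pair π' r' ∈ τ ∧ P.le t r' ∧ P.forcesEq t π π') ∧
  (∀ π r, ZFSet.pair π r ∈ τ → ∀ q, P.le q p → P.le q r →
    ∀ q', P.le q' q → ∃ t, P.le t q' ∧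
      ∃ π' r', ∃ _ : ZFSet.pair π' r' ∈ σ, P.le t r' ∧ P.forcesEq t π' π)
termination_by σ.rank
decreasing_by all_goals exact rank_lt_of_pair_mem ‹_›

/-- `p ⊩ σ ∈ τ`: the conditions `t` such that `t ≤ r` and `t ⊩ σ = π` for some `⟨π, r⟩ ∈ τ` are dense
below `p`. -/
def ForcingNotion.forcesMem (P : ForcingNotion.{u}) (p σ τ : ZFSet.{u}) : Prop :=
  ∀ q, P.le q p → ∃ t, P.le t q ∧
    ∃ π r, ZFSet.pair π r ∈ τ ∧ P.le t r ∧ P.forcesEq t σ π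

/-- The `Δ₀` formulas of the language of set theory in the variables `v_0, …, v_{n-1}`.
`ball i φ` is `∀ v_n ∈ v_i, φ`. -/
inductive DeltaZero : ℕ → Type
  | mem {n : ℕ} (i j : Fin n) : DeltaZero n
  | eq {n : ℕ} (i j : Fin n) : DeltaZero n
  | neg {n : ℕ} (φ : DeltaZero n) : DeltaZero n
  | and {n : ℕ} (φ ψ : DeltaZero n) : DeltaZero n
  | ball {n : ℕ} (i : Fin n) (φ : DeltaZero (n + 1)) : DeltaZero n

/-- The forcing relation `p ⊩ φ(σ_0, …, σ_{n-1})` for `Δ₀` formulas. -/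
def ForcingNotion.forces (P : ForcingNotion.{u}) :
    {n : ℕ} → DeltaZero n → ZFSet.{u} → (Fin n → ZFSet.{u}) → Prop
  | _, .mem i j, p, σ => P.forcesMem p (σ i) (σ j)
  | _, .eq i j, p, σ => P.forcesEq p (σ i) (σ j)
  | _, .neg φ, p, σ => ∀ q, P.le q p → ¬ P.forces φ q σ
  | _, .and φ ψ, p, σ => P.forces φ p σ ∧ P.forces ψ p σ
  | _, .ball i φ, p, σ => ∀ π r, ZFSet.pair π r ∈ σ i → ∀ q, P.le q p → P.le q r →
      P.forces φ q (Fin.snoc (α := fun _ => ZFSet.{u}) σ π)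

/-- For every `Δ₀` formula `φ`, the relation `p ⊩ φ(σ_0, …, σ_{n-1})` between conditions `p` and names
`σ_i ∈ M` is definable with parameters over `⟨M, P⟩`. -/
def ForcingNotion.DeltaZeroDefinable (P : ForcingNotion.{u}) (M : Set ZFSet.{u}) : Prop :=
  ∀ (n : ℕ) (φ : DeltaZero n),
    RelDefinableOver M P.graph
      (fun v : Fin (n + 1) → ZFSet.{u} => v 0 ∈ P.carrier ∧ P.forces φ (v 0) (fun i => v i.succ))

/-- `G ⊆ P` is compatible, closed upwards, and meets every dense class `D ⊆ P` that is definable with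
parameters over `⟨M, P⟩`. -/
structure ForcingNotion.IsGenericFilter (P : ForcingNotion.{u}) (M G : Set ZFSet.{u}) : Prop where
  subset : G ⊆ P.carrier
  compatible : ∀ p ∈ G, ∀ q ∈ G, ∃ r, P.le r p ∧ P.le r q
  upward : ∀ p ∈ G, ∀ q, P.le p q → q ∈ G
  meets : ∀ D : Set ZFSet.{u}, D ⊆ P.carrier → DefinableOver M P.graph D →
    (∀ p ∈ P.carrier, ∃ q ∈ D, P.le q p) → ∃ p ∈ G, p ∈ D

instance small_pairs (G : Set ZFSet.{u}) (σ : ZFSet.{u}) :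
    Small.{u} {π : ZFSet.{u} // ∃ r ∈ G, ZFSet.pair π r ∈ σ} := by
  refine small_of_injective
    (β := {z : ZFSet.{u} // z ∈ σ})
    (f := fun x => ⟨ZFSet.pair x.1 x.2.choose, x.2.choose_spec.2⟩) ?_
  intro x y h
  exact Subtype.ext (ZFSet.pair_injective (Subtype.ext_iff.1 h)).1

/-- The `G`-interpretation of the name `σ`: `σ^G = {π^G : ⟨π, r⟩ ∈ σ for some r ∈ G}`. -/
noncomputable def nameVal (G : Set ZFSet.{u}) (σ : ZFSet.{u}) : ZFSet.{u} :=
  ZFSet.range fun x : {π : ZFSet.{u} // ∃ r ∈ G, ZFSet.pair π r ∈ σ} => nameVal G x.1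
termination_by σ.rank
decreasing_by exact rank_lt_of_pair_mem x.2.choose_spec.2

/-- `M[G]`, the class of all interpretations of names in `M`. -/
def genericExt (M G : Set ZFSet.{u}) : Set ZFSet.{u} := nameVal G '' M

/-- `N` is a generic extension of `M` (by a possibly proper class forcing): `N` is an inner model of
the form `M[G]`, where `⟨M, P⟩` is amenable, forcing for `Δ₀` sentences is `⟨M, P⟩`-definable, and `G`
is `P`-generic for `⟨M, P⟩`-definable dense classes. -/
def IsGenericExtension (M N : Set ZFSet.{u}) : Prop :=
  IsInnerModel N ∧ ∃ (P : ForcingNotion.{u}) (G : Set ZFSet.{u}),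
    IsAmenable M P.graph ∧ P.DeltaZeroDefinable M ∧ P.IsGenericFilter M G ∧ N = genericExt M G

/-- The set `x` is generic over `M`: it is an element of a generic extension of `M`. -/
def IsGenericOver (M : Set ZFSet.{u}) (x : ZFSet.{u}) : Prop :=
  ∃ N : Set ZFSet.{u}, IsGenericExtension M N ∧ x ∈ N

/-! Take `A` to be the forcing notion `P` (coded by the class of pairs of its order) of a generic
extension `L[G]` containing `R`. Suppose `Sat⟨L, P⟩` were definable over `⟨L[R], P⟩`.

Since `L[G]` is an inner model containing `R`, it computes the levels `L_α[R]` correctly, so `L[R]`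
is a definable class of `L[G]`. The class `P` is also visible there: a name has its value in `P` iff
some condition in `G` equates it with the check name of an element of `P`. The truth lemma, for
formulas relativized to `L[R]` with predicate `P`, therefore yields a relation `F`, definable over
`⟨L, P⟩` and inherited by stronger conditions, such that `x ∈ Sat⟨L, P⟩` iff `F x p` for some `p ∈
G` (`exists_forcing_relation`). Definability of the forcing of equality is enough for this:
membership and all logical operations are treated through density, and quantifiers over `L[G]`
become quantifiers over names in `L`.

So far truth is computed from `G`, which is not available in `⟨L, P⟩`. The point is that correctness
of `F` is itself decided by a condition. Call `p` misdeciding if what `F` says at `p` violates one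
of Tarski's recursive clauses for some formula and sequence. This is definable over `⟨L, P⟩`. No `p
∈ G` is misdeciding (`not_misdecides`), because along `G` the relation `F` gives genuine truth,
which obeys the clauses. By genericity some `p ∈ G` has no misdeciding extension. Induction on
formulas then shows that every extension of this `p`, in `G` or not, decides truth correctly
(`decides_correctly`). Hence truth in `⟨L, P⟩` is "some `q ≤ p` satisfies `F`", which is definable
over `⟨L, P⟩`, and a diagonal class gives Tarski's contradiction (`exists_mem_Sat_not_iff`).

Definability proofs are delegated to instance search: `Dfn` for relations, `DT` for terms with
definable graph, `Mor` for rearrangements of variables. -/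

set_option synthInstance.maxSize 1000000000

/-! ## Definable relations in contexts

A context over a class `N` is a type identified with a finite power of `N`. -/

/-- The elements of a class, as a type. -/
abbrev El (N : Set ZFSet.{u}) : Type (u + 1) := {x : ZFSet.{u} // x ∈ N}

/-- A type identified with a finite power of the class `N`. -/
class Ctx (N : Set ZFSet.{u}) (Γ : Type (u + 1)) where
  ι : Type
  finite : Finite ι
  e : Γ ≃ (ι → El N)

attribute [instance] Ctx.finite

instance Ctx.el (N : Set ZFSet.{u}) : Ctx N (El N) := ⟨Unit, inferInstance, (Equiv.funUnique _ _).symm⟩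

instance Ctx.tuple (N : Set ZFSet.{u}) (n : ℕ) : Ctx N (Fin n → El N) :=
  ⟨Fin n, inferInstance, Equiv.refl _⟩

instance Ctx.prod (N : Set ZFSet.{u}) (Γ Δ : Type (u + 1)) [Ctx N Γ] [Ctx N Δ] : Ctx N (Γ × Δ) :=
  ⟨ι N Γ ⊕ ι N Δ, inferInstance, (Equiv.prodCongr e e).trans (Equiv.sumArrowEquivProdArrow _ _ _).symm⟩

/-- Maps of contexts that merely rearrange coordinates. -/
class Mor (N : Set ZFSet.{u}) {Γ Δ : Type (u + 1)} [Ctx N Γ] [Ctx N Δ] (f : Γ → Δ) : Prop where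
  out : ∃ σ : Ctx.ι N Δ → Ctx.ι N Γ, ∀ γ i, Ctx.e (N := N) (f γ) i = Ctx.e (N := N) γ (σ i)

/-- The structure `⟨N, ∈, A⟩` on the type of elements of `N`. -/
abbrev elStructure (N A : Set ZFSet.{u}) : setLang.Structure (El N) := ClassStr.instStructure N A

/-- `p` is definable with parameters over `⟨N, ∈, A⟩`. -/
class Dfn (N A : Set ZFSet.{u}) {Γ : Type (u + 1)} [Ctx N Γ] (p : Γ → Prop) : Prop where
  out : letI := elStructure N A
    (Set.univ : Set (El N)).Definable setLang {v : Ctx.ι N Γ → El N | p (Ctx.e.symm v)}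

/-- `t` is a function into `N` with definable graph. -/
class DT (N A : Set ZFSet.{u}) {Γ : Type (u + 1)} [Ctx N Γ] (t : Γ → ZFSet.{u}) : Prop where
  mem : ∀ γ, t γ ∈ N
  graph : Dfn N A (fun z : Γ × El N => z.2.1 = t z.1)

section
variable {N A : Set ZFSet.{u}} {Γ Δ Θ : Type (u + 1)} [Ctx N Γ] [Ctx N Δ] [Ctx N Θ]

theorem Dfn.congr {p q : Γ → Prop} (hq : Dfn N A q) (h : ∀ γ, p γ ↔ q γ) : Dfn N A p := by
  rwa [show p = q from funext fun γ => propext (h γ)]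

instance Mor.fst' : Mor N (Prod.fst : Γ × Δ → Γ) := ⟨Sum.inl, fun _ _ => rfl⟩

instance Mor.id : Mor N (fun γ : Γ => γ) := ⟨_root_.id, fun _ _ => rfl⟩

instance Mor.fst (f : Γ → Δ × Θ) [hf : Mor N f] : Mor N (fun γ => (f γ).1) := by
  obtain ⟨σ, h⟩ := hf
  exact ⟨fun i => σ (Sum.inl i), fun γ i => h γ (Sum.inl i)⟩

instance Mor.snd (f : Γ → Δ × Θ) [hf : Mor N f] : Mor N (fun γ => (f γ).2) := by
  obtain ⟨σ, h⟩ := hf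
  exact ⟨fun i => σ (Sum.inr i), fun γ i => h γ (Sum.inr i)⟩

instance Mor.prodMk (f : Γ → Δ) (g : Γ → Θ) [hf : Mor N f] [hg : Mor N g] :
    Mor N (fun γ => (f γ, g γ)) := by
  obtain ⟨σ, h⟩ := hf
  obtain ⟨τ, h'⟩ := hg
  exact ⟨Sum.elim σ τ, fun γ i => by cases i; exacts [h γ _, h' γ _]⟩

instance Mor.apply {n : ℕ} (f : Γ → Fin n → El N) [hf : Mor N f] (i : Fin n) :
    Mor N (fun γ => f γ i) := by
  obtain ⟨σ, h⟩ := hf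
  exact ⟨fun _ => σ i, fun γ _ => h γ i⟩

theorem Mor.tuple {n : ℕ} (f : Γ → Fin n → El N) (hf : ∀ i, Mor N fun γ => f γ i) :
    Mor N f := by
  choose σ h using fun i => (hf i).out
  exact ⟨fun i => σ i (), fun γ i => h i γ ()⟩

instance Mor.snoc {n : ℕ} (f : Γ → Fin n → El N) (g : Γ → El N) [hf : Mor N f] [hg : Mor N g] :
    Mor N (fun γ => (Fin.snoc (f γ) (g γ) : Fin (n + 1) → El N)) := by
  refine Mor.tuple _ fun i => ?_
  induction i using Fin.lastCases with
  | last => simpa using hg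
  | cast i => simpa using Mor.apply f i

/-- On coordinates `f` is precomposition with a map of index sets, and definable sets are stable
under such preimages. This supplies weakening, permutation and identification of variables. -/
theorem Dfn.reindex {p : Δ → Prop} (hp : Dfn N A p) (f : Γ → Δ) [hf : Mor N f] :
    Dfn N A (fun γ => p (f γ)) := by
  let := elStructure N A
  obtain ⟨σ, h⟩ := hf
  refine ⟨?_⟩
  convert hp.out.preimage_comp σ using 1
  ext v
  simp only [Set.mem_ofPred_eq, Set.mem_preimage]
  have : f ((Ctx.e (N := N)).symm v) = (Ctx.e (N := N)).symm (v ∘ σ) := by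
    rw [Equiv.eq_symm_apply]
    funext i
    rw [h]
    simp
  rw [this]

instance Dfn.and {p q : Γ → Prop} [hp : Dfn N A p] [hq : Dfn N A q] :
    Dfn N A (fun γ => p γ ∧ q γ) :=
  letI := elStructure N A
  ⟨hp.out.inter hq.out⟩

instance Dfn.or {p q : Γ → Prop} [hp : Dfn N A p] [hq : Dfn N A q] :
    Dfn N A (fun γ => p γ ∨ q γ) :=
  letI := elStructure N A
  ⟨hp.out.union hq.out⟩

instance Dfn.not {p : Γ → Prop} [hp : Dfn N A p] : Dfn N A (fun γ => ¬ p γ) :=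
  letI := elStructure N A
  ⟨hp.out.compl⟩

instance Dfn.imp {p q : Γ → Prop} [Dfn N A p] [Dfn N A q] : Dfn N A (fun γ => p γ → q γ) :=
  Dfn.congr (q := fun γ => ¬ p γ ∨ q γ) inferInstance fun γ => by tauto

instance Dfn.iff {p q : Γ → Prop} [Dfn N A p] [Dfn N A q] : Dfn N A (fun γ => p γ ↔ q γ) :=
  Dfn.congr (q := fun γ => (p γ → q γ) ∧ (q γ → p γ)) inferInstance fun γ => by tauto

instance Dfn.const (c : Prop) : Dfn N A (fun _ : Γ => c) := by
  let := elStructure N A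
  by_cases hc : c
  · exact ⟨by simp [hc]⟩
  · exact ⟨by simp [hc]⟩

/-- A context is a finite power of `N`, so this is the projection of a definable set along a finite
block of variables. -/
instance Dfn.ex {p : Γ → Δ → Prop} [hp : Dfn N A (fun z : Γ × Δ => p z.1 z.2)] :
    Dfn N A (fun γ => ∃ x, p γ x) := by
  let := elStructure N A
  refine ⟨?_⟩
  convert hp.out.exists_of_finite using 1
  ext v
  simp only [Set.mem_ofPred_eq]
  constructor
  · rintro ⟨x, hx⟩
    refine ⟨Ctx.e x, ?_⟩
    change p (Ctx.e.symm v) (Ctx.e.symm (Ctx.e x))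
    rwa [Equiv.symm_apply_apply]
  · rintro ⟨u, hu⟩
    exact ⟨Ctx.e.symm u, hu⟩

instance Dfn.all {p : Γ → Δ → Prop} [hp : Dfn N A (fun z : Γ × Δ => p z.1 z.2)] :
    Dfn N A (fun γ => ∀ x, p γ x) :=
  Dfn.congr (q := fun γ => ¬ ∃ x, ¬ p γ x) inferInstance fun γ => by simp

theorem Dfn.mem_var (f g : Γ → El N) [hf : Mor N f] [hg : Mor N g] :
    Dfn N A (fun γ => (f γ).1 ∈ (g γ).1) := by
  let := elStructure N A
  obtain ⟨σ, h⟩ := hf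
  obtain ⟨τ, h'⟩ := hg
  refine ⟨Set.definable_iff_exists_formula_sum.2 ⟨Language.Relations.formula₂
    (SetSymbol.mem : setLang.Relations 2) (.var (.inr (σ ()))) (.var (.inr (τ ()))), ?_⟩⟩
  ext v
  have e1 := h (Ctx.e.symm v) ()
  have e2 := h' (Ctx.e.symm v) ()
  simp only [Equiv.apply_symm_apply] at e1 e2
  change (Ctx.e (N := N) (f (Ctx.e.symm v)) ()).1 ∈ (Ctx.e (N := N) (g (Ctx.e.symm v)) ()).1 ↔ _
  rw [e1, e2]
  rfl

theorem Dfn.pred_var (f : Γ → El N) [hf : Mor N f] : Dfn N A (fun γ => (f γ).1 ∈ A) := by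
  let := elStructure N A
  obtain ⟨σ, h⟩ := hf
  refine ⟨Set.definable_iff_exists_formula_sum.2 ⟨Language.Relations.formula₁
    (SetSymbol.pred : setLang.Relations 1) (.var (.inr (σ ()))), ?_⟩⟩
  ext v
  have e1 := h (Ctx.e.symm v) ()
  simp only [Equiv.apply_symm_apply] at e1
  change (Ctx.e (N := N) (f (Ctx.e.symm v)) ()).1 ∈ A ↔ _
  rw [e1]
  rfl

theorem Dfn.eq_var (f g : Γ → El N) [hf : Mor N f] [hg : Mor N g] :
    Dfn N A (fun γ => (f γ).1 = (g γ).1) := by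
  let := elStructure N A
  obtain ⟨σ, h⟩ := hf
  obtain ⟨τ, h'⟩ := hg
  refine ⟨Set.definable_iff_exists_formula_sum.2 ⟨Language.Term.equal
    (.var (.inr (σ ()))) (.var (.inr (τ ()))), ?_⟩⟩
  ext v
  have e1 := h (Ctx.e.symm v) ()
  have e2 := h' (Ctx.e.symm v) ()
  simp only [Equiv.apply_symm_apply] at e1 e2
  change (Ctx.e (N := N) (f (Ctx.e.symm v)) ()).1 = (Ctx.e (N := N) (g (Ctx.e.symm v)) ()).1 ↔ _
  rw [e1, e2, Set.mem_ofPred_eq, Language.Formula.realize_equal]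
  exact Subtype.ext_iff.symm

theorem Dfn.eq_const (f : Γ → El N) [hf : Mor N f] (a : ZFSet.{u}) :
    Dfn N A (fun γ => (f γ).1 = a) := by
  let := elStructure N A
  -- If `a` lies in `N` it serves as a parameter; otherwise the value is never attained and the
  -- relation is empty.
  by_cases ha : a ∈ N
  · obtain ⟨σ, h⟩ := hf
    refine ⟨Set.definable_iff_exists_formula_sum.2 ⟨Language.Term.equal
      (.var (.inr (σ ()))) (.var (.inl ⟨(⟨a, ha⟩ : El N), trivial⟩)), ?_⟩⟩
    ext v
    have e1 := h (Ctx.e.symm v) ()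
    simp only [Equiv.apply_symm_apply] at e1
    change (Ctx.e (N := N) (f (Ctx.e.symm v)) ()).1 = a ↔ _
    rw [e1, Set.mem_ofPred_eq, Language.Formula.realize_equal]
    exact (Subtype.ext_iff (a1 := v (σ ())) (a2 := ⟨a, ha⟩)).symm
  · exact Dfn.congr (Dfn.const False) fun γ => by
      simp only [iff_false]
      rintro rfl
      exact ha (f γ).2

instance DT.var (f : Γ → El N) [Mor N f] : DT N A (fun γ => (f γ).1) :=
  ⟨fun γ => (f γ).2, Dfn.eq_var (fun z : Γ × El N => z.2) (fun z => f z.1)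
    (hg := by
      obtain ⟨σ, h⟩ := ‹Mor N f›
      exact ⟨fun i => Sum.inl (σ i), fun γ i => h γ.1 i⟩)⟩

theorem DT.const {a : ZFSet.{u}} (ha : a ∈ N) : DT N A (fun _ : Γ => a) :=
  ⟨fun _ => ha, Dfn.eq_const _ _⟩

theorem Mor.comp {g : Δ → Θ} (hg : Mor N g) (f : Γ → Δ) [hf : Mor N f] :
    Mor N (fun γ => g (f γ)) := by
  obtain ⟨σ, h⟩ := hf
  obtain ⟨τ, h'⟩ := hg
  exact ⟨fun i => σ (τ i), fun γ i => by rw [h', h]⟩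

theorem DT.reindex {t : Δ → ZFSet.{u}} (ht : DT N A t) (f : Γ → Δ) [hf : Mor N f] :
    DT N A (fun γ => t (f γ)) :=
  ⟨fun γ => ht.mem _, by
    have : Mor N (fun z : Γ × El N => f z.1) := Mor.comp hf _
    exact ht.graph.reindex (fun z : Γ × El N => (f z.1, z.2))⟩

/-- Substitution of a definable term. -/
theorem Dfn.subst {p : Γ → ZFSet.{u} → Prop} {t : Γ → ZFSet.{u}}
    (hp : Dfn N A (fun z : Γ × El N => p z.1 z.2.1)) (ht : DT N A t) :
    Dfn N A (fun γ => p γ (t γ)) := by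
  have := ht.graph
  refine Dfn.congr (q := fun γ => ∃ x : El N, x.1 = t γ ∧ p γ x.1) inferInstance fun γ => ?_
  constructor
  · exact fun h => ⟨⟨t γ, ht.mem γ⟩, rfl, h⟩
  · rintro ⟨x, h, hx⟩
    rwa [← h]

/-- With its binary and ternary versions, this reduces the definability of a relation between
definable terms to the case of plain variables, which is proved once per relation. -/
theorem Dfn.subst₁ {p : ZFSet.{u} → Prop} {s : Γ → ZFSet.{u}}
    (hp : Dfn N A (fun z : El N => p z.1)) (hs : DT N A s) :
    Dfn N A (fun γ => p (s γ)) :=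
  Dfn.subst (p := fun _ y => p y) (hp.reindex fun z : Γ × El N => z.2) hs

theorem Dfn.subst₂ {p : ZFSet.{u} → ZFSet.{u} → Prop} {s t : Γ → ZFSet.{u}}
    (hp : Dfn N A (fun z : El N × El N => p z.1.1 z.2.1)) (hs : DT N A s) (ht : DT N A t) :
    Dfn N A (fun γ => p (s γ) (t γ)) :=
  Dfn.subst (p := fun γ x => p x (t γ)) (Dfn.subst (p := fun (z : Γ × El N) y => p z.2.1 y)
    (hp.reindex fun z : (Γ × El N) × El N => (z.1.2, z.2)) (ht.reindex fun z : Γ × El N => z.1)) hs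

theorem Dfn.subst₃ {p : ZFSet.{u} → ZFSet.{u} → ZFSet.{u} → Prop} {r s t : Γ → ZFSet.{u}}
    (hp : Dfn N A (fun z : El N × El N × El N => p z.1.1 z.2.1.1 z.2.2.1))
    (hr : DT N A r) (hs : DT N A s) (ht : DT N A t) :
    Dfn N A (fun γ => p (r γ) (s γ) (t γ)) :=
  Dfn.subst (p := fun γ x => p x (s γ) (t γ)) (Dfn.subst (p := fun (z : Γ × El N) y => p z.2.1 y (t z.1))
    (Dfn.subst (p := fun (z : (Γ × El N) × El N) y => p z.1.2.1 z.2.1 y)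
    (hp.reindex fun z : ((Γ × El N) × El N) × El N => (z.1.1.2, z.1.2, z.2))
    (ht.reindex fun z : (Γ × El N) × El N => z.1.1)) (hs.reindex fun z : Γ × El N => z.1)) hr

instance Dfn.mem {s t : Γ → ZFSet.{u}} [hs : DT N A s] [ht : DT N A t] :
    Dfn N A (fun γ => s γ ∈ t γ) := Dfn.subst₂ (p := fun x y => x ∈ y) (Dfn.mem_var _ _) hs ht

instance Dfn.eq {s t : Γ → ZFSet.{u}} [hs : DT N A s] [ht : DT N A t] :
    Dfn N A (fun γ => s γ = t γ) := Dfn.subst₂ (p := fun x y => x = y) (Dfn.eq_var _ _) hs ht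

instance Dfn.pred {s : Γ → ZFSet.{u}} [hs : DT N A s] :
    Dfn N A (fun γ => s γ ∈ A) := Dfn.subst₁ (p := fun x => x ∈ A) (Dfn.pred_var _) hs

end

/-- A transitive class closed under pairing and union. -/
class PairClosed (N : Set ZFSet.{u}) : Prop where
  trans : ∀ x ∈ N, ∀ y ∈ x, y ∈ N
  pairing : ∀ x ∈ N, ∀ y ∈ N, ({x, y} : ZFSet.{u}) ∈ N
  union : ∀ x ∈ N, ZFSet.sUnion x ∈ N

theorem IsInnerModel.pairClosed {N : Set ZFSet.{u}} (h : IsInnerModel N) : PairClosed N :=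
  ⟨h.transitive, h.pairing, h.union⟩

/-! ### Set operations and bounded quantifiers in transitive classes closed under pairs and unions
-/

section
variable {N A : Set ZFSet.{u}} {Γ Δ Θ : Type (u + 1)} [Ctx N Γ] [hN : PairClosed N]

theorem PairClosed.singleton_mem {x : ZFSet.{u}} (hx : x ∈ N) : ({x} : ZFSet.{u}) ∈ N := by
  simpa using PairClosed.pairing x hx x hx

theorem PairClosed.union_mem {x y : ZFSet.{u}} (hx : x ∈ N) (hy : y ∈ N) : x ∪ y ∈ N :=
  PairClosed.union _ (PairClosed.pairing x hx y hy)

theorem PairClosed.insert_mem {x y : ZFSet.{u}} (hx : x ∈ N) (hy : y ∈ N) :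
    (insert x y : ZFSet.{u}) ∈ N := by
  rw [ZFSet.insert_eq]
  exact PairClosed.union_mem (PairClosed.singleton_mem hx) hy

theorem PairClosed.pair_mem {x y : ZFSet.{u}} (hx : x ∈ N) (hy : y ∈ N) : ZFSet.pair x y ∈ N :=
  PairClosed.pairing _ (PairClosed.singleton_mem hx) _ (PairClosed.pairing _ hx _ hy)

theorem PairClosed.of_pair_mem {x y : ZFSet.{u}} (h : ZFSet.pair x y ∈ N) : x ∈ N ∧ y ∈ N := by
  have : ({x, y} : ZFSet.{u}) ∈ N := PairClosed.trans _ h _ (by simp [ZFSet.pair])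
  exact ⟨PairClosed.trans _ this _ (by simp), PairClosed.trans _ this _ (by simp)⟩

/-- Transitivity of `N` turns a quantifier over the elements of `t γ` into a quantifier over `N`. -/
instance Dfn.bex {t : Γ → ZFSet.{u}} {p : Γ → ZFSet.{u} → Prop} [DT N A t]
    [Dfn N A (fun z : Γ × El N => p z.1 z.2.1)] : Dfn N A (fun γ => ∃ x ∈ t γ, p γ x) := by
  have : DT N A (fun z : Γ × El N => t z.1) := DT.reindex ‹_› _
  refine Dfn.congr (q := fun γ => ∃ x : El N, x.1 ∈ t γ ∧ p γ x.1) inferInstance fun γ => ?_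
  exact ⟨fun ⟨x, h, h'⟩ => ⟨⟨x, PairClosed.trans _ (DT.mem (A := A) γ) x h⟩, h, h'⟩,
    fun ⟨x, h, h'⟩ => ⟨x.1, h, h'⟩⟩

instance Dfn.ball {t : Γ → ZFSet.{u}} {p : Γ → ZFSet.{u} → Prop} [DT N A t]
    [Dfn N A (fun z : Γ × El N => p z.1 z.2.1)] : Dfn N A (fun γ => ∀ x ∈ t γ, p γ x) :=
  Dfn.congr (q := fun γ => ¬ ∃ x ∈ t γ, ¬ p γ x) inferInstance fun γ => by simp

/-- Extensionality holds in the transitive class `N`, so the graph of `t` is definable as soon as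
membership in its values is. -/
theorem DT.of_mem {t : Γ → ZFSet.{u}} (h : ∀ γ, t γ ∈ N)
    (hd : Dfn N A (fun z : Γ × El N => z.2.1 ∈ t z.1)) : DT N A t := by
  refine ⟨h, ?_⟩
  have : Dfn N A (fun z : (Γ × El N) × El N => z.2.1 ∈ t z.1.1) :=
    hd.reindex fun z : (Γ × El N) × El N => (z.1.1, z.2)
  refine Dfn.congr (q := fun z : Γ × El N => ∀ w : El N, w.1 ∈ z.2.1 ↔ w.1 ∈ t z.1)
    inferInstance fun z => ?_
  constructor
  · intro e w
    rw [e]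
  · intro e
    ext w
    constructor
    · exact fun hw => (e ⟨w, PairClosed.trans _ z.2.2 w hw⟩).1 hw
    · exact fun hw => (e ⟨w, PairClosed.trans _ (h _) w hw⟩).2 hw

instance DT.pairing {s t : Γ → ZFSet.{u}} [hs : DT N A s] [ht : DT N A t] :
    DT N A (fun γ => ({s γ, t γ} : ZFSet.{u})) := by
  refine DT.of_mem (fun γ => PairClosed.pairing _ (hs.mem γ) _ (ht.mem γ)) ?_
  simp only [ZFSet.mem_pair]
  have : DT N A (fun z : Γ × El N => t z.1) := DT.reindex ‹_› _
  have : DT N A (fun z : Γ × El N => s z.1) := DT.reindex ‹_› _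
  infer_instance

instance DT.singleton {s : Γ → ZFSet.{u}} [hs : DT N A s] :
    DT N A (fun γ => ({s γ} : ZFSet.{u})) := by
  simpa using DT.pairing (N := N) (A := A) (s := s) (t := s)

instance DT.pair {s t : Γ → ZFSet.{u}} [hs : DT N A s] [ht : DT N A t] :
    DT N A (fun γ => ZFSet.pair (s γ) (t γ)) := by
  unfold ZFSet.pair
  infer_instance

instance DT.union {s t : Γ → ZFSet.{u}} [hs : DT N A s] [ht : DT N A t] :
    DT N A (fun γ => s γ ∪ t γ) := by
  refine DT.of_mem (fun γ => PairClosed.union_mem (hs.mem γ) (ht.mem γ)) ?_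
  simp only [ZFSet.mem_union]
  have : DT N A (fun z : Γ × El N => t z.1) := DT.reindex ‹_› _
  have : DT N A (fun z : Γ × El N => s z.1) := DT.reindex ‹_› _
  infer_instance

instance DT.insert {s t : Γ → ZFSet.{u}} [hs : DT N A s] [ht : DT N A t] :
    DT N A (fun γ => (Insert.insert (s γ) (t γ) : ZFSet.{u})) := by
  simp only [ZFSet.insert_eq]
  infer_instance

theorem PairClosed.mem_of_pair_mem {x y z : ZFSet.{u}} (hz : z ∈ N) (h : ZFSet.pair x y ∈ z) :
    x ∈ N ∧ y ∈ N := PairClosed.of_pair_mem (PairClosed.trans _ hz _ h)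

end

/-! ## Satisfaction in classes, formula codes and sequences -/

/-- The variable that a term is. -/
def termVar {n : ℕ} : setLang.Term (Empty ⊕ Fin n) → Fin n
  | .var (Sum.inl e) => e.elim
  | .var (Sum.inr i) => i
  | .func f _ => Empty.elim f

/-- `⟨K, ∈, A⟩ ⊨ φ[v]`, for a tuple `v` of arbitrary sets. -/
def realizeIn (K A : Set ZFSet.{u}) : {n : ℕ} → setLang.BoundedFormula Empty n →
    (Fin n → ZFSet.{u}) → Prop
  | _, .falsum, _ => False
  | _, .equal s t, v => v (termVar s) = v (termVar t)
  | _, .rel SetSymbol.mem ts, v => v (termVar (ts 0)) ∈ v (termVar (ts 1))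
  | _, .rel SetSymbol.pred ts, v => v (termVar (ts 0)) ∈ A
  | _, .imp φ ψ, v => realizeIn K A φ v → realizeIn K A ψ v
  | _, .all φ, v => ∀ x ∈ K, realizeIn K A φ (Fin.snoc (α := fun _ => ZFSet.{u}) v x)

theorem term_realize_eq {K A : Set ZFSet.{u}} {n : ℕ} (t : setLang.Term (Empty ⊕ Fin n))
    (v : Fin n → ClassStr K A) : t.realize (Sum.elim Empty.elim v) = v (termVar t) := by
  match t with
  | .var (Sum.inl e) => exact e.elim
  | .var (Sum.inr i) => rfl
  | .func f _ => exact Empty.elim f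

theorem coe_snoc {K : Set ZFSet.{u}} {n : ℕ} (v : Fin n → El K) (x : El K) :
    (fun i => (Fin.snoc (α := fun _ => El K) v x i).1) =
      Fin.snoc (α := fun _ => ZFSet.{u}) (fun i => (v i).1) x.1 := by
  funext i
  induction i using Fin.lastCases <;> simp

theorem realize_iff_realizeIn {K A : Set ZFSet.{u}} {n : ℕ} (φ : setLang.BoundedFormula Empty n)
    (v : Fin n → ClassStr K A) :
    φ.Realize Empty.elim v ↔ realizeIn K A φ (fun i => (v i).1) := by
  induction φ with
  | falsum => exact Iff.rfl
  | equal s t =>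
    change s.realize _ = t.realize _ ↔ (v (termVar s)).1 = (v (termVar t)).1
    rw [term_realize_eq, term_realize_eq]
    exact Subtype.ext_iff
  | rel r ts =>
    cases r with
    | mem =>
      change ((ts 0).realize (Sum.elim Empty.elim v)).1 ∈ ((ts 1).realize (Sum.elim Empty.elim v)).1 ↔
        (v (termVar (ts 0))).1 ∈ (v (termVar (ts 1))).1
      rw [term_realize_eq, term_realize_eq]
    | pred =>
      change ((ts 0).realize (Sum.elim Empty.elim v)).1 ∈ A ↔ (v (termVar (ts 0))).1 ∈ A
      rw [term_realize_eq]
  | imp φ ψ h1 h2 => exact imp_congr (h1 v) (h2 v)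
  | all φ h =>
    refine ⟨fun H x hx => ?_, fun H x => ?_⟩
    · have := (h _).1 (H ⟨x, hx⟩)
      exact (coe_snoc (K := K) v ⟨x, hx⟩) ▸ this
    · refine (h _).2 ?_
      exact (coe_snoc (K := K) v x).symm ▸ H x.1 x.2

/-- A family of relations on tuples from `I` with the closure properties of first-order logic
contains every relation of the form `⟨K, ∈, A⟩ ⊨ φ`. -/
theorem realizeIn_closure {I : Type*} (val : I → ZFSet.{u}) {K A : Set ZFSet.{u}}
    (hK : K ⊆ Set.range val) (F : ∀ n, ((Fin n → I) → Prop) → Prop)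
    (hfalse : ∀ n, F n fun _ => False)
    (heq : ∀ n i j, F n fun v => val (v i) = val (v j))
    (hmem : ∀ n i j, F n fun v => val (v i) ∈ val (v j))
    (hpred : ∀ n i, F n fun v => val (v i) ∈ A)
    (himp : ∀ n p q, F n p → F n q → F n fun v => p v → q v)
    (hall : ∀ n p, F (n + 1) p → F n fun v => ∀ x, val x ∈ K → p (Fin.snoc v x))
    {n : ℕ} (φ : setLang.BoundedFormula Empty n) :
    F n fun v => realizeIn K A φ (fun i => val (v i)) := by
  induction φ with
  | falsum => exact hfalse _
  | equal s t => exact heq _ _ _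
  | rel r ts =>
    cases r with
    | mem => exact hmem _ _ _
    | pred => exact hpred _ _
  | imp φ ψ h1 h2 => exact himp _ _ _ h1 h2
  | @all n φ h =>
    convert hall _ _ h using 2 with v
    have key : ∀ x, (fun i => val (Fin.snoc (α := fun _ => I) v x i)) =
        Fin.snoc (α := fun _ => ZFSet.{u}) (fun i => val (v i)) (val x) := by
      intro x
      funext i
      induction i using Fin.lastCases <;> simp
    constructor
    · intro H x hx
      rw [key]
      exact H _ hx
    · intro H y hy
      obtain ⟨x, rfl⟩ := hK hy
      have := H x hy
      rwa [key] at this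

section
variable {N A : Set ZFSet.{u}} {Γ : Type (u + 1)} [Ctx N Γ]

theorem Dfn.forallFin {n : ℕ} {p : Fin n → Γ → Prop} (h : ∀ i, Dfn N A (p i)) :
    Dfn N A (fun γ => ∀ i, p i γ) := by
  let := elStructure N A
  refine ⟨?_⟩
  convert Set.definable_iInter_of_finite (fun i => (h i).out) using 1
  ext v
  simp

/-- Satisfaction in `⟨K, ∈, B⟩` is definable over `⟨N, ∈, A⟩` if `K` and `B` are. -/
theorem Dfn.realizeIn {K B : Set ZFSet.{u}} (hKN : K ⊆ N)
    (hK : Dfn N A fun x : El N => x.1 ∈ K) (hB : Dfn N A fun x : El N => x.1 ∈ B)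
    {n : ℕ} (φ : setLang.BoundedFormula Empty n) :
    Dfn N A (fun v : Fin n → El N => realizeIn K B φ fun i => (v i).1) := by
  refine realizeIn_closure (I := El N) (fun x => x.1) (by simpa using hKN)
    (fun n p => Dfn N A p) ?_ ?_ ?_ ?_ ?_ ?_ φ
  · exact fun n => inferInstance
  · exact fun n i j => inferInstance
  · exact fun n i j => inferInstance
  · exact fun n i => Dfn.subst₁ (p := fun x => x ∈ B) hB inferInstance
  · exact fun n p q _ _ => inferInstance
  · intro n p hp
    have h1 : Dfn N A (fun z : (Fin n → El N) × El N => z.2.1 ∈ K) :=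
      hK.reindex fun z : (Fin n → El N) × El N => z.2
    have h2 := hp.reindex fun z : (Fin n → El N) × El N =>
      (Fin.snoc (α := fun _ => El N) z.1 z.2)
    exact Dfn.all (Δ := El N) (p := fun (v : Fin n → El N) x => x.1 ∈ K → p (Fin.snoc v x))

theorem Dfn.all_mem {B : Set ZFSet.{u}} : Dfn B A fun x : El B => x.1 ∈ B :=
  Dfn.congr (Dfn.const True) fun x => by simp

theorem definableOver_iff_dfn {D : Set ZFSet.{u}} :
    DefinableOver N A D ↔ Dfn N A fun x : El N => x.1 ∈ D := by
  let := elStructure N A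
  have key : DefinableOver N A D ↔ Dfn N A fun v : Fin 1 → El N => (v 0).1 ∈ D :=
    ⟨fun h => ⟨h⟩, fun h => h.out⟩
  rw [key]
  constructor
  · intro h
    have : Mor N (fun x : El N => fun _ : Fin 1 => x) := Mor.tuple _ fun i => Mor.id
    exact h.reindex fun x : El N => fun _ : Fin 1 => x
  · exact fun h => h.reindex fun v : Fin 1 → El N => v 0

theorem relDefinableOver_iff_dfn {n : ℕ} {D : (Fin n → ZFSet.{u}) → Prop} :
    RelDefinableOver N A D ↔ Dfn N A fun v : Fin n → El N => D fun i => (v i).1 :=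
  ⟨fun h => ⟨h⟩, fun h => h.out⟩

theorem Dfn.realizeIn_snoc {K B : Set ZFSet.{u}} (hKN : K ⊆ N)
    (hK : Dfn N A fun x : El N => x.1 ∈ K) (hB : Dfn N A fun x : El N => x.1 ∈ B)
    {n : ℕ} (φ : setLang.BoundedFormula Empty (n + 1)) (s : Fin n → ZFSet.{u}) (hs : ∀ i, s i ∈ N) :
    Dfn N A (fun x : El N => _root_.realizeIn K B φ (Fin.snoc (α := fun _ => ZFSet.{u}) s x.1)) := by
  have h1 := (Dfn.realizeIn hKN hK hB φ).reindex fun z : El N × (Fin n → El N) =>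
      (Fin.snoc (α := fun _ => El N) z.2 z.1)
  have h2 : Dfn N A (fun z : El N × (Fin n → El N) => ∀ i, (z.2 i).1 = s i) :=
    Dfn.forallFin fun i => Dfn.eq_const _ _
  -- The parameters are first treated as variables `w` and then pinned down by equations with
  -- constants.
  refine Dfn.congr (q := fun x : El N => ∃ w : Fin n → El N, (∀ i, (w i).1 = s i) ∧
    _root_.realizeIn K B φ fun i => (Fin.snoc (α := fun _ => El N) w x i).1) inferInstance fun x => ?_
  constructor
  · intro h
    refine ⟨fun i => ⟨s i, hs i⟩, fun i => rfl, ?_⟩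
    rwa [coe_snoc]
  · rintro ⟨w, hw, h⟩
    rw [coe_snoc] at h
    rwa [← (funext hw : (fun i => (w i).1) = s)]

/-- A definable class is defined by a formula in finitely many variables, from a finite sequence of
parameters. -/
theorem definableOver_iff_realizeIn {D : Set ZFSet.{u}} :
    DefinableOver N A D ↔ ∃ (n : ℕ) (φ : setLang.BoundedFormula Empty (n + 1)) (s : Fin n → ZFSet.{u}),
      (∀ i, s i ∈ N) ∧ ∀ x ∈ N, x ∈ D ↔ realizeIn N A φ (Fin.snoc (α := fun _ => ZFSet.{u}) s x) := by
  constructor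
  · intro h
    -- Only finitely many parameters occur. Enumerated, they become the first variables, and the
    -- element being tested becomes the last one.
    obtain ⟨F, -, hF⟩ := Set.definable_iff_finitely_definable.1 h
    obtain ⟨φ, hφ⟩ := Set.definable_iff_exists_formula_sum.1 hF
    let e := F.equivFin
    let g : ((F : Set (ClassStr N A)) ⊕ Fin 1) → Empty ⊕ Fin (F.card + 1) :=
      Sum.elim (fun a => Sum.inr (Fin.castSucc (e a))) (fun _ => Sum.inr (Fin.last _))
    refine ⟨F.card, Language.BoundedFormula.relabel g φ, fun i => (e.symm i).1.1,
      fun i => (e.symm i).1.2, fun x hx => ?_⟩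
    let x₀ : ClassStr N A := ⟨x, hx⟩
    have h1 : x ∈ D ↔ φ.Realize (Sum.elim Subtype.val fun _ => x₀) := Set.ext_iff.1 hφ fun _ => x₀
    rw [h1]
    have h2 := realize_iff_realizeIn (A := A) (Language.BoundedFormula.relabel g φ)
      (Fin.snoc (α := fun _ => ClassStr N A) (fun i => (e.symm i).1) x₀)
    have h3 := coe_snoc (K := N) (fun i => (e.symm i).1) x₀
    rw [← h3]
    refine Iff.trans ?_ h2
    rw [Language.BoundedFormula.realize_relabel]
    unfold Language.Formula.Realize
    apply iff_of_eq
    congr 1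
    · funext a
      rcases a with a | a
      · change a.1 = (Fin.snoc (α := fun _ => ClassStr N A) (fun i => (e.symm i).1) x₀ :
          Fin (F.card + 1) → ClassStr N A) (Fin.castSucc (e a))
        rw [Fin.snoc_castSucc, Equiv.symm_apply_apply]
      · change x₀ = (Fin.snoc (α := fun _ => ClassStr N A) (fun i => (e.symm i).1) x₀ :
          Fin (F.card + 1) → ClassStr N A) (Fin.last _)
        rw [Fin.snoc_last]
    · exact Subsingleton.elim _ _
  · rintro ⟨n, φ, s, hs, h⟩
    rw [definableOver_iff_dfn]
    exact Dfn.congr (Dfn.realizeIn_snoc subset_rfl Dfn.all_mem inferInstance φ s hs)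
      fun x => h x.1 x.2

end

/-! ### Codes -/

theorem natSet_inj {m n : ℕ} : natSet.{u} m = natSet n ↔ m = n := by
  unfold natSet
  rw [Ordinal.toZFSet_injective.eq_iff]
  exact Nat.cast_inj

theorem mem_natSet {n : ℕ} {x : ZFSet.{u}} : x ∈ natSet n ↔ ∃ m < n, x = natSet m := by
  unfold natSet
  rw [Ordinal.mem_toZFSet_iff]
  constructor
  · rintro ⟨a, ha, rfl⟩
    obtain ⟨m, rfl⟩ := Ordinal.lt_omega0.1 (ha.trans (Ordinal.natCast_lt_omega0 n))
    exact ⟨m, by exact_mod_cast ha, rfl⟩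
  · rintro ⟨m, hm, rfl⟩
    exact ⟨m, by exact_mod_cast hm, rfl⟩

theorem natSet_succ (n : ℕ) : natSet.{u} (n + 1) = insert (natSet n) (natSet n) := by
  simp only [natSet, Nat.cast_add, Nat.cast_one]
  exact Ordinal.toZFSet_add_one _

theorem mem_omega_iff {x : ZFSet.{u}} : x ∈ ZFSet.omega ↔ ∃ n, x = natSet n := by
  have key : ∀ n : ℕ, ZFSet.mk (PSet.ofNat n) = natSet.{u} n := by
    intro n
    induction n with
    | zero => simp [natSet]; rfl
    | succ n ih =>
      rw [natSet_succ, ← ih]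
      rfl
  constructor
  · refine Quotient.inductionOn x fun x => ?_
    rintro ⟨⟨n⟩, h⟩
    exact ⟨n, (Quotient.sound h).trans (key n)⟩
  · rintro ⟨n, rfl⟩
    rw [← key]
    exact ⟨⟨n⟩, PSet.Equiv.refl _⟩

theorem varIndex_eq {n : ℕ} (t : setLang.Term (Empty ⊕ Fin n)) : varIndex t = termVar t := by
  match t with
  | .var (Sum.inl e) => exact e.elim
  | .var (Sum.inr i) => rfl
  | .func f _ => exact Empty.elim f

theorem termVar_inj {n : ℕ} {s t : setLang.Term (Empty ⊕ Fin n)} (h : varIndex s = varIndex t) :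
    s = t := by
  rw [varIndex_eq, varIndex_eq, Fin.val_inj] at h
  match s, t with
  | .var (Sum.inl e), _ => exact e.elim
  | _, .var (Sum.inl e) => exact e.elim
  | .func f _, _ => exact Empty.elim f
  | _, .func f _ => exact Empty.elim f
  | .var (Sum.inr i), .var (Sum.inr j) =>
    have : i = j := h
    rw [this]

/-- The tags 0 to 5 separate the constructors. The code does not record the number of variables, so
both formulas are taken with the same `n`. -/
theorem fmlCode_injective {n : ℕ} (φ ψ : setLang.BoundedFormula Empty n)
    (h : fmlCode.{u} φ = fmlCode ψ) : φ = ψ := by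
  induction φ with
  | falsum =>
    cases ψ with
    | falsum => rfl
    | rel r ts => cases r <;> simp [fmlCode, ZFSet.pair_inj, natSet_inj] at h
    | _ => simp [fmlCode, ZFSet.pair_inj, natSet_inj] at h
  | equal s t =>
    cases ψ with
    | equal s' t' =>
      simp only [fmlCode, ZFSet.pair_inj, natSet_inj, true_and] at h
      rw [termVar_inj h.1, termVar_inj h.2]
    | rel r ts => cases r <;> simp [fmlCode, ZFSet.pair_inj, natSet_inj] at h
    | _ => simp [fmlCode, ZFSet.pair_inj, natSet_inj] at h
  | rel r ts =>
    cases r with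
    | mem =>
      cases ψ with
      | rel r' ts' =>
        cases r' with
        | mem =>
          simp only [fmlCode, ZFSet.pair_inj, natSet_inj, true_and] at h
          have : ts = ts' := by
            funext i
            fin_cases i
            exacts [termVar_inj h.1, termVar_inj h.2]
          rw [this]
        | pred => simp [fmlCode, ZFSet.pair_inj, natSet_inj] at h
      | _ => simp [fmlCode, ZFSet.pair_inj, natSet_inj] at h
    | pred =>
      cases ψ with
      | rel r' ts' =>
        cases r' with
        | pred =>
          simp only [fmlCode, ZFSet.pair_inj, natSet_inj, true_and] at h
          have : ts = ts' := by
            funext i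
            fin_cases i
            exact termVar_inj h
          rw [this]
        | mem => simp [fmlCode, ZFSet.pair_inj, natSet_inj] at h
      | _ => simp [fmlCode, ZFSet.pair_inj, natSet_inj] at h
  | imp φ₁ φ₂ h1 h2 =>
    cases ψ with
    | imp ψ₁ ψ₂ =>
      simp only [fmlCode, ZFSet.pair_inj, true_and] at h
      rw [h1 _ h.1, h2 _ h.2]
    | rel r ts => cases r <;> simp [fmlCode, ZFSet.pair_inj, natSet_inj] at h
    | _ => simp [fmlCode, ZFSet.pair_inj, natSet_inj] at h
  | all φ h1 =>
    cases ψ with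
    | all ψ =>
      simp only [fmlCode, ZFSet.pair_inj, true_and] at h
      rw [h1 _ h]
    | rel r ts => cases r <;> simp [fmlCode, ZFSet.pair_inj, natSet_inj] at h
    | _ => simp [fmlCode, ZFSet.pair_inj, natSet_inj] at h

theorem mem_seqSet {n : ℕ} {s : Fin n → ZFSet.{u}} {z : ZFSet.{u}} :
    z ∈ seqSet s ↔ ∃ i : Fin n, z = ZFSet.pair (natSet i) (s i) := by
  simp [seqSet, eq_comm]

theorem pair_mem_seqSet {n : ℕ} {s : Fin n → ZFSet.{u}} {i : Fin n} {x : ZFSet.{u}} :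
    ZFSet.pair (natSet i) x ∈ seqSet s ↔ x = s i := by
  rw [mem_seqSet]
  constructor
  · rintro ⟨j, hj⟩
    rw [ZFSet.pair_inj, natSet_inj, Fin.val_inj] at hj
    rw [hj.2, hj.1]
  · rintro rfl
    exact ⟨i, rfl⟩

theorem seqSet_injective {n : ℕ} : Function.Injective (seqSet (n := n)) := by
  intro s t h
  funext i
  exact pair_mem_seqSet.1 (h ▸ pair_mem_seqSet.2 rfl)

theorem seqSet_length {m n : ℕ} {s : Fin m → ZFSet.{u}} {t : Fin n → ZFSet.{u}}
    (h : seqSet s = seqSet t) : m = n := by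
  have key : ∀ {m n : ℕ} {s : Fin m → ZFSet.{u}} {t : Fin n → ZFSet.{u}},
      seqSet s = seqSet t → m ≤ n := by
    intro m n s t h
    by_contra! hlt
    obtain ⟨i, hi⟩ := mem_seqSet.1 (h ▸ (mem_seqSet.2 ⟨⟨n, hlt⟩, rfl⟩ : _ ∈ seqSet s))
    rw [ZFSet.pair_inj, natSet_inj] at hi
    exact absurd i.2 (by simp [← hi.1])
  exact le_antisymm (key h) (key h.symm)

theorem seqSet_snoc {n : ℕ} (s : Fin n → ZFSet.{u}) (x : ZFSet.{u}) :
    seqSet (Fin.snoc (α := fun _ => ZFSet.{u}) s x) = insert (ZFSet.pair (natSet n) x) (seqSet s) := by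
  ext z
  rw [ZFSet.mem_insert_iff, mem_seqSet, mem_seqSet]
  constructor
  · rintro ⟨i, rfl⟩
    induction i using Fin.lastCases with
    | last => simp
    | cast i => exact Or.inr ⟨i, by simp⟩
  · rintro (rfl | ⟨i, rfl⟩)
    · exact ⟨Fin.last n, by simp⟩
    · exact ⟨i.castSucc, by simp⟩

/-- The sequence determines the number of variables, and then the code determines the formula, so
the pair has only one reading. -/
theorem pair_mem_Sat {M A : Set ZFSet.{u}} {n : ℕ} {φ : setLang.BoundedFormula Empty n}
    {v : Fin n → ZFSet.{u}} (hv : ∀ i, v i ∈ M) :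
    ZFSet.pair (fmlCode φ) (seqSet v) ∈ Sat M A ↔ realizeIn M A φ v := by
  constructor
  · rintro ⟨m, ψ, s, h, e⟩
    rw [ZFSet.pair_inj] at e
    obtain rfl := seqSet_length e.2
    rw [fmlCode_injective _ _ e.1, seqSet_injective e.2]
    exact (realize_iff_realizeIn _ _).1 h
  · exact fun h => ⟨n, φ, fun i => ⟨v i, hv i⟩, (realize_iff_realizeIn _ _).2 h, rfl⟩

/-! ## `L[A]` is an inner model -/

/-- The predicate `∅` is defined by a false formula, so a definition without predicate survives the
addition of any predicate `A`. -/
theorem Dfn.of_empty {N A : Set ZFSet.{u}} {D : Set ZFSet.{u}} (h : DefinableOver N ∅ D) :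
    Dfn N A fun x : El N => x.1 ∈ D := by
  obtain ⟨n, φ, s, hs, h⟩ := definableOver_iff_realizeIn.1 h
  exact Dfn.congr (Dfn.realizeIn_snoc subset_rfl Dfn.all_mem
    (Dfn.congr (Dfn.const False) fun x => by simp) φ s hs) fun x => h x.1 x.2

instance Dfn.subset {N A : Set ZFSet.{u}} [PairClosed N] {Γ : Type (u + 1)} [Ctx N Γ]
    {s t : Γ → ZFSet.{u}} [hs : DT N A s] [ht : DT N A t] : Dfn N A (fun γ => s γ ⊆ t γ) := by
  refine Dfn.subst₂ (p := fun x y => x ⊆ y) ?_ hs ht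
  exact Dfn.congr (q := fun z : El N × El N => ∀ w ∈ z.1.1, w ∈ z.2.1) inferInstance
    fun z => Iff.rfl

theorem Dfn.isTransitive {N A : Set ZFSet.{u}} [PairClosed N] {Γ : Type (u + 1)} [Ctx N Γ]
    {t : Γ → ZFSet.{u}} (ht : DT N A t) : Dfn N A (fun γ => (t γ).IsTransitive) := by
  refine Dfn.subst₁ (p := fun x => x.IsTransitive) ?_ ht
  exact Dfn.congr (q := fun z : El N => ∀ w ∈ z.1, w ⊆ z.1) inferInstance fun z => Iff.rfl

theorem Dfn.isOrdinal {N A : Set ZFSet.{u}} [PairClosed N] {Γ : Type (u + 1)} [Ctx N Γ]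
    {t : Γ → ZFSet.{u}} (ht : DT N A t) : Dfn N A (fun γ => (t γ).IsOrdinal) := by
  refine Dfn.subst₁ (p := fun x => x.IsOrdinal) ?_ ht
  have h1 : Dfn N A (fun z : El N => z.1.IsTransitive) := Dfn.isTransitive inferInstance
  have h2 : Dfn N A (fun z : El N × El N => z.2.1.IsTransitive) := Dfn.isTransitive inferInstance
  exact Dfn.congr (q := fun z : El N => z.1.IsTransitive ∧ ∀ w ∈ z.1, w.IsTransitive) inferInstance
    fun z => ZFSet.isOrdinal_iff_forall_mem_isTransitive

section
variable {A : Set ZFSet.{u}}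

theorem mem_defPowerset {x y : ZFSet.{u}} :
    y ∈ defPowerset A x ↔ y ⊆ x ∧ DefinableOver {z | z ∈ x} A {z | z ∈ y} := by
  simp [defPowerset]

theorem mem_constrLevel {o : Ordinal.{u}} {x : ZFSet.{u}} :
    x ∈ constrLevel A o ↔ ∃ a < o, x ∈ defPowerset A (constrLevel A a) := by
  rw [constrLevel]
  simp

theorem constrLevel_mono {a b : Ordinal.{u}} (h : a ≤ b) : constrLevel A a ⊆ constrLevel A b := by
  intro x hx
  obtain ⟨c, hc, hx⟩ := mem_constrLevel.1 hx
  exact mem_constrLevel.2 ⟨c, hc.trans_le h, hx⟩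

theorem constrLevel_trans {o : Ordinal.{u}} : (constrLevel A o).IsTransitive := by
  intro x hx y hy
  obtain ⟨a, ha, hx⟩ := mem_constrLevel.1 hx
  exact constrLevel_mono ha.le ((mem_defPowerset.1 hx).1 hy)

theorem constrLevel_mem (o : Ordinal.{u}) : constrLevel A o ∈ relConstructible A := by
  refine ⟨o + 1, mem_constrLevel.2 ⟨o, by simp, mem_defPowerset.2 ⟨subset_rfl, ?_⟩⟩⟩
  rw [definableOver_iff_dfn]
  exact Dfn.all_mem

/-- The levels at which the elements of a set appear form a small family of ordinals, hence are
bounded. -/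
theorem exists_subset_constrLevel {s : ZFSet.{u}} (hs : ∀ x ∈ s, x ∈ relConstructible A) :
    ∃ o, s ⊆ constrLevel A o := by
  choose f hf using fun x : s => hs x.1 x.2
  obtain ⟨o, ho⟩ := Ordinal.bddAbove_of_small (s := Set.range f)
  exact ⟨o, fun x hx => constrLevel_mono (ho ⟨⟨x, hx⟩, rfl⟩) (hf ⟨x, hx⟩)⟩

theorem relConstructible_trans {x y : ZFSet.{u}} (hx : x ∈ relConstructible A) (hy : y ∈ x) :
    y ∈ relConstructible A := by
  obtain ⟨o, ho⟩ := hx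
  exact ⟨o, constrLevel_trans x ho hy⟩

/-- There are only set-many formulas with parameters from `L_a[A]`, so levels chosen to contain
their counterexamples are bounded. All formulas are treated at once, since satisfaction in a class
structure is available in the ambient theory. -/
theorem exists_skolem_bound (a : Ordinal.{u}) : ∃ b, a ≤ b ∧
    ∀ (n : ℕ) (φ : setLang.BoundedFormula Empty (n + 1)) (v : Fin n → ZFSet.{u}),
      (∀ i, v i ∈ constrLevel A a) →
      (∃ x ∈ relConstructible A, ¬ realizeIn (relConstructible A) A φ (Fin.snoc v x)) →
      ∃ x ∈ constrLevel A b, ¬ realizeIn (relConstructible A) A φ (Fin.snoc v x) := by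
  classical
  let I := Σ n : ℕ, setLang.BoundedFormula Empty (n + 1) × (Fin n → constrLevel A a)
  have key : ∀ i : I, ∃ b, (∃ x ∈ relConstructible A,
      ¬ realizeIn (relConstructible A) A i.2.1 (Fin.snoc (fun j => (i.2.2 j).1) x)) →
      ∃ x ∈ constrLevel A b,
        ¬ realizeIn (relConstructible A) A i.2.1 (Fin.snoc (fun j => (i.2.2 j).1) x) := by
    intro i
    by_cases h : ∃ x ∈ relConstructible A,
      ¬ realizeIn (relConstructible A) A i.2.1 (Fin.snoc (fun j => (i.2.2 j).1) x)
    · obtain ⟨x, ⟨b, hb⟩, hx⟩ := h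
      exact ⟨b, fun _ => ⟨x, hb, hx⟩⟩
    -- Without a counterexample any level will do.
    · exact ⟨0, fun h' => absurd h' h⟩
  choose f hf using key
  obtain ⟨o, ho⟩ := Ordinal.bddAbove_of_small (s := Set.range f)
  refine ⟨max a o, le_max_left _ _, fun n φ v hv h => ?_⟩
  obtain ⟨x, hx, h'⟩ := hf ⟨n, φ, fun j => ⟨v j, hv j⟩⟩ h
  exact ⟨x, constrLevel_mono ((ho ⟨_, rfl⟩).trans (le_max_right _ _)) hx, h'⟩

/-- Reflection: there are arbitrarily large levels that are elementary in `⟨L[A], ∈, A⟩`. -/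
theorem exists_elementary_level (a : Ordinal.{u}) : ∃ b, a ≤ b ∧
    ∀ (n : ℕ) (φ : setLang.BoundedFormula Empty n) (v : Fin n → ZFSet.{u}),
      (∀ i, v i ∈ constrLevel A b) →
      (realizeIn {z | z ∈ constrLevel A b} A φ v ↔ realizeIn (relConstructible A) A φ v) := by
  choose f hle hf using exists_skolem_bound (A := A)
  -- The supremum of the `ω` iterates of the bound is closed under counterexamples, which is the
  -- Tarski–Vaught criterion.
  let g : ℕ → Ordinal.{u} := fun n => f^[n] a
  have hg : ∀ n, g (n + 1) = f (g n) := fun n => Function.iterate_succ_apply' _ _ _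
  have hmono : Monotone g := monotone_nat_of_le_succ fun n => by rw [hg]; exact hle _
  have hbdd := Ordinal.bddAbove_of_small (s := Set.range g)
  have hmem : ∀ x, x ∈ constrLevel A (⨆ n, g n) → ∃ n, x ∈ constrLevel A (g n) := by
    intro x hx
    obtain ⟨c, hc, hx⟩ := mem_constrLevel.1 hx
    obtain ⟨n, hn⟩ := (lt_ciSup_iff hbdd).1 hc
    exact ⟨n, mem_constrLevel.2 ⟨c, hn, hx⟩⟩
  refine ⟨⨆ n, g n, le_ciSup hbdd 0, fun n φ => ?_⟩
  induction φ with
  | falsum => exact fun v hv => Iff.rfl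
  | equal s t => exact fun v hv => Iff.rfl
  | rel r ts => cases r <;> exact fun v hv => Iff.rfl
  | imp φ ψ h1 h2 => exact fun v hv => imp_congr (h1 v hv) (h2 v hv)
  | @all n φ h =>
    intro v hv
    have hsnoc : ∀ x ∈ constrLevel A (⨆ n, g n), ∀ i,
        Fin.snoc (α := fun _ => ZFSet.{u}) v x i ∈ constrLevel A (⨆ n, g n) := by
      intro x hx i
      induction i using Fin.lastCases with
      | last => simpa using hx
      | cast i => simpa using hv i
    constructor
    · intro H
      by_contra hcon
      have hcon' : ∃ x ∈ relConstructible A,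
          ¬ realizeIn (relConstructible A) A φ (Fin.snoc (α := fun _ => ZFSet.{u}) v x) := by
        by_contra! h'
        exact hcon h'
      -- The finitely many parameters already lie in one stage `g M`, so a counterexample occurs at
      -- stage `M + 1`.
      choose m hm using fun i => hmem _ (hv i)
      obtain ⟨M, hM⟩ : ∃ M, ∀ i, m i ≤ M :=
        ⟨Finset.univ.sup m, fun i => Finset.le_sup (Finset.mem_univ i)⟩
      obtain ⟨x, hx, hx'⟩ := hf (g M) n φ v
        (fun i => constrLevel_mono (hmono (hM i)) (hm i)) hcon'
      rw [← hg] at hx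
      have hx2 : x ∈ constrLevel A (⨆ n, g n) := constrLevel_mono (le_ciSup hbdd _) hx
      exact hx' ((h _ (hsnoc x hx2)).1 (H x hx2))
    · intro H x hx
      exact (h _ (hsnoc x hx)).2 (H x ⟨_, hx⟩)

/-- By reflection the definition of `D` can be evaluated in an elementary level that contains `x`
and the parameters, so the subset of `x` appears one level later. The predicate `A` is allowed in
the definition. -/
theorem relConstructible_sep {D : Set ZFSet.{u}} (hD : DefinableOver (relConstructible A) A D)
    {x : ZFSet.{u}} (hx : x ∈ relConstructible A) :
    ZFSet.sep (fun z => z ∈ D) x ∈ relConstructible A := by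
  obtain ⟨n, φ, s, hs, h⟩ := definableOver_iff_realizeIn.1 hD
  obtain ⟨a, ha⟩ := exists_subset_constrLevel (A := A) (s := insert x (ZFSet.range s)) (by
    intro y hy
    rcases ZFSet.mem_insert_iff.1 hy with rfl | hy
    · exact hx
    · obtain ⟨i, rfl⟩ := ZFSet.mem_range.1 hy
      exact hs i)
  obtain ⟨b, hab, hb⟩ := exists_elementary_level (A := A) a
  have hxb : x ∈ constrLevel A b := constrLevel_mono hab (ha (by simp))
  have hsb : ∀ i, s i ∈ constrLevel A b := fun i => constrLevel_mono hab (ha (by simp))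
  refine ⟨b + 1, mem_constrLevel.2 ⟨b, by simp, mem_defPowerset.2 ⟨?_, ?_⟩⟩⟩
  · intro z hz
    exact constrLevel_trans _ hxb (ZFSet.mem_sep.1 hz).1
  · rw [definableOver_iff_dfn]
    have h1 : DT {z | z ∈ constrLevel A b} A (fun _ : El {z | z ∈ constrLevel A b} => x) :=
      DT.const hxb
    have h2 := Dfn.realizeIn_snoc (N := {z | z ∈ constrLevel A b}) (A := A) (B := A) subset_rfl
      Dfn.all_mem inferInstance φ s hsb
    refine Dfn.congr (q := fun z : El {z | z ∈ constrLevel A b} => z.1 ∈ x ∧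
      realizeIn {z | z ∈ constrLevel A b} A φ (Fin.snoc (α := fun _ => ZFSet.{u}) s z.1))
      inferInstance fun z => ?_
    simp only [Set.mem_ofPred_eq, ZFSet.mem_sep, and_congr_right_iff]
    intro hz
    rw [hb, h z.1 (relConstructible_trans hx hz)]
    intro i
    induction i using Fin.lastCases with
    | last => simpa using z.2
    | cast i => simpa using hsb i

theorem relConstructible_sep' {p : ZFSet.{u} → Prop}
    (hp : Dfn (relConstructible A) A fun z : El (relConstructible A) => p z.1)
    {x : ZFSet.{u}} (hx : x ∈ relConstructible A) : ZFSet.sep p x ∈ relConstructible A :=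
  relConstructible_sep (D := {z | p z}) (definableOver_iff_dfn.2 hp) hx

instance relConstructible_pairClosed : PairClosed (relConstructible A) where
  trans _ hx _ hy := relConstructible_trans hx hy
  pairing x hx y hy := by
    obtain ⟨o, ho⟩ := exists_subset_constrLevel (A := A) (s := {x, y}) (by simp [hx, hy])
    have h1 : Dfn (relConstructible A) A fun z : El (relConstructible A) => z.1 = x ∨ z.1 = y := by
      have := fun z => Dfn.eq_const (N := relConstructible A) (A := A)
        (fun γ : El (relConstructible A) => γ) z
      infer_instance
    convert relConstructible_sep' (p := fun z => z = x ∨ z = y) h1 (constrLevel_mem o) using 1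
    ext z
    simp only [ZFSet.mem_pair, ZFSet.mem_sep, iff_and_self]
    exact fun hz => ho (by simpa using hz)
  union x hx := by
    obtain ⟨o, ho⟩ := hx
    have h1 : DT (relConstructible A) A (fun _ : El (relConstructible A) × El (relConstructible A) => x) :=
      DT.const ⟨o, ho⟩
    have h2 : Dfn (relConstructible A) A fun z : El (relConstructible A) =>
      ∃ y : El (relConstructible A), y.1 ∈ x ∧ z.1 ∈ y.1 := inferInstance
    convert relConstructible_sep' (p := fun z => ∃ y : El (relConstructible A), y.1 ∈ x ∧ z ∈ y.1) h2
      (constrLevel_mem o) using 1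
    ext z
    simp only [ZFSet.mem_sUnion, ZFSet.mem_sep]
    constructor
    · rintro ⟨y, hy, hz⟩
      exact ⟨constrLevel_trans _ (constrLevel_trans _ ho hy) hz,
        ⟨y, relConstructible_trans ⟨o, ho⟩ hy⟩, hy, hz⟩
    · rintro ⟨-, y, hy, hz⟩
      exact ⟨y.1, hy, hz⟩

/-- If a level contains all smaller ordinals, its ordinals form an ordinal `T ∈ L[A]` that includes
`o`. Either `o = T`, or `o ∈ T` and then `o` is already in that level. -/
theorem toZFSet_mem_relConstructible (o : Ordinal.{u}) : o.toZFSet ∈ relConstructible A := by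
  induction o using WellFoundedLT.induction with
  | ind o ih =>
    obtain ⟨a, ha⟩ := exists_subset_constrLevel (A := A) (s := o.toZFSet) (by
      intro x hx
      obtain ⟨b, hb, rfl⟩ := Ordinal.mem_toZFSet_iff.1 hx
      exact ih b hb)
    have hT := relConstructible_sep' (A := A) (p := fun z => z.IsOrdinal)
      (Dfn.isOrdinal inferInstance) (constrLevel_mem a)
    set T := ZFSet.sep (fun z => z.IsOrdinal) (constrLevel A a) with hTdef
    have hTord : T.IsOrdinal := by
      rw [ZFSet.isOrdinal_iff_forall_mem_isOrdinal]
      refine ⟨fun x hx y hy => ?_, fun x hx => (ZFSet.mem_sep.1 hx).2⟩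
      obtain ⟨h1, h2⟩ := ZFSet.mem_sep.1 hx
      exact ZFSet.mem_sep.2 ⟨constrLevel_trans _ h1 hy, h2.mem hy⟩
    have hoT : o.toZFSet ⊆ T := by
      intro x hx
      exact ZFSet.mem_sep.2 ⟨ha hx, (ZFSet.isOrdinal_toZFSet o).mem hx⟩
    rcases ((ZFSet.isOrdinal_toZFSet o).subset_iff_eq_or_mem hTord).1 hoT with h | h
    · rwa [h]
    · exact ⟨a, (ZFSet.mem_sep.1 h).1⟩

theorem isInnerModel_relConstructible (A : Set ZFSet.{u}) : IsInnerModel (relConstructible A) where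
  transitive _ hx _ hy := relConstructible_trans hx hy
  ordinals := toZFSet_mem_relConstructible
  pairing := PairClosed.pairing
  union := PairClosed.union
  powerset x hx := by
    -- All constructible subsets of `x` lie in a single level, from which the power set is
    -- separated.
    obtain ⟨o, ho⟩ := exists_subset_constrLevel (A := A)
      (s := ZFSet.sep (fun y => y ∈ relConstructible A) x.powerset) (by simp)
    have h1 : DT (relConstructible A) A (fun _ : El (relConstructible A) => x) := DT.const hx
    convert relConstructible_sep' (A := A) (p := fun z => z ⊆ x) inferInstance
      (constrLevel_mem o) using 1
    ext z
    simp only [ZFSet.mem_sep, ZFSet.mem_powerset]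
    constructor
    · rintro ⟨h, h'⟩
      exact ⟨ho (by simp [h, h']), h⟩
    · rintro ⟨h, h'⟩
      exact ⟨h', o, h⟩
  separation D hD x hx := relConstructible_sep (definableOver_iff_dfn.2 (Dfn.of_empty hD)) hx
  replacement F hF x hx hex := by
    choose! f hf using fun a (ha : a ∈ x) => (hex a ha).exists
    obtain ⟨o, ho⟩ := exists_subset_constrLevel (A := A) (s := ZFSet.range fun a : x => f a.1) (by
      intro y hy
      obtain ⟨a, rfl⟩ := ZFSet.mem_range.1 hy
      exact (hf a.1 a.2).1)
    have h1 : DT (relConstructible A) ∅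
      (fun _ : El (relConstructible A) × El (relConstructible A) => x) := DT.const hx
    have hm : Mor (relConstructible A)
        (fun z : El (relConstructible A) × El (relConstructible A) => ![z.2, z.1]) :=
      Mor.tuple _ fun i => by fin_cases i <;> simp <;> infer_instance
    have h2 : Dfn (relConstructible A) ∅
        (fun z : El (relConstructible A) × El (relConstructible A) => F z.2.1 z.1.1) :=
      (relDefinableOver_iff_dfn.1 hF).reindex
        fun z : El (relConstructible A) × El (relConstructible A) => ![z.2, z.1]
    have h3 : Dfn (relConstructible A) ∅
      (fun z : El (relConstructible A) => z.1 ∈ {b | ∃ a : El (relConstructible A), a.1 ∈ x ∧ F a.1 b}) :=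
      Dfn.congr (q := fun z : El (relConstructible A) =>
        ∃ a : El (relConstructible A), a.1 ∈ x ∧ F a.1 z.1) inferInstance fun z => Iff.rfl
    refine ⟨_, relConstructible_sep' (Dfn.of_empty (definableOver_iff_dfn.2 h3)) (constrLevel_mem o),
      fun b => ?_⟩
    simp only [ZFSet.mem_sep, Set.mem_ofPred_eq]
    constructor
    · rintro ⟨hb, a, ha, hF⟩
      exact ⟨⟨o, hb⟩, a.1, ha, hF⟩
    · rintro ⟨hb, a, ha, hF⟩
      refine ⟨?_, ⟨a, relConstructible_trans hx ha⟩, ha, hF⟩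
      rw [(hex a ha).unique ⟨hb, hF⟩ (hf a ha)]
      exact ho (ZFSet.mem_range.2 ⟨⟨a, ha⟩, rfl⟩)

end

/-! ## Inner models: separation, replacement and recursion -/

section
variable {N A : Set ZFSet.{u}} {Γ : Type (u + 1)} [Ctx N Γ]

theorem DT.subst₁ {g : ZFSet.{u} → ZFSet.{u}} {t : Γ → ZFSet.{u}}
    (hg : DT N A fun z : El N => g z.1) (ht : DT N A t) : DT N A fun γ => g (t γ) := by
  refine ⟨fun γ => hg.mem ⟨t γ, ht.mem γ⟩, ?_⟩
  exact Dfn.subst₂ (p := fun y x => x = g y) (hg.graph) (ht.reindex fun z : Γ × El N => z.1)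
    inferInstance

instance pairClosed_of_fact [h : Fact (IsInnerModel N)] : PairClosed N := h.out.pairClosed

variable [hN : Fact (IsInnerModel N)]

theorem natSet_mem (n : ℕ) : natSet n ∈ N := hN.out.ordinals _

theorem omega_mem : ZFSet.omega ∈ N := by
  have : ZFSet.omega.{u} = Ordinal.omega0.toZFSet := by
    ext x
    rw [mem_omega_iff, Ordinal.mem_toZFSet_iff]
    constructor
    · rintro ⟨n, rfl⟩
      exact ⟨n, Ordinal.natCast_lt_omega0 n, rfl⟩
    · rintro ⟨a, ha, rfl⟩
      obtain ⟨n, rfl⟩ := Ordinal.lt_omega0.1 ha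
      exact ⟨n, rfl⟩
  rw [this]
  exact hN.out.ordinals _

instance DT.natSet (n : ℕ) : DT N A (fun _ : Γ => natSet n) := DT.const (natSet_mem n)

instance DT.omega : DT N A (fun _ : Γ => ZFSet.omega) := DT.const omega_mem

theorem empty_mem : (∅ : ZFSet.{u}) ∈ N := by
  have := natSet_mem (N := N) 0
  simpa [_root_.natSet] using this

theorem sep_mem_of_dfn {p : ZFSet.{u} → Prop} (hp : Dfn N ∅ fun z : El N => p z.1)
    {x : ZFSet.{u}} (hx : x ∈ N) : ZFSet.sep p x ∈ N :=
  hN.out.separation {z | p z} (definableOver_iff_dfn.2 hp) x hx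

theorem exists_replacement {F : ZFSet.{u} → ZFSet.{u} → Prop}
    (hF : Dfn N ∅ fun z : El N × El N => F z.1.1 z.2.1) {x : ZFSet.{u}} (hx : x ∈ N)
    {g : ZFSet.{u} → ZFSet.{u}} (hg : ∀ a ∈ x, g a ∈ N ∧ ∀ b, F a b ↔ b = g a) :
    ∃ y ∈ N, ∀ b, b ∈ y ↔ ∃ a ∈ x, b = g a := by
  obtain ⟨y, hy, h⟩ := hN.out.replacement F
    (relDefinableOver_iff_dfn.2 (hF.reindex fun v : Fin 2 → El N => (v 0, v 1))) x hx
    (fun a ha => ⟨g a, ⟨(hg a ha).1, ((hg a ha).2 _).2 rfl⟩, fun b hb => ((hg a ha).2 b).1 hb.2⟩)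
  refine ⟨y, hy, fun b => (h b).trans ⟨?_, ?_⟩⟩
  · rintro ⟨-, a, ha, hab⟩
    exact ⟨a, ha, ((hg a ha).2 b).1 hab⟩
  · rintro ⟨a, ha, rfl⟩
    exact ⟨(hg a ha).1, a, ha, ((hg a ha).2 _).2 rfl⟩

/-- `H` is closed under, and obeys, the recursion `f b = ⋃_{c ∈ b} Ψ (f c)`. -/
def RecApprox (N : Set ZFSet.{u}) (Ψ : ZFSet.{u} → ZFSet.{u}) (H : ZFSet.{u}) : Prop :=
  ∀ b u : El N, ZFSet.pair b.1 u.1 ∈ H →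
    (∀ z : El N, z.1 ∈ u.1 ↔ ∃ c w : El N, c.1 ∈ b.1 ∧ ZFSet.pair c.1 w.1 ∈ H ∧ z.1 ∈ Ψ w.1) ∧
    ∀ c ∈ b.1, ∃ w : El N, ZFSet.pair c w.1 ∈ H

/-- The function defined by the recursion `f b = ⋃_{c ∈ b} Ψ (f c)`, computed in `N`. -/
def RecGraph (N : Set ZFSet.{u}) (Ψ : ZFSet.{u} → ZFSet.{u}) (b u : ZFSet.{u}) : Prop :=
  ∃ H : El N, RecApprox N Ψ H.1 ∧ ZFSet.pair b u ∈ H.1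

theorem Dfn.recGraph {Ψ : ZFSet.{u} → ZFSet.{u}} (hΨ : DT N A fun z : El N => Ψ z.1) :
    Dfn N A fun z : El N × El N => RecGraph N Ψ z.1.1 z.2.1 := by
  have h1 : Dfn N A fun H : El N => RecApprox N Ψ H.1 := by
    unfold RecApprox
    have : DT N A (fun z : ((((El N × El N) × El N) × El N) × El N) × El N => Ψ z.2.1) :=
      DT.subst₁ hΨ inferInstance
    infer_instance
  have h2 : Dfn N A fun z : (El N × El N) × El N => RecApprox N Ψ z.2.1 :=
    h1.reindex fun z : (El N × El N) × El N => z.2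
  unfold RecGraph
  infer_instance

variable {Ψ f : ZFSet.{u} → ZFSet.{u}}

/-- By ∈-induction on the argument: the second clause of an approximation provides values at all
members of `b`, and these are correct by induction. Functionality of `H` follows and need not be
required. -/
theorem RecApprox.eq (hΨ : ∀ w ∈ N, Ψ w ∈ N) (hf : ∀ b z, z ∈ f b ↔ ∃ c ∈ b, z ∈ Ψ (f c))
    {H : ZFSet.{u}} (hH : H ∈ N) (h : RecApprox N Ψ H) :
    ∀ {b u : ZFSet.{u}}, ZFSet.pair b u ∈ H → u = f b := by
  intro b
  induction b using ZFSet.inductionOn with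
  | _ b ih =>
    intro u hbu
    obtain ⟨hb, hu⟩ := PairClosed.mem_of_pair_mem hH hbu
    obtain ⟨h1, h2⟩ := h ⟨b, hb⟩ ⟨u, hu⟩ hbu
    ext z
    rw [hf]
    constructor
    · intro hz
      obtain ⟨c, w, hc, hcw, hzw⟩ := (h1 ⟨z, PairClosed.trans _ hu z hz⟩).1 hz
      rw [ih c.1 hc hcw] at hzw
      exact ⟨c.1, hc, hzw⟩
    · rintro ⟨c, hc, hz⟩
      obtain ⟨w, hcw⟩ := h2 c hc
      rw [← ih c hc hcw] at hz
      exact (h1 ⟨z, PairClosed.trans _ (hΨ _ w.2) z hz⟩).2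
        ⟨⟨c, PairClosed.trans _ hb c hc⟩, w, hc, hcw, hz⟩

theorem RecGraph.eq (hΨ : ∀ w ∈ N, Ψ w ∈ N) (hf : ∀ b z, z ∈ f b ↔ ∃ c ∈ b, z ∈ Ψ (f c))
    {b u : ZFSet.{u}} (h : RecGraph N Ψ b u) : u = f b ∧ f b ∈ N := by
  obtain ⟨H, h1, h2⟩ := h
  have := h1.eq hΨ hf H.2 h2
  exact ⟨this, this ▸ (PairClosed.mem_of_pair_mem H.2 h2).2⟩

/-- The usual recursion theorem inside `N`. The part `t₀` of `t` where the recursion succeeds is a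
set of `N` by separation. If all members of `x` are in `t₀`, replacement collects the values on `t₀`
into one approximation, which is then extended to `x`. -/
theorem recGraph_of_mem (hΨ : DT N ∅ fun z : El N => Ψ z.1)
    (hf : ∀ b z, z ∈ f b ↔ ∃ c ∈ b, z ∈ Ψ (f c)) {t : ZFSet.{u}} (ht : t ∈ N)
    (htr : t.IsTransitive) {x : ZFSet.{u}} (hx : x ∈ t) : RecGraph N Ψ x (f x) := by
  have hΨN : ∀ w ∈ N, Ψ w ∈ N := fun w hw => hΨ.mem ⟨w, hw⟩
  have hG := Dfn.recGraph hΨ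
  have hG' : Dfn N ∅ (fun z : El N => ∃ u : El N, RecGraph N Ψ z.1 u.1) := inferInstance
  set t₀ := ZFSet.sep (fun z => ∃ u : El N, RecGraph N Ψ z u.1) t with ht₀
  have ht₀N : t₀ ∈ N := sep_mem_of_dfn (p := fun z => ∃ u : El N, RecGraph N Ψ z u.1) hG' ht
  have hrec : ∀ c ∈ t₀, f c ∈ N ∧ RecGraph N Ψ c (f c) := by
    intro c hc
    obtain ⟨-, u, hu⟩ := ZFSet.mem_sep.1 hc
    obtain ⟨h1, h2⟩ := hu.eq hΨN hf
    exact ⟨h2, h1 ▸ hu⟩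
  have htr₀ : t₀.IsTransitive := by
    intro y hy c hc
    obtain ⟨hyt, u, H, hH, hyu⟩ := ZFSet.mem_sep.1 hy
    obtain ⟨w, hw⟩ := (hH ⟨y, PairClosed.trans _ ht y hyt⟩ u hyu).2 c hc
    exact ZFSet.mem_sep.2 ⟨htr y hyt hc, w, H, hH, hw⟩
  suffices h : ∀ x, x ∈ t → x ∈ t₀ from (hrec x (h x hx)).2
  intro x
  induction x using ZFSet.inductionOn with
  | _ x ih =>
    intro hx
    have hxN := PairClosed.trans _ ht x hx
    have hsub : ∀ c ∈ x, c ∈ t₀ := fun c hc => ih c hc (htr x hx hc)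
    -- The values are collected over all of `t₀` and not just over `x`, because an approximation
    -- must have a domain closed under members.
    obtain ⟨H₀, hH₀N, hH₀⟩ := exists_replacement (N := N)
      (F := fun c e => ∃ u : El N, RecGraph N Ψ c u.1 ∧ e = ZFSet.pair c u.1)
      (by
        have : Dfn N ∅ (fun z : (El N × El N) × El N => RecGraph N Ψ z.1.1.1 z.2.1) :=
          hG.reindex fun z : (El N × El N) × El N => (z.1.1, z.2)
        infer_instance) ht₀N (g := fun c => ZFSet.pair c (f c)) (by
        intro c hc
        obtain ⟨h1, h2⟩ := hrec c hc
        refine ⟨PairClosed.pair_mem (PairClosed.trans _ ht₀N c hc) h1, fun e => ⟨?_, ?_⟩⟩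
        · rintro ⟨u, hu, rfl⟩
          rw [(hu.eq hΨN hf).1]
        · rintro rfl
          exact ⟨⟨f c, h1⟩, h2, rfl⟩)
    -- `f x` is the union of the sets `Ψ (f c)` with `c ∈ x`, so a second use of replacement shows
    -- that it belongs to `N`.
    obtain ⟨Y, hYN, hY⟩ := exists_replacement (N := N)
      (F := fun c e => ∃ u : El N, RecGraph N Ψ c u.1 ∧ e = Ψ u.1)
      (by
        have : Dfn N ∅ (fun z : (El N × El N) × El N => RecGraph N Ψ z.1.1.1 z.2.1) :=
          hG.reindex fun z : (El N × El N) × El N => (z.1.1, z.2)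
        have : DT N ∅ (fun z : (El N × El N) × El N => Ψ z.2.1) := DT.subst₁ hΨ inferInstance
        infer_instance) hxN (g := fun c => Ψ (f c)) (by
        intro c hc
        obtain ⟨h1, h2⟩ := hrec c (hsub c hc)
        refine ⟨hΨN _ h1, fun e => ⟨?_, ?_⟩⟩
        · rintro ⟨u, hu, rfl⟩
          rw [(hu.eq hΨN hf).1]
        · rintro rfl
          exact ⟨⟨f c, h1⟩, h2, rfl⟩)
    have hfx : f x = ZFSet.sUnion Y := by
      ext z
      rw [hf, ZFSet.mem_sUnion]
      constructor
      · rintro ⟨c, hc, hz⟩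
        exact ⟨_, (hY _).2 ⟨c, hc, rfl⟩, hz⟩
      · rintro ⟨y, hy, hz⟩
        obtain ⟨c, hc, rfl⟩ := (hY _).1 hy
        exact ⟨c, hc, hz⟩
    have hfxN : f x ∈ N := hfx ▸ PairClosed.union _ hYN
    have hmem : ∀ b u, ZFSet.pair b u ∈ (insert (ZFSet.pair x (f x)) H₀ : ZFSet.{u}) →
        u = f b ∧ ∀ c ∈ b, c ∈ t₀ := by
      intro b u h
      rcases ZFSet.mem_insert_iff.1 h with h | h
      · obtain ⟨rfl, rfl⟩ := ZFSet.pair_inj.1 h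
        exact ⟨rfl, hsub⟩
      · obtain ⟨c, hc, h⟩ := (hH₀ _).1 h
        obtain ⟨rfl, rfl⟩ := ZFSet.pair_inj.1 h
        exact ⟨rfl, fun d hd => htr₀ _ hc hd⟩
    have hmem' : ∀ c ∈ t₀, ZFSet.pair c (f c) ∈ (insert (ZFSet.pair x (f x)) H₀ : ZFSet.{u}) :=
      fun c hc => ZFSet.mem_insert_of_mem _ ((hH₀ _).2 ⟨c, hc, rfl⟩)
    refine ZFSet.mem_sep.2 ⟨hx, ⟨f x, hfxN⟩,
      ⟨_, PairClosed.insert_mem (PairClosed.pair_mem hxN hfxN) hH₀N⟩, ?_, ZFSet.mem_insert _ _⟩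
    intro b u hbu
    obtain ⟨hu, hb⟩ := hmem _ _ hbu
    refine ⟨fun z => ?_, fun c hc => ⟨⟨f c, (hrec c (hb c hc)).1⟩, hmem' c (hb c hc)⟩⟩
    rw [hu, hf]
    constructor
    · rintro ⟨c, hc, hz⟩
      exact ⟨⟨c, PairClosed.trans _ b.2 c hc⟩, ⟨f c, (hrec c (hb c hc)).1⟩, hc,
        hmem' c (hb c hc), hz⟩
    · rintro ⟨c, w, hc, hcw, hz⟩
      exact ⟨c.1, hc, (hmem _ _ hcw).1 ▸ hz⟩

end

/-! ## Definable subsets inside inner models -/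

/-- `s` is a sequence of elements of `x`, of length `n`. -/
def IsSeqOn (n x s : ZFSet.{u}) : Prop :=
  (∀ z ∈ s, ∃ i ∈ n, ∃ t ∈ x, z = ZFSet.pair i t) ∧
    ∀ i ∈ n, ∃ t ∈ x, ZFSet.pair i t ∈ s ∧ ∀ t' ∈ x, ZFSet.pair i t' ∈ s → t' = t

theorem isSeqOn_natSet {n : ℕ} {x s : ZFSet.{u}} :
    IsSeqOn (natSet n) x s ↔ ∃ v : Fin n → ZFSet.{u}, (∀ i, v i ∈ x) ∧ s = seqSet v := by
  constructor
  · rintro ⟨h1, h2⟩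
    choose v hv hvs huniq using fun i : Fin n => h2 (natSet i) (mem_natSet.2 ⟨i, i.2, rfl⟩)
    refine ⟨v, hv, ?_⟩
    ext z
    rw [mem_seqSet]
    constructor
    · intro hz
      obtain ⟨i, hi, t, ht, rfl⟩ := h1 z hz
      obtain ⟨m, hm, rfl⟩ := mem_natSet.1 hi
      exact ⟨⟨m, hm⟩, by rw [← huniq ⟨m, hm⟩ t ht hz]⟩
    · rintro ⟨i, rfl⟩
      exact hvs i
  · rintro ⟨v, hv, rfl⟩
    constructor
    · intro z hz
      obtain ⟨i, rfl⟩ := mem_seqSet.1 hz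
      exact ⟨_, mem_natSet.2 ⟨i, i.2, rfl⟩, _, hv i, rfl⟩
    · intro i hi
      obtain ⟨m, hm, rfl⟩ := mem_natSet.1 hi
      refine ⟨v ⟨m, hm⟩, hv _, pair_mem_seqSet (i := ⟨m, hm⟩).2 rfl, fun t' _ h => ?_⟩
      exact pair_mem_seqSet (i := ⟨m, hm⟩).1 h

theorem isSeqOn_seqSet {n : ℕ} {x : ZFSet.{u}} {v : Fin n → ZFSet.{u}} :
    IsSeqOn (natSet n) x (seqSet v) ↔ ∀ i, v i ∈ x := by
  rw [isSeqOn_natSet]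
  constructor
  · rintro ⟨w, hw, h⟩
    rwa [seqSet_injective h]
  · exact fun h => ⟨v, h, rfl⟩

/-- The local correctness of an item `⟨n, ⟨c, S⟩⟩` of a set `X`: if `c` codes a formula in the
variables `v_0, …, v_{n-1}`, then `S` is the set of sequences satisfying it in `⟨x, ∈, R⟩`, provided
this holds for the items of `X` for the immediate subformulas. -/
def CertStep (N : Set ZFSet.{u}) (R x X n c S : ZFSet.{u}) : Prop :=
  n ∈ ZFSet.omega ∧ (∀ s ∈ S, IsSeqOn n x s) ∧
  ((c = ZFSet.pair (natSet 0) (natSet 0) ∧ ∀ s : El N, IsSeqOn n x s.1 → s.1 ∉ S) ∨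
   (∃ i ∈ n, ∃ j ∈ n, c = ZFSet.pair (natSet 1) (ZFSet.pair i j) ∧
     ∀ s : El N, IsSeqOn n x s.1 → (s.1 ∈ S ↔ ∃ a ∈ x, ZFSet.pair i a ∈ s.1 ∧ ZFSet.pair j a ∈ s.1)) ∨
   (∃ i ∈ n, ∃ j ∈ n, c = ZFSet.pair (natSet 2) (ZFSet.pair i j) ∧
     ∀ s : El N, IsSeqOn n x s.1 →
      (s.1 ∈ S ↔ ∃ a ∈ x, ∃ b ∈ x, ZFSet.pair i a ∈ s.1 ∧ ZFSet.pair j b ∈ s.1 ∧ a ∈ b)) ∨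
   (∃ i ∈ n, c = ZFSet.pair (natSet 3) i ∧
     ∀ s : El N, IsSeqOn n x s.1 → (s.1 ∈ S ↔ ∃ a ∈ x, ZFSet.pair i a ∈ s.1 ∧ a ∈ R)) ∨
   (∃ a b S₁ S₂ : El N, c = ZFSet.pair (natSet 4) (ZFSet.pair a.1 b.1) ∧
     ZFSet.pair n (ZFSet.pair a.1 S₁.1) ∈ X ∧ ZFSet.pair n (ZFSet.pair b.1 S₂.1) ∈ X ∧
     ∀ s : El N, IsSeqOn n x s.1 → (s.1 ∈ S ↔ (s.1 ∈ S₁.1 → s.1 ∈ S₂.1))) ∨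
   (∃ a S₁ : El N, c = ZFSet.pair (natSet 5) a.1 ∧
     ZFSet.pair (insert n n) (ZFSet.pair a.1 S₁.1) ∈ X ∧
     ∀ s : El N, IsSeqOn n x s.1 →
      (s.1 ∈ S ↔ ∀ t ∈ x, (insert (ZFSet.pair n t) s.1 : ZFSet.{u}) ∈ S₁.1)))

/-- `X` is a locally correct set of items. -/
def IsCert (N : Set ZFSet.{u}) (R x X : ZFSet.{u}) : Prop :=
  ∀ n c S : El N, ZFSet.pair n.1 (ZFSet.pair c.1 S.1) ∈ X → CertStep N R x X n.1 c.1 S.1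

/-- `S` is the set of the sequences satisfying the formula with code `c` in `⟨x, ∈, R⟩`. -/
def IsTruthSet (N : Set ZFSet.{u}) (R x n c S : ZFSet.{u}) : Prop :=
  ∃ X : El N, IsCert N R x X.1 ∧ ZFSet.pair n (ZFSet.pair c S) ∈ X.1

/-! ### Absoluteness of satisfaction in set structures for inner models -/

section
variable {N A : Set ZFSet.{u}} {Γ : Type (u + 1)} [Ctx N Γ] [hN : Fact (IsInnerModel N)]

instance Dfn.isSeqOn {n x s : Γ → ZFSet.{u}} [hn : DT N A n] [hx : DT N A x] [hs : DT N A s] :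
    Dfn N A fun γ => IsSeqOn (n γ) (x γ) (s γ) := by
  refine Dfn.subst₃ (p := IsSeqOn) ?_ hn hx hs
  unfold IsSeqOn
  infer_instance

set_option synthInstance.maxHeartbeats 2000000 in
set_option maxHeartbeats 2000000 in
theorem Dfn.isCert : Dfn N A fun z : El N × El N × El N => IsCert N z.1.1 z.2.1.1 z.2.2.1 := by
  unfold IsCert CertStep
  infer_instance

instance Dfn.isTruthSet {R x n c S : Γ → ZFSet.{u}} [hR : DT N A R] [hx : DT N A x]
    [hn : DT N A n] [hc : DT N A c] [hS : DT N A S] :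
    Dfn N A fun γ => IsTruthSet N (R γ) (x γ) (n γ) (c γ) (S γ) := by
  have := hR.reindex fun z : Γ × El N => z.1
  have := hx.reindex fun z : Γ × El N => z.1
  have := hn.reindex fun z : Γ × El N => z.1
  have := hc.reindex fun z : Γ × El N => z.1
  have := hS.reindex fun z : Γ × El N => z.1
  have : Dfn N A fun z : Γ × El N => IsCert N (R z.1) (x z.1) z.2.1 :=
    Dfn.subst₃ (p := IsCert N) Dfn.isCert inferInstance inferInstance inferInstance
  unfold IsTruthSet
  infer_instance

theorem rank_fst_lt_pair (a b : ZFSet.{u}) : a.rank < (ZFSet.pair a b).rank := by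
  have h1 : a ∈ ({a, b} : ZFSet.{u}) := by simp
  have h2 : ({a, b} : ZFSet.{u}) ∈ ZFSet.pair a b := by simp [ZFSet.pair]
  exact (ZFSet.rank_lt_of_mem h1).trans (ZFSet.rank_lt_of_mem h2)

theorem rank_snd_lt_pair (a b : ZFSet.{u}) : b.rank < (ZFSet.pair a b).rank := by
  have h1 : b ∈ ({a, b} : ZFSet.{u}) := by simp
  have h2 : ({a, b} : ZFSet.{u}) ∈ ZFSet.pair a b := by simp [ZFSet.pair]
  exact (ZFSet.rank_lt_of_mem h1).trans (ZFSet.rank_lt_of_mem h2)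

theorem seqSet_mem {n : ℕ} {v : Fin n → ZFSet.{u}} (hv : ∀ i, v i ∈ N) : seqSet v ∈ N := by
  induction n with
  | zero =>
    have : seqSet v = ∅ := by
      ext z
      rw [mem_seqSet]
      simp
    rw [this]
    exact empty_mem
  | succ n ih =>
    rw [← Fin.snoc_init_self v, seqSet_snoc]
    exact PairClosed.insert_mem (PairClosed.pair_mem (natSet_mem n) (hv _)) (ih fun i => hv _)

theorem fmlCode_mem {n : ℕ} (φ : setLang.BoundedFormula Empty n) : fmlCode φ ∈ N := by
  induction φ with
  | falsum => exact PairClosed.pair_mem (natSet_mem _) (natSet_mem _)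
  | equal => exact PairClosed.pair_mem (natSet_mem _) (PairClosed.pair_mem (natSet_mem _) (natSet_mem _))
  | rel r ts =>
    cases r with
    | mem => exact PairClosed.pair_mem (natSet_mem _) (PairClosed.pair_mem (natSet_mem _) (natSet_mem _))
    | pred => exact PairClosed.pair_mem (natSet_mem _) (natSet_mem _)
  | imp φ ψ h1 h2 => exact PairClosed.pair_mem (natSet_mem _) (PairClosed.pair_mem h1 h2)
  | all φ h => exact PairClosed.pair_mem (natSet_mem _) h

/-- The set `S` consists of the sequences satisfying `φ` in `⟨x, ∈, R⟩`. -/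
def IsTruthSetFor (R x S : ZFSet.{u}) {n : ℕ} (φ : setLang.BoundedFormula Empty n) : Prop :=
  (∀ s ∈ S, IsSeqOn (natSet n) x s) ∧ ∀ v : Fin n → ZFSet.{u}, (∀ i, v i ∈ x) →
    (seqSet v ∈ S ↔ realizeIn {z | z ∈ x} {z | z ∈ R} φ v)

/-- Finite sequences of elements of `N` belong to `N`, so conditions on the sequences lying in `N`
already cover all tuples from `x`. -/
theorem IsTruthSetFor.congr {R x S : ZFSet.{u}} {n : ℕ} {φ : setLang.BoundedFormula Empty n}
    (hx : x ∈ N) {p : ZFSet.{u} → Prop} (hS : ∀ s ∈ S, IsSeqOn (natSet n) x s)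
    (h : ∀ s : El N, IsSeqOn (natSet n) x s.1 → (s.1 ∈ S ↔ p s.1))
    (hp : ∀ v : Fin n → ZFSet.{u}, (∀ i, v i ∈ x) →
      (p (seqSet v) ↔ realizeIn {z | z ∈ x} {z | z ∈ R} φ v)) : IsTruthSetFor R x S φ := by
  refine ⟨hS, fun v hv => ?_⟩
  rw [← hp v hv]
  exact h ⟨_, seqSet_mem fun i => PairClosed.trans _ hx _ (hv i)⟩ (isSeqOn_seqSet.2 hv)

theorem exists_mem_pair_seqSet {n : ℕ} {v : Fin n → ZFSet.{u}} {x : ZFSet.{u}} (hv : ∀ i, v i ∈ x)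
    {i : ℕ} (hi : i < n) {p : ZFSet.{u} → Prop} :
    (∃ a ∈ x, ZFSet.pair (natSet i) a ∈ seqSet v ∧ p a) ↔ p (v ⟨i, hi⟩) := by
  have : ∀ a, ZFSet.pair (natSet i) a ∈ seqSet v ↔ a = v ⟨i, hi⟩ :=
    fun a => pair_mem_seqSet (i := ⟨i, hi⟩)
  simp only [this]
  constructor
  · rintro ⟨a, -, rfl, h⟩
    exact h
  · exact fun h => ⟨_, hv _, rfl, h⟩

theorem exists_mem_pair_seqSet₂ {n : ℕ} {v : Fin n → ZFSet.{u}} {x : ZFSet.{u}} (hv : ∀ i, v i ∈ x)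
    {i j : ℕ} (hi : i < n) (hj : j < n) :
    (∃ a ∈ x, ∃ b ∈ x, ZFSet.pair (natSet i) a ∈ seqSet v ∧ ZFSet.pair (natSet j) b ∈ seqSet v ∧
      a ∈ b) ↔ v ⟨i, hi⟩ ∈ v ⟨j, hj⟩ := by
  have h1 : ∀ a, ZFSet.pair (natSet i) a ∈ seqSet v ↔ a = v ⟨i, hi⟩ :=
    fun a => pair_mem_seqSet (i := ⟨i, hi⟩)
  have h2 : ∀ a, ZFSet.pair (natSet j) a ∈ seqSet v ↔ a = v ⟨j, hj⟩ :=
    fun a => pair_mem_seqSet (i := ⟨j, hj⟩)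
  simp only [h1, h2]
  constructor
  · rintro ⟨a, -, b, -, rfl, rfl, h⟩
    exact h
  · exact fun h => ⟨_, hv _, _, hv _, rfl, rfl, h⟩

theorem forall_snoc_mem_class {N : Set ZFSet.{u}} {n : ℕ} {v : Fin n → ZFSet.{u}} {t : ZFSet.{u}}
    (hv : ∀ i, v i ∈ N) (ht : t ∈ N) (i : Fin (n + 1)) :
    Fin.snoc (α := fun _ => ZFSet.{u}) v t i ∈ N := by
  induction i using Fin.lastCases with
  | last => rwa [Fin.snoc_last]
  | cast i => rw [Fin.snoc_castSucc]; exact hv i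

theorem forall_snoc_mem {n : ℕ} {v : Fin n → ZFSet.{u}} {x t : ZFSet.{u}} (hv : ∀ i, v i ∈ x)
    (ht : t ∈ x) (i : Fin (n + 1)) : Fin.snoc (α := fun _ => ZFSet.{u}) v t i ∈ x :=
  forall_snoc_mem_class (N := {z | z ∈ x}) hv ht i

theorem mem_natSet_iff_exists_term {n : ℕ} {i : ZFSet.{u}} : i ∈ natSet n ↔
    ∃ t : setLang.Term (Empty ⊕ Fin n), i = natSet (varIndex t) := by
  rw [mem_natSet]
  constructor
  · rintro ⟨m, hm, rfl⟩
    exact ⟨.var (.inr ⟨m, hm⟩), rfl⟩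
  · rintro ⟨t, rfl⟩
    exact ⟨_, by rw [varIndex_eq]; exact (termVar t).2, rfl⟩

theorem IsTruthSetFor.equal {R x S : ZFSet.{u}} {n : ℕ} (hx : x ∈ N)
    (s t : setLang.Term (Empty ⊕ Fin n)) (hS : ∀ s ∈ S, IsSeqOn (natSet n) x s)
    (h : ∀ w : El N, IsSeqOn (natSet n) x w.1 → (w.1 ∈ S ↔ ∃ a ∈ x,
      ZFSet.pair (natSet (varIndex s)) a ∈ w.1 ∧ ZFSet.pair (natSet (varIndex t)) a ∈ w.1)) :
    IsTruthSetFor R x S (.equal s t) := by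
  refine IsTruthSetFor.congr hx hS (p := fun w => ∃ a ∈ x,
    ZFSet.pair (natSet (varIndex s)) a ∈ w ∧ ZFSet.pair (natSet (varIndex t)) a ∈ w) h fun v hv => ?_
  rw [varIndex_eq, varIndex_eq, exists_mem_pair_seqSet hv (termVar s).2, pair_mem_seqSet]
  rfl

theorem IsTruthSetFor.mem {R x S : ZFSet.{u}} {n : ℕ} (hx : x ∈ N)
    (ts : Fin 2 → setLang.Term (Empty ⊕ Fin n)) (hS : ∀ s ∈ S, IsSeqOn (natSet n) x s)
    (h : ∀ w : El N, IsSeqOn (natSet n) x w.1 → (w.1 ∈ S ↔ ∃ a ∈ x, ∃ b ∈ x,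
      ZFSet.pair (natSet (varIndex (ts 0))) a ∈ w.1 ∧
      ZFSet.pair (natSet (varIndex (ts 1))) b ∈ w.1 ∧ a ∈ b)) :
    IsTruthSetFor R x S (.rel SetSymbol.mem ts) := by
  refine IsTruthSetFor.congr hx hS (p := fun w => ∃ a ∈ x, ∃ b ∈ x,
    ZFSet.pair (natSet (varIndex (ts 0))) a ∈ w ∧ ZFSet.pair (natSet (varIndex (ts 1))) b ∈ w ∧
    a ∈ b) h fun v hv => ?_
  rw [varIndex_eq, varIndex_eq, exists_mem_pair_seqSet₂ hv (termVar _).2 (termVar _).2]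
  rfl

theorem IsTruthSetFor.pred {R x S : ZFSet.{u}} {n : ℕ} (hx : x ∈ N)
    (ts : Fin 1 → setLang.Term (Empty ⊕ Fin n)) (hS : ∀ s ∈ S, IsSeqOn (natSet n) x s)
    (h : ∀ w : El N, IsSeqOn (natSet n) x w.1 → (w.1 ∈ S ↔ ∃ a ∈ x,
      ZFSet.pair (natSet (varIndex (ts 0))) a ∈ w.1 ∧ a ∈ R)) :
    IsTruthSetFor R x S (.rel SetSymbol.pred ts) := by
  refine IsTruthSetFor.congr hx hS (p := fun w => ∃ a ∈ x,
    ZFSet.pair (natSet (varIndex (ts 0))) a ∈ w ∧ a ∈ R) h fun v hv => ?_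
  rw [varIndex_eq, exists_mem_pair_seqSet hv (termVar _).2]
  rfl

theorem IsTruthSetFor.imp {R x S S₁ S₂ : ZFSet.{u}} {n : ℕ} (hx : x ∈ N)
    {φ ψ : setLang.BoundedFormula Empty n} (hφ : IsTruthSetFor R x S₁ φ)
    (hψ : IsTruthSetFor R x S₂ ψ) (hS : ∀ s ∈ S, IsSeqOn (natSet n) x s)
    (h : ∀ w : El N, IsSeqOn (natSet n) x w.1 → (w.1 ∈ S ↔ (w.1 ∈ S₁ → w.1 ∈ S₂))) :
    IsTruthSetFor R x S (.imp φ ψ) :=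
  IsTruthSetFor.congr hx hS (p := fun w => w ∈ S₁ → w ∈ S₂) h
    fun v hv => imp_congr (hφ.2 v hv) (hψ.2 v hv)

theorem IsTruthSetFor.all {R x S S₁ : ZFSet.{u}} {n : ℕ} (hx : x ∈ N)
    {φ : setLang.BoundedFormula Empty (n + 1)} (hφ : IsTruthSetFor R x S₁ φ)
    (hS : ∀ s ∈ S, IsSeqOn (natSet n) x s)
    (h : ∀ w : El N, IsSeqOn (natSet n) x w.1 → (w.1 ∈ S ↔ ∀ t ∈ x,
      (insert (ZFSet.pair (natSet n) t) w.1 : ZFSet.{u}) ∈ S₁)) :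
    IsTruthSetFor R x S (.all φ) := by
  refine IsTruthSetFor.congr hx hS (p := fun w => ∀ t ∈ x,
      (insert (ZFSet.pair (natSet n) t) w : ZFSet.{u}) ∈ S₁) h fun v hv => ?_
  refine forall₂_congr fun t ht => ?_
  rw [← seqSet_snoc]
  exact hφ.2 _ (forall_snoc_mem hv ht)

/-- Induction on the rank of the code: the same certificate vouches for the subcodes, which have
smaller rank. Well-foundedness and the standard `ω` ensure that only codes of actual formulas can be
certified. -/
theorem IsTruthSet.sound {R x : ZFSet.{u}} (hx : x ∈ N) (o : Ordinal.{u}) :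
    ∀ {n c S : ZFSet.{u}}, c.rank = o → IsTruthSet N R x n c S →
    ∃ (k : ℕ) (φ : setLang.BoundedFormula Empty k), n = natSet k ∧ c = fmlCode φ ∧
      IsTruthSetFor R x S φ := by
  induction o using WellFoundedLT.induction with
  | ind o ih =>
    rintro n c S rfl ⟨X, hX, hmem⟩
    obtain ⟨hnN, hcS⟩ := PairClosed.mem_of_pair_mem X.2 hmem
    obtain ⟨hcN, hSN⟩ := PairClosed.of_pair_mem hcS
    obtain ⟨hn, hS, h⟩ := hX ⟨n, hnN⟩ ⟨c, hcN⟩ ⟨S, hSN⟩ hmem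
    dsimp only at hn hS h
    obtain ⟨k, rfl⟩ := mem_omega_iff.1 hn
    rcases h with ⟨rfl, h⟩ | ⟨i, hi, j, hj, rfl, h⟩ | ⟨i, hi, j, hj, rfl, h⟩ | ⟨i, hi, rfl, h⟩ |
      ⟨a, b, S₁, S₂, rfl, h1, h2, h⟩ | ⟨a, S₁, rfl, h1, h⟩
    · exact ⟨k, .falsum, rfl, rfl, IsTruthSetFor.congr hx (p := fun _ => False) hS
        (fun s hs => by simpa using h s hs) fun v hv => Iff.rfl⟩
    · obtain ⟨s, rfl⟩ := mem_natSet_iff_exists_term.1 hi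
      obtain ⟨t, rfl⟩ := mem_natSet_iff_exists_term.1 hj
      exact ⟨k, .equal s t, rfl, rfl, .equal hx s t hS h⟩
    · obtain ⟨s, rfl⟩ := mem_natSet_iff_exists_term.1 hi
      obtain ⟨t, rfl⟩ := mem_natSet_iff_exists_term.1 hj
      exact ⟨k, .rel SetSymbol.mem ![s, t], rfl, rfl, .mem hx ![s, t] hS h⟩
    · obtain ⟨s, rfl⟩ := mem_natSet_iff_exists_term.1 hi
      exact ⟨k, .rel SetSymbol.pred ![s], rfl, rfl, .pred hx ![s] hS h⟩
    · obtain ⟨k₁, φ, e, ha, hφ⟩ := ih _ ((rank_fst_lt_pair _ _).trans (rank_snd_lt_pair _ _)) rfl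
        ⟨X, hX, h1⟩
      obtain rfl := natSet_inj.1 e
      obtain ⟨k₂, ψ, e, hb, hψ⟩ := ih _ ((rank_snd_lt_pair _ _).trans (rank_snd_lt_pair _ _)) rfl
        ⟨X, hX, h2⟩
      obtain rfl := natSet_inj.1 e
      exact ⟨k, .imp φ ψ, rfl, by rw [ha, hb]; rfl, .imp hx hφ hψ hS h⟩
    · obtain ⟨k₁, φ, e, ha, hφ⟩ := ih _ (rank_snd_lt_pair _ _) rfl ⟨X, hX, h1⟩
      rw [← natSet_succ] at e
      obtain rfl := natSet_inj.1 e
      exact ⟨k, .all φ, rfl, by rw [ha]; rfl, .all hx hφ hS h⟩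

/-- The set `X` of items occurs only positively. This allows certificates to be united and enlarged.
-/
theorem CertStep.mono {R x X X' n c S : ZFSet.{u}} (hXX' : X ⊆ X') (h : CertStep N R x X n c S) :
    CertStep N R x X' n c S := by
  obtain ⟨hn, hS, h⟩ := h
  refine ⟨hn, hS, ?_⟩
  rcases h with h | h | h | h | ⟨a, b, S₁, S₂, hc, h1, h2, h⟩ | ⟨a, S₁, hc, h1, h⟩
  · exact Or.inl h
  · exact Or.inr (Or.inl h)
  · exact Or.inr (Or.inr (Or.inl h))
  · exact Or.inr (Or.inr (Or.inr (Or.inl h)))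
  · exact Or.inr (Or.inr (Or.inr (Or.inr (Or.inl ⟨a, b, S₁, S₂, hc, hXX' h1, hXX' h2, h⟩))))
  · exact Or.inr (Or.inr (Or.inr (Or.inr (Or.inr ⟨a, S₁, hc, hXX' h1, h⟩))))

theorem IsCert.union {R x X X' : ZFSet.{u}} (h : IsCert N R x X) (h' : IsCert N R x X') :
    IsCert N R x (X ∪ X') := by
  intro n c S hmem
  rcases ZFSet.mem_union.1 hmem with hm | hm
  · exact (h n c S hm).mono fun z hz => ZFSet.mem_union.2 (Or.inl hz)
  · exact (h' n c S hm).mono fun z hz => ZFSet.mem_union.2 (Or.inr hz)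

theorem IsCert.empty {R x : ZFSet.{u}} : IsCert N R x ∅ :=
  fun _ _ _ h => absurd h (ZFSet.notMem_empty _)

theorem IsCert.isTruthSet {R x X n c S : ZFSet.{u}} (hX : X ∈ N) (h : IsCert N R x X) (hn : n ∈ N)
    (hc : c ∈ N) (hS : S ∈ N) (hstep : CertStep N R x X n c S) : IsTruthSet N R x n c S := by
  refine ⟨⟨insert (ZFSet.pair n (ZFSet.pair c S)) X, PairClosed.insert_mem
    (PairClosed.pair_mem hn (PairClosed.pair_mem hc hS)) hX⟩, ?_, ZFSet.mem_insert _ _⟩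
  have hsub : X ⊆ insert (ZFSet.pair n (ZFSet.pair c S)) X :=
    fun z hz => ZFSet.mem_insert_of_mem _ hz
  intro n' c' S' hmem
  rcases ZFSet.mem_insert_iff.1 hmem with hm | hm
  · obtain ⟨h1, h2⟩ := ZFSet.pair_inj.1 hm
    obtain ⟨h2, h3⟩ := ZFSet.pair_inj.1 h2
    rw [h1, h2, h3]
    exact hstep.mono hsub
  · exact (h n' c' S' hm).mono hsub

/-- The set of sequences of length `n` of elements of `x` that satisfy a given property is in `N`. -/
theorem exists_set_of_seqs {p : ZFSet.{u} → Prop} (hp : Dfn N ∅ fun z : El N => p z.1)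
    {x : ZFSet.{u}} (hx : x ∈ N) (n : ℕ) : ∃ S ∈ N, (∀ s ∈ S, IsSeqOn (natSet n) x s) ∧
      ∀ s : El N, IsSeqOn (natSet n) x s.1 → (s.1 ∈ S ↔ p s.1) := by
  let pow : ZFSet.{u} → ZFSet.{u} := fun y => ZFSet.sep (fun z => z ∈ N) y.powerset
  have hpow : ∀ y ∈ N, pow y ∈ N := hN.out.powerset
  have hmem : ∀ {y z}, z ∈ N → (∀ w ∈ z, w ∈ y) → z ∈ pow y := fun hz h =>
    ZFSet.mem_sep.2 ⟨ZFSet.mem_powerset.2 h, hz⟩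
  have hdx : DT N ∅ (fun _ : El N => x) := DT.const hx
  -- A sequence is a set of Kuratowski pairs built from `n ∪ x`, hence an element of the third power
  -- set of `n ∪ x` as computed in `N`.
  refine ⟨_, sep_mem_of_dfn (p := fun s => IsSeqOn (natSet n) x s ∧ p s) inferInstance
    (hpow _ (hpow _ (hpow _ (PairClosed.union_mem (natSet_mem n) hx)))),
    fun s hs => (ZFSet.mem_sep.1 hs).2.1, fun s hs => ?_⟩
  rw [ZFSet.mem_sep]
  refine ⟨fun h => h.2.2, fun h => ⟨hmem s.2 fun z hz => ?_, hs, h⟩⟩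
  obtain ⟨i, hi, t, ht, rfl⟩ := hs.1 z hz
  have h1 := PairClosed.trans _ s.2 _ hz
  refine hmem h1 fun w hw => ?_
  refine hmem (PairClosed.trans _ h1 _ hw) fun a ha => ?_
  rw [ZFSet.mem_union]
  simp only [ZFSet.pair, ZFSet.mem_pair] at hw
  rcases hw with rfl | rfl
  · rw [ZFSet.mem_singleton.1 ha]
    exact Or.inl hi
  · rcases ZFSet.mem_pair.1 ha with rfl | rfl
    exacts [Or.inl hi, Or.inr ht]

/-- The induction on the formula is external. At each step the certificates of the immediate
subformulas are united and one new item, formed by separation in `N`, is added. -/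
theorem exists_isTruthSet {R x : ZFSet.{u}} (hR : R ∈ N) (hx : x ∈ N) {n : ℕ}
    (φ : setLang.BoundedFormula Empty n) : ∃ S, IsTruthSet N R x (natSet n) (fmlCode φ) S := by
  have hdx : ∀ {Γ : Type (u + 1)} [Ctx N Γ], DT N ∅ (fun _ : Γ => x) := DT.const hx
  have hdR : ∀ {Γ : Type (u + 1)} [Ctx N Γ], DT N ∅ (fun _ : Γ => R) := DT.const hR
  have hω : ∀ n, natSet.{u} n ∈ ZFSet.omega := fun n => mem_omega_iff.2 ⟨n, rfl⟩
  have hterm : ∀ {n : ℕ} (t : setLang.Term (Empty ⊕ Fin n)), natSet.{u} (varIndex t) ∈ natSet n :=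
    fun t => mem_natSet_iff_exists_term.2 ⟨t, rfl⟩
  induction φ with
  | @falsum n =>
    obtain ⟨S, hSN, hS, h⟩ := exists_set_of_seqs (N := N) (p := fun _ => False) inferInstance hx n
    refine ⟨S, IsCert.empty.isTruthSet empty_mem (natSet_mem _) (fmlCode_mem _) hSN
      ⟨hω n, hS, Or.inl ⟨rfl, fun s hs => by simpa using h s hs⟩⟩⟩
  | @equal n s t =>
    obtain ⟨S, hSN, hS, h⟩ := exists_set_of_seqs (N := N) (p := fun w => ∃ a ∈ x,
      ZFSet.pair (natSet (varIndex s)) a ∈ w ∧ ZFSet.pair (natSet (varIndex t)) a ∈ w)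
      inferInstance hx n
    exact ⟨S, IsCert.empty.isTruthSet empty_mem (natSet_mem _) (fmlCode_mem _) hSN
      ⟨hω n, hS, Or.inr (Or.inl ⟨_, hterm s, _, hterm t, rfl, h⟩)⟩⟩
  | @rel n l r ts =>
    cases r with
    | mem =>
      obtain ⟨S, hSN, hS, h⟩ := exists_set_of_seqs (N := N) (p := fun w => ∃ a ∈ x, ∃ b ∈ x,
        ZFSet.pair (natSet (varIndex (ts 0))) a ∈ w ∧ ZFSet.pair (natSet (varIndex (ts 1))) b ∈ w ∧
        a ∈ b) inferInstance hx n
      exact ⟨S, IsCert.empty.isTruthSet empty_mem (natSet_mem _) (fmlCode_mem _) hSN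
        ⟨hω n, hS, Or.inr (Or.inr (Or.inl ⟨_, hterm (ts 0), _, hterm (ts 1), rfl, h⟩))⟩⟩
    | pred =>
      obtain ⟨S, hSN, hS, h⟩ := exists_set_of_seqs (N := N) (p := fun w => ∃ a ∈ x,
        ZFSet.pair (natSet (varIndex (ts 0))) a ∈ w ∧ a ∈ R) inferInstance hx n
      exact ⟨S, IsCert.empty.isTruthSet empty_mem (natSet_mem _) (fmlCode_mem _) hSN
        ⟨hω n, hS, Or.inr (Or.inr (Or.inr (Or.inl ⟨_, hterm (ts 0), rfl, h⟩)))⟩⟩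
  | @imp n φ ψ h1 h2 =>
    obtain ⟨S₁, X₁, hX₁, hm₁⟩ := h1
    obtain ⟨S₂, X₂, hX₂, hm₂⟩ := h2
    have hS₁ := (PairClosed.of_pair_mem (PairClosed.mem_of_pair_mem X₁.2 hm₁).2).2
    have hS₂ := (PairClosed.of_pair_mem (PairClosed.mem_of_pair_mem X₂.2 hm₂).2).2
    have : DT N ∅ (fun _ : El N => S₁) := DT.const hS₁
    have : DT N ∅ (fun _ : El N => S₂) := DT.const hS₂
    obtain ⟨S, hSN, hS, h⟩ := exists_set_of_seqs (N := N) (p := fun w => w ∈ S₁ → w ∈ S₂)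
      inferInstance hx n
    exact ⟨S, (hX₁.union hX₂).isTruthSet (PairClosed.union_mem X₁.2 X₂.2) (natSet_mem _)
      (fmlCode_mem _) hSN ⟨hω n, hS, Or.inr (Or.inr (Or.inr (Or.inr (Or.inl
        ⟨⟨_, fmlCode_mem φ⟩, ⟨_, fmlCode_mem ψ⟩, ⟨S₁, hS₁⟩, ⟨S₂, hS₂⟩, rfl,
          ZFSet.mem_union.2 (Or.inl hm₁), ZFSet.mem_union.2 (Or.inr hm₂), h⟩))))⟩⟩
  | @all n φ h1 =>
    obtain ⟨S₁, X₁, hX₁, hm₁⟩ := h1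
    have hS₁ := (PairClosed.of_pair_mem (PairClosed.mem_of_pair_mem X₁.2 hm₁).2).2
    have : DT N ∅ (fun _ : El N × El N => S₁) := DT.const hS₁
    obtain ⟨S, hSN, hS, h⟩ := exists_set_of_seqs (N := N) (p := fun w => ∀ t ∈ x,
      (insert (ZFSet.pair (natSet n) t) w : ZFSet.{u}) ∈ S₁) inferInstance hx n
    exact ⟨S, hX₁.isTruthSet X₁.2 (natSet_mem _) (fmlCode_mem _) hSN
      ⟨hω n, hS, Or.inr (Or.inr (Or.inr (Or.inr (Or.inr
        ⟨⟨_, fmlCode_mem φ⟩, ⟨S₁, hS₁⟩, rfl, natSet_succ n ▸ hm₁, h⟩))))⟩⟩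

/-- Definability over `⟨x, ∈, R⟩`, expressed in `N`. -/
theorem mem_defPowerset_iff {R x y : ZFSet.{u}} (hR : R ∈ N) (hx : x ∈ N) :
    y ∈ defPowerset {z | z ∈ R} x ↔ y ⊆ x ∧ ∃ n c S s : El N, n.1 ∈ ZFSet.omega ∧
      IsTruthSet N R x (insert n.1 n.1) c.1 S.1 ∧ IsSeqOn n.1 x s.1 ∧
      ∀ t ∈ x, t ∈ y ↔ (insert (ZFSet.pair n.1 t) s.1 : ZFSet.{u}) ∈ S.1 := by
  rw [mem_defPowerset, definableOver_iff_realizeIn]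
  refine and_congr_right fun _ => ⟨?_, ?_⟩
  · rintro ⟨n, φ, v, hv, h⟩
    obtain ⟨S, hS⟩ := exists_isTruthSet hR hx φ
    obtain ⟨X, hX, hm⟩ := hS
    have hSN := (PairClosed.of_pair_mem (PairClosed.mem_of_pair_mem X.2 hm).2).2
    have hS : IsTruthSet N R x (natSet (n + 1)) (fmlCode φ) S := ⟨X, hX, hm⟩
    obtain ⟨k, ψ, e, hψ, hS'⟩ := hS.sound hx _ rfl
    obtain rfl := natSet_inj.1 e
    rw [← fmlCode_injective _ _ hψ] at hS'
    refine ⟨⟨_, natSet_mem n⟩, ⟨_, fmlCode_mem φ⟩, ⟨S, hSN⟩,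
      ⟨seqSet v, seqSet_mem fun i => PairClosed.trans _ hx _ (hv i)⟩, mem_omega_iff.2 ⟨n, rfl⟩,
      natSet_succ n ▸ hS, isSeqOn_seqSet.2 hv, fun t ht => ?_⟩
    rw [← seqSet_snoc]
    exact (h t ht).trans (hS'.2 _ (forall_snoc_mem hv ht)).symm
  · rintro ⟨n, c, S, s, hn, hS, hs, h⟩
    obtain ⟨k, φ, e, hφ, hS'⟩ := hS.sound hx _ rfl
    obtain ⟨m, hm⟩ := mem_omega_iff.1 hn
    rw [hm, ← natSet_succ] at e
    obtain rfl := natSet_inj.1 e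
    rw [hm] at hs h
    obtain ⟨v, hv, hsv⟩ := isSeqOn_natSet.1 hs
    refine ⟨m, φ, v, hv, fun t ht => (h t ht).trans ?_⟩
    rw [hsv, ← seqSet_snoc]
    exact hS'.2 _ (forall_snoc_mem hv ht)

/-- The truth set of the defining formula belongs to `N`, so `y` is obtained from `x` by separation
in `N`. -/
theorem mem_of_mem_defPowerset {R x y : ZFSet.{u}} (hR : R ∈ N) (hx : x ∈ N)
    (hy : y ∈ defPowerset {z | z ∈ R} x) : y ∈ N := by
  obtain ⟨h, n, c, S, s, -, -, -, h'⟩ := (mem_defPowerset_iff hR hx).1 hy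
  have : DT N ∅ fun _ : El N => n.1 := DT.const n.2
  have : DT N ∅ fun _ : El N => s.1 := DT.const s.2
  have : DT N ∅ fun _ : El N => S.1 := DT.const S.2
  convert sep_mem_of_dfn (p := fun t => (insert (ZFSet.pair n.1 t) s.1 : ZFSet.{u}) ∈ S.1)
    inferInstance hx using 1
  ext t
  rw [ZFSet.mem_sep]
  exact ⟨fun ht => ⟨h ht, (h' t (h ht)).1 ht⟩, fun ht => (h' t ht.1).2 ht.2⟩

theorem DT.defPowerset {R : ZFSet.{u}} (hR : R ∈ N) :
    DT N A fun x : El N => defPowerset {z | z ∈ R} x.1 := by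
  -- The predicate is left open: `∅` is needed for separation in `N`, and `A` for the conclusion.
  have key : ∀ B, Dfn N B fun z : El N × El N => z.2.1 ∈ _root_.defPowerset {z | z ∈ R} z.1.1 := by
    intro B
    have hdR : ∀ {Γ : Type (u + 1)} [Ctx N Γ], DT N B (fun _ : Γ => R) := DT.const hR
    exact Dfn.congr inferInstance fun z => mem_defPowerset_iff hR z.1.2
  refine DT.of_mem (fun x => ?_) (key A)
  have := key ∅
  have h1 : DT N ∅ fun _ : El N => x.1 := DT.const x.2
  have h2 := Dfn.subst₂ (p := fun a b => b ∈ _root_.defPowerset {z | z ∈ R} a) this h1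
    (DT.var (A := ∅) fun z : El N => z)
  convert sep_mem_of_dfn h2 (hN.out.powerset x.1 x.2) using 1
  ext y
  simp only [ZFSet.mem_sep, ZFSet.mem_powerset]
  exact ⟨fun hy => ⟨⟨(mem_defPowerset.1 hy).1, mem_of_mem_defPowerset hR x.2 hy⟩, hy⟩, fun hy => hy.2⟩

end

/-! ## `L[R]` as a definable class of an inner model; check names -/

/-- The function given by the recursion `f b = ⋃_{c ∈ b} Ψ (f c)`. -/
noncomputable def recFun (Ψ : ZFSet.{u} → ZFSet.{u}) (b : ZFSet.{u}) : ZFSet.{u} :=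
  ZFSet.iUnion fun c : b => Ψ (recFun Ψ c.1)
termination_by b
decreasing_by exact c.2

theorem mem_recFun {Ψ : ZFSet.{u} → ZFSet.{u}} {b z : ZFSet.{u}} :
    z ∈ recFun Ψ b ↔ ∃ c ∈ b, z ∈ Ψ (recFun Ψ c) := by
  rw [recFun]
  simp

theorem recFun_toZFSet (A : Set ZFSet.{u}) (o : Ordinal.{u}) :
    recFun (defPowerset A) o.toZFSet = constrLevel A o := by
  induction o using WellFoundedLT.induction with
  | ind o ih =>
    ext z
    rw [mem_recFun, mem_constrLevel]
    constructor
    · rintro ⟨c, hc, hz⟩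
      obtain ⟨a, ha, rfl⟩ := Ordinal.mem_toZFSet_iff.1 hc
      exact ⟨a, ha, ih a ha ▸ hz⟩
    · rintro ⟨a, ha, hz⟩
      exact ⟨_, Ordinal.mem_toZFSet_iff.2 ⟨a, ha, rfl⟩, (ih a ha).symm ▸ hz⟩

/-! ### `L[R]` as a definable class of an inner model containing `R` -/

section
variable {N A : Set ZFSet.{u}} [hN : Fact (IsInnerModel N)] {R : ZFSet.{u}}

theorem recGraph_toZFSet (hR : R ∈ N) (o : Ordinal.{u}) :
    RecGraph N (defPowerset {z | z ∈ R}) o.toZFSet (constrLevel {z | z ∈ R} o) := by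
  rw [← recFun_toZFSet]
  refine recGraph_of_mem (DT.defPowerset hR) (fun _ _ => mem_recFun)
    (hN.out.ordinals (o + 1)) (ZFSet.isOrdinal_toZFSet _).isTransitive ?_
  exact Ordinal.mem_toZFSet_iff.2 ⟨o, by simp, rfl⟩

/-- The operation `Def` is absolute for `N`, so the recursion carried out in `N` along an ordinal
produces the true level `L_o[R]`. Membership in `L[R]` thus becomes a first-order statement over
`N`. -/
theorem mem_relConstructible_iff (hR : R ∈ N) {x : ZFSet.{u}} :
    x ∈ relConstructible {z | z ∈ R} ↔ ∃ b u : El N, b.1.IsOrdinal ∧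
      RecGraph N (defPowerset {z | z ∈ R}) b.1 u.1 ∧ x ∈ u.1 := by
  have hΨ : DT N ∅ fun x : El N => defPowerset {z | z ∈ R} x.1 := DT.defPowerset hR
  have heq : ∀ {b u}, RecGraph N (defPowerset {z | z ∈ R}) b u →
      u = recFun (defPowerset {z | z ∈ R}) b ∧ recFun (defPowerset {z | z ∈ R}) b ∈ N :=
    RecGraph.eq (fun w hw => hΨ.mem ⟨w, hw⟩) (fun _ _ => mem_recFun)
  constructor
  · rintro ⟨o, ho⟩
    have h := recGraph_toZFSet hR o
    obtain ⟨h1, h2⟩ := heq h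
    exact ⟨⟨_, hN.out.ordinals o⟩, ⟨_, h1 ▸ h2⟩, ZFSet.isOrdinal_toZFSet o, h, ho⟩
  · rintro ⟨b, u, hb, h, hx⟩
    obtain ⟨o, ho⟩ := ZFSet.isOrdinal_iff_mem_range_toZFSet.1 hb
    rw [(heq h).1, ← ho, recFun_toZFSet] at hx
    exact ⟨o, hx⟩

theorem relConstructible_subset (hR : R ∈ N) : relConstructible {z | z ∈ R} ⊆ N := by
  intro x hx
  obtain ⟨b, u, -, -, h⟩ := (mem_relConstructible_iff hR).1 hx
  exact PairClosed.trans _ u.2 x h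

theorem Dfn.mem_relConstructible (hR : R ∈ N) :
    Dfn N A fun x : El N => x.1 ∈ relConstructible {z | z ∈ R} := by
  have h1 : Dfn N A fun z : (El N × El N) × El N => z.1.2.1.IsOrdinal := Dfn.isOrdinal inferInstance
  have h2 : Dfn N A fun z : (El N × El N) × El N =>
      RecGraph N (defPowerset {z | z ∈ R}) z.1.2.1 z.2.1 :=
    (Dfn.recGraph (DT.defPowerset hR)).reindex fun z : (El N × El N) × El N => (z.1.2, z.2)
  exact Dfn.congr inferInstance fun x => mem_relConstructible_iff hR

end

instance fact_relConstructible (A : Set ZFSet.{u}) : Fact (IsInnerModel (relConstructible A)) :=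
  ⟨isInnerModel_relConstructible A⟩

instance fact_constructible : Fact (IsInnerModel constructible.{u}) :=
  ⟨isInnerModel_relConstructible ∅⟩

/-- Minimality of `L`: the preceding computation of `L[R]` in an inner model, with `R = ∅`. -/
theorem constructible_subset {N : Set ZFSet.{u}} [hN : Fact (IsInnerModel N)] :
    constructible ⊆ N := by
  have h := relConstructible_subset (N := N) (R := ∅) empty_mem
  have e : {z : ZFSet.{u} | z ∈ (∅ : ZFSet.{u})} = ∅ := by ext; simp
  rwa [e] at h

/-- The canonical name for `x`, with all conditions equal to `p`. -/
noncomputable def checkName (p : ZFSet.{u}) : ZFSet.{u} → ZFSet.{u} :=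
  recFun fun w => {ZFSet.pair w p}

theorem mem_checkName {p x z : ZFSet.{u}} :
    z ∈ checkName p x ↔ ∃ y ∈ x, z = ZFSet.pair (checkName p y) p := by
  unfold checkName
  rw [mem_recFun]
  simp

theorem mem_nameVal {G : Set ZFSet.{u}} {σ z : ZFSet.{u}} :
    z ∈ nameVal G σ ↔ ∃ π, ∃ r ∈ G, ZFSet.pair π r ∈ σ ∧ z = nameVal G π := by
  rw [nameVal]
  simp only [ZFSet.mem_range, Subtype.exists, exists_prop]
  constructor
  · rintro ⟨π, ⟨r, hr, h⟩, rfl⟩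
    exact ⟨π, r, hr, h, rfl⟩
  · rintro ⟨π, r, hr, h, rfl⟩
    exact ⟨π, ⟨r, hr, h⟩, rfl⟩

theorem nameVal_checkName {G : Set ZFSet.{u}} {p : ZFSet.{u}} (hp : p ∈ G) (x : ZFSet.{u}) :
    nameVal G (checkName p x) = x := by
  induction x using ZFSet.inductionOn with
  | _ x ih =>
    ext z
    rw [mem_nameVal]
    constructor
    · rintro ⟨π, r, -, h, rfl⟩
      obtain ⟨y, hy, e⟩ := mem_checkName.1 h
      rw [(ZFSet.pair_inj.1 e).1, ih y hy]
      exact hy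
    · intro hz
      exact ⟨_, p, hp, mem_checkName.2 ⟨z, hz, rfl⟩, (ih z hz).symm⟩

/-- Check names are given by a recursion of the form treated above, with `Ψ w = {⟨w, p⟩}`. Each `x ∈
L` lies in a transitive set of `L`, namely a level, along which the recursion runs. -/
theorem DT.checkName {A : Set ZFSet.{u}} {p : ZFSet.{u}} (hp : p ∈ constructible) :
    DT constructible A fun x : El constructible => checkName p x.1 := by
  have hΨ : ∀ B, DT constructible B
      fun w : El constructible => ({ZFSet.pair w.1 p} : ZFSet.{u}) := by
    intro B
    have hd : DT constructible B fun _ : El constructible => p := DT.const hp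
    infer_instance
  have hrec : ∀ x ∈ constructible.{u},
      RecGraph constructible (fun w => {ZFSet.pair w p}) x (_root_.checkName p x) := by
    rintro x ⟨o, ho⟩
    exact recGraph_of_mem (hΨ ∅) (fun _ _ => mem_recFun) (constrLevel_mem o) constrLevel_trans ho
  have heq : ∀ {b u : ZFSet.{u}}, RecGraph constructible (fun w => {ZFSet.pair w p}) b u →
      u = _root_.checkName p b ∧ _root_.checkName p b ∈ constructible :=
    RecGraph.eq (fun w hw => (hΨ ∅).mem ⟨w, hw⟩) (fun _ _ => mem_recFun)
  refine ⟨fun x => (heq (hrec x.1 x.2)).2, ?_⟩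
  refine Dfn.congr (Dfn.recGraph (hΨ A)) fun z => ⟨fun h => ?_, fun h => (heq h).1⟩
  rw [h]
  exact hrec _ z.1.2

/-! ## Class forcing over `L` -/

theorem ForcingNotion.pair_mem_graph {P : ForcingNotion.{u}} {p q : ZFSet.{u}} :
    ZFSet.pair p q ∈ P.graph ↔ P.le p q := by
  constructor
  · rintro ⟨p', q', h, e⟩
    obtain ⟨rfl, rfl⟩ := ZFSet.pair_inj.1 e
    exact h
  · exact fun h => ⟨p, q, h, rfl⟩

theorem ForcingNotion.mem_carrier_iff {P : ForcingNotion.{u}} {p : ZFSet.{u}} :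
    p ∈ P.carrier ↔ P.le p p := ⟨P.refl p, P.left_mem⟩

theorem ForcingNotion.forcesEq_iff {P : ForcingNotion.{u}} {p σ τ : ZFSet.{u}} :
    P.forcesEq p σ τ ↔
      (∀ π r, ZFSet.pair π r ∈ σ → ∀ q, P.le q p → P.le q r → ∀ q', P.le q' q → ∃ t, P.le t q' ∧
        ∃ π' r', ZFSet.pair π' r' ∈ τ ∧ P.le t r' ∧ P.forcesEq t π π') ∧
      (∀ π r, ZFSet.pair π r ∈ τ → ∀ q, P.le q p → P.le q r → ∀ q', P.le q' q → ∃ t, P.le t q' ∧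
        ∃ π' r', ZFSet.pair π' r' ∈ σ ∧ P.le t r' ∧ P.forcesEq t π' π) := by
  rw [ForcingNotion.forcesEq]
  simp only [exists_prop]

/-- The two clauses of the definition are mirror images except that the recursive call always keeps
the part of `σ` on the left. Induction on the rank of the left name removes this asymmetry. -/
theorem ForcingNotion.forcesEq_comm {P : ForcingNotion.{u}} (o : Ordinal.{u}) :
    ∀ {p σ τ : ZFSet.{u}}, σ.rank = o → (P.forcesEq p σ τ ↔ P.forcesEq p τ σ) := by
  induction o using WellFoundedLT.induction with
  | ind o ih =>
    rintro p σ τ rfl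
    rw [P.forcesEq_iff (σ := σ), P.forcesEq_iff (σ := τ), and_comm]
    refine and_congr ?_ ?_
    · refine forall₃_congr fun π r _ => forall₃_congr fun q _ _ => forall₂_congr fun q' _ =>
        exists_congr fun t => and_congr_right fun _ => exists₂_congr fun π' r' =>
          and_congr_right fun h => and_congr_right fun _ => ih _ (rank_lt_of_pair_mem h) rfl
    · refine forall₃_congr fun π r h => forall₃_congr fun q _ _ => forall₂_congr fun q' _ =>
        exists_congr fun t => and_congr_right fun _ => exists₂_congr fun π' r' =>
          and_congr_right fun _ => and_congr_right fun _ => ih _ (rank_lt_of_pair_mem h) rfl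

/-- The requirements on a forcing notion in the definition of a generic extension of `L`. -/
class IsTame (P : ForcingNotion.{u}) : Prop where
  amenable : IsAmenable constructible P.graph
  definable : P.DeltaZeroDefinable constructible

/-- `p` is a condition forcing `σ = τ`. -/
def ForcingNotion.condForcesEq (P : ForcingNotion.{u}) (p σ τ : ZFSet.{u}) : Prop :=
  p ∈ P.carrier ∧ P.forcesEq p σ τ

/-- `t` forces `π ∈ τ` by being below a condition in `τ` paired with a name forced equal to `π`. -/
def ForcingNotion.stronglyForcesMem (P : ForcingNotion.{u}) (t π τ : ZFSet.{u}) : Prop :=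
  ∃ π' r' : El constructible.{u}, ZFSet.pair π'.1 r'.1 ∈ τ ∧ P.le t r'.1 ∧ P.condForcesEq t π π'.1

/-- `p` is a condition forcing `σ ⊆ τ`. -/
def ForcingNotion.condForcesSubset (P : ForcingNotion.{u}) (p σ τ : ZFSet.{u}) : Prop :=
  p ∈ P.carrier ∧ ∀ π r q q' : El constructible.{u}, ZFSet.pair π.1 r.1 ∈ σ → P.le q.1 p →
    P.le q.1 r.1 → P.le q'.1 q.1 →
      ∃ t : El constructible.{u}, P.le t.1 q'.1 ∧ P.stronglyForcesMem t.1 π.1 τ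

/-! ### Definability of forced equality and the truth lemma for equality -/

section
variable {P : ForcingNotion.{u}} {Γ : Type (u + 1)} [Ctx constructible Γ]

instance Dfn.le {s t : Γ → ZFSet.{u}} [DT constructible P.graph s] [DT constructible P.graph t] :
    Dfn constructible P.graph fun γ => P.le (s γ) (t γ) :=
  Dfn.congr (q := fun γ => ZFSet.pair (s γ) (t γ) ∈ P.graph) inferInstance
    fun _ => ForcingNotion.pair_mem_graph.symm

instance Dfn.carrier {s : Γ → ZFSet.{u}} [DT constructible P.graph s] :
    Dfn constructible P.graph fun γ => s γ ∈ P.carrier :=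
  Dfn.congr (q := fun γ => P.le (s γ) (s γ)) inferInstance
    fun _ => ForcingNotion.mem_carrier_iff

variable [hP : IsTame P]

theorem carrier_subset {p : ZFSet.{u}} (hp : p ∈ P.carrier) : p ∈ constructible :=
  (PairClosed.of_pair_mem (hP.amenable.1 (ForcingNotion.pair_mem_graph.2 (P.refl p hp)))).1

/-- The assumed definability of `Δ₀` forcing enters here, for the formula `v_0 = v_1`. -/
instance Dfn.condForcesEq {p s t : Γ → ZFSet.{u}} [hp : DT constructible P.graph p]
    [hs : DT constructible P.graph s] [ht : DT constructible P.graph t] :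
    Dfn constructible P.graph fun γ => P.condForcesEq (p γ) (s γ) (t γ) := by
  refine Dfn.subst₃ (p := P.condForcesEq) ?_ hp hs ht
  have hm : Mor constructible (fun z : El constructible.{u} × El constructible × El constructible =>
      ![z.1, z.2.1, z.2.2]) :=
    Mor.tuple _ fun i => by fin_cases i <;> simp <;> infer_instance
  exact (relDefinableOver_iff_dfn.1 (hP.definable 2 (.eq 0 1))).reindex
    fun z : El constructible.{u} × El constructible × El constructible => ![z.1, z.2.1, z.2.2]

instance Dfn.stronglyForcesMem {p s t : Γ → ZFSet.{u}} [hp : DT constructible P.graph p]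
    [hs : DT constructible P.graph s] [ht : DT constructible P.graph t] :
    Dfn constructible P.graph fun γ => P.stronglyForcesMem (p γ) (s γ) (t γ) := by
  refine Dfn.subst₃ (p := P.stronglyForcesMem) ?_ hp hs ht
  unfold ForcingNotion.stronglyForcesMem
  infer_instance

instance Dfn.condForcesSubset {p s t : Γ → ZFSet.{u}} [hp : DT constructible P.graph p]
    [hs : DT constructible P.graph s] [ht : DT constructible P.graph t] :
    Dfn constructible P.graph fun γ => P.condForcesSubset (p γ) (s γ) (t γ) := by
  refine Dfn.subst₃ (p := P.condForcesSubset) ?_ hp hs ht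
  unfold ForcingNotion.condForcesSubset
  infer_instance

theorem condForcesEq_comm {p σ τ : ZFSet.{u}} : P.condForcesEq p σ τ ↔ P.condForcesEq p τ σ :=
  and_congr_right fun _ => P.forcesEq_comm _ rfl

theorem stronglyForcesMem_iff {t π τ : ZFSet.{u}} (hτ : τ ∈ constructible) :
    P.stronglyForcesMem t π τ ↔
      ∃ π' r', ZFSet.pair π' r' ∈ τ ∧ P.le t r' ∧ P.forcesEq t π π' := by
  constructor
  · rintro ⟨π', r', h1, h2, h3⟩
    exact ⟨_, _, h1, h2, h3.2⟩
  · rintro ⟨π', r', h1, h2, h3⟩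
    obtain ⟨ha, hb⟩ := PairClosed.mem_of_pair_mem hτ h1
    exact ⟨⟨π', ha⟩, ⟨r', hb⟩, h1, h2, P.left_mem h2, h3⟩

/-- Conditions and components of names in `L` are themselves in `L`, so restricting all quantifiers
to `L`, as definability requires, changes nothing. -/
theorem condForcesSubset_iff {p σ τ : ZFSet.{u}} (hσ : σ ∈ constructible) (hτ : τ ∈ constructible) :
    P.condForcesSubset p σ τ ↔ p ∈ P.carrier ∧
      ∀ π r, ZFSet.pair π r ∈ σ → ∀ q, P.le q p → P.le q r → ∀ q', P.le q' q → ∃ t, P.le t q' ∧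
        ∃ π' r', ZFSet.pair π' r' ∈ τ ∧ P.le t r' ∧ P.forcesEq t π π' := by
  simp only [← stronglyForcesMem_iff hτ]
  refine and_congr_right fun _ => ⟨fun H π r h q hqp hqr q' hq' => ?_,
    fun H π r q q' h hqp hqr hq' => ?_⟩
  · obtain ⟨ha, hb⟩ := PairClosed.mem_of_pair_mem hσ h
    obtain ⟨t, h1, h2⟩ := H ⟨π, ha⟩ ⟨r, hb⟩ ⟨q, carrier_subset (P.left_mem hqp)⟩
      ⟨q', carrier_subset (P.left_mem hq')⟩ h hqp hqr hq'
    exact ⟨t, h1, h2⟩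
  · obtain ⟨t, h1, h2⟩ := H _ _ h _ hqp hqr _ hq'
    exact ⟨⟨t, carrier_subset (P.left_mem h1)⟩, h1, h2⟩

theorem condForcesEq_iff {p σ τ : ZFSet.{u}} (hσ : σ ∈ constructible) (hτ : τ ∈ constructible) :
    P.condForcesEq p σ τ ↔ P.condForcesSubset p σ τ ∧ P.condForcesSubset p τ σ := by
  rw [condForcesSubset_iff hσ hτ, condForcesSubset_iff hτ hσ, ForcingNotion.condForcesEq,
    P.forcesEq_iff]
  have : ∀ {t π π'}, P.forcesEq t π π' ↔ P.forcesEq t π' π := fun {t π π'} => P.forcesEq_comm _ rfl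
  simp only [this (π' := _)]
  constructor
  · rintro ⟨h, h1, h2⟩
    exact ⟨⟨h, h1⟩, h, by simpa only [this] using h2⟩
  · rintro ⟨⟨h, h1⟩, -, h2⟩
    exact ⟨h, h1, by simpa only [this] using h2⟩

theorem condForcesSubset_mono {p q σ τ : ZFSet.{u}} (h : P.condForcesSubset p σ τ)
    (hqp : P.le q p) : P.condForcesSubset q σ τ :=
  ⟨P.left_mem hqp, fun π r s s' h1 h2 h3 h4 => h.2 π r s s' h1 (P.trans h2 hqp) h3 h4⟩

theorem condForcesEq_mono {p q σ τ : ZFSet.{u}} (hσ : σ ∈ constructible) (hτ : τ ∈ constructible)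
    (h : P.condForcesEq p σ τ) (hqp : P.le q p) : P.condForcesEq q σ τ := by
  rw [condForcesEq_iff hσ hτ] at h ⊢
  exact ⟨condForcesSubset_mono h.1 hqp, condForcesSubset_mono h.2 hqp⟩

variable {G : Set ZFSet.{u}}

theorem exists_mem_dense (hG : P.IsGenericFilter constructible G) {D : ZFSet.{u} → Prop}
    (hD : Dfn constructible P.graph fun z : El constructible.{u} => D z.1)
    (h : ∀ p ∈ P.carrier, ∃ q, D q ∧ P.le q p) : ∃ p ∈ G, D p := by
  obtain ⟨p, hp, h'⟩ := hG.meets {p | p ∈ P.carrier ∧ D p} (fun p hp => hp.1)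
    (definableOver_iff_dfn.2 (Dfn.and (p := fun z : El constructible.{u} => z.1 ∈ P.carrier)))
    (fun p hp => by
      obtain ⟨q, h1, h2⟩ := h p hp
      exact ⟨q, ⟨P.left_mem h2, h1⟩, h2⟩)
  exact ⟨p, hp, h'.2⟩

theorem exists_mem_dense_below (hG : P.IsGenericFilter constructible G) {D : ZFSet.{u} → Prop}
    (hD : Dfn constructible P.graph fun z : El constructible.{u} => D z.1) {p : ZFSet.{u}} (hp : p ∈ G)
    (h : ∀ q, P.le q p → ∃ r, P.le r q ∧ D r) : ∃ r ∈ G, D r := by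
  have hdp : ∀ {Γ : Type (u + 1)} [Ctx constructible Γ], DT constructible P.graph (fun _ : Γ => p) :=
    DT.const (carrier_subset (hG.subset hp))
  obtain ⟨q, hq, h'⟩ := exists_mem_dense hG
    -- To pass from density below `p` to density, the conditions incompatible with `p` are added;
    -- none of these is in `G`.
    (D := fun q => D q ∨ ¬ ∃ r : El constructible.{u}, P.le r.1 q ∧ P.le r.1 p) inferInstance (by
      intro q hq
      by_cases hcomp : ∃ r : El constructible.{u}, P.le r.1 q ∧ P.le r.1 p
      · obtain ⟨r, h1, h2⟩ := hcomp
        obtain ⟨s, hs, hDs⟩ := h r.1 h2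
        exact ⟨s, Or.inl hDs, P.trans hs h1⟩
      · exact ⟨q, Or.inr hcomp, P.refl q hq⟩)
  rcases h' with h' | h'
  · exact ⟨q, hq, h'⟩
  · obtain ⟨r, h1, h2⟩ := hG.compatible q hq p hp
    exact absurd ⟨⟨r, carrier_subset (P.left_mem h1)⟩, h1, h2⟩ h'

/-- Compatibility only gives a common extension in `P`. One in `G` is found by genericity: below
`p`, the conditions that are below `q` or incompatible with `q` are dense. -/
theorem exists_mem_le (hG : P.IsGenericFilter constructible G) {p q : ZFSet.{u}} (hp : p ∈ G)
    (hq : q ∈ G) : ∃ r ∈ G, P.le r p ∧ P.le r q := by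
  have hdp : ∀ {Γ : Type (u + 1)} [Ctx constructible Γ], DT constructible P.graph (fun _ : Γ => p) :=
    DT.const (carrier_subset (hG.subset hp))
  have hdq : ∀ {Γ : Type (u + 1)} [Ctx constructible Γ], DT constructible P.graph (fun _ : Γ => q) :=
    DT.const (carrier_subset (hG.subset hq))
  obtain ⟨r, hr, h⟩ := exists_mem_dense_below hG (D := fun r => P.le r p ∧
    (P.le r q ∨ ¬ ∃ s : El constructible.{u}, P.le s.1 r ∧ P.le s.1 q)) inferInstance hp (by
      intro r hr
      by_cases hcomp : ∃ s : El constructible.{u}, P.le s.1 r ∧ P.le s.1 q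
      · obtain ⟨s, h1, h2⟩ := hcomp
        exact ⟨s.1, h1, P.trans h1 hr, Or.inl h2⟩
      · exact ⟨r, P.refl r (P.left_mem hr), hr, Or.inr hcomp⟩)
  refine ⟨r, hr, h.1, ?_⟩
  rcases h.2 with h | h
  · exact h
  · obtain ⟨s, h1, h2⟩ := hG.compatible r hr q hq
    exact absurd ⟨⟨s, carrier_subset (P.left_mem h1)⟩, h1, h2⟩ h

theorem exists_mem_generic (hG : P.IsGenericFilter constructible G) : ∃ p, p ∈ G := by
  obtain ⟨p, hp, -⟩ := exists_mem_dense hG (D := fun p => p ∈ P.carrier) inferInstance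
    fun p hp => ⟨p, hp, P.refl p hp⟩
  exact ⟨p, hp⟩

/-- Inclusion reduces to equality of components, which is why the truth lemma for those is a
hypothesis: this is the inductive step of `nameVal_eq_iff`. -/
theorem nameVal_subset_iff (hG : P.IsGenericFilter constructible G) {σ τ : ZFSet.{u}}
    (hσ : σ ∈ constructible) (hτ : τ ∈ constructible)
    (ih : ∀ π r π' r', ZFSet.pair π r ∈ σ → ZFSet.pair π' r' ∈ τ →
      (nameVal G π = nameVal G π' ↔ ∃ p ∈ G, P.condForcesEq p π π')) :
    nameVal G σ ⊆ nameVal G τ ↔ ∃ p ∈ G, P.condForcesSubset p σ τ := by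
  have hdσ : ∀ {Γ : Type (u + 1)} [Ctx constructible Γ], DT constructible P.graph (fun _ : Γ => σ) :=
    DT.const hσ
  have hdτ : ∀ {Γ : Type (u + 1)} [Ctx constructible Γ], DT constructible P.graph (fun _ : Γ => τ) :=
    DT.const hτ
  constructor
  · intro hsub
    -- A condition that does not force the inclusion has an extension below some `r` with `⟨π, r⟩ ∈
    -- σ`, none of whose extensions puts `π` into `τ`. If the second alternative met `G`, the value
    -- of `π` would be a member of the value of `τ`, and a common extension in `G` would refute it.
    obtain ⟨p, hp, h⟩ := exists_mem_dense hG (D := fun p => P.condForcesSubset p σ τ ∨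
      ∃ π r : El constructible.{u}, ZFSet.pair π.1 r.1 ∈ σ ∧ P.le p r.1 ∧
        ∀ t : El constructible.{u}, P.le t.1 p → ¬ P.stronglyForcesMem t.1 π.1 τ) inferInstance (by
      intro p hp
      by_cases h : P.condForcesSubset p σ τ
      · exact ⟨p, Or.inl h, P.refl p hp⟩
      · simp only [ForcingNotion.condForcesSubset, hp, true_and] at h
        push Not at h
        obtain ⟨π, r, q, q', h1, h2, h3, h4, h5⟩ := h
        exact ⟨q'.1, Or.inr ⟨π, r, h1, P.trans h4 h3, h5⟩, P.trans h4 h2⟩)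
    rcases h with h | ⟨π, r, h1, h2, h3⟩
    · exact ⟨p, hp, h⟩
    · have hr := hG.upward p hp _ h2
      obtain ⟨π', r', hr', h4, h5⟩ := mem_nameVal.1 (hsub (mem_nameVal.2 ⟨_, _, hr, h1, rfl⟩))
      obtain ⟨s, hs, h6⟩ := (ih _ _ _ _ h1 h4).1 h5
      obtain ⟨t, ht, h7, h8⟩ := exists_mem_le hG hp hr'
      obtain ⟨t', ht', h9, h10⟩ := exists_mem_le hG ht hs
      obtain ⟨ha, hb⟩ := PairClosed.mem_of_pair_mem hτ h4
      exact absurd ⟨⟨π', ha⟩, ⟨r', hb⟩, h4, P.trans h9 h8, condForcesEq_mono π.2 ha h6 h10⟩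
        (h3 ⟨t', carrier_subset (P.left_mem h9)⟩ (P.trans h9 h7))
  · rintro ⟨p, hp, h⟩ z hz
    obtain ⟨π, r, hr, h1, rfl⟩ := mem_nameVal.1 hz
    obtain ⟨ha, hb⟩ := PairClosed.mem_of_pair_mem hσ h1
    have hdπ : ∀ {Γ : Type (u + 1)} [Ctx constructible Γ], DT constructible P.graph (fun _ : Γ => π) :=
      DT.const ha
    obtain ⟨q, hq, h2, h3⟩ := exists_mem_le hG hp hr
    obtain ⟨t, ht, π', r', h4, h5, h6⟩ := exists_mem_dense_below hG
      (D := fun t => P.stronglyForcesMem t π τ) inferInstance hq (by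
        intro q' hq'
        obtain ⟨t, h4, h5⟩ := h.2 ⟨π, ha⟩ ⟨r, hb⟩ ⟨q, carrier_subset (hG.subset hq)⟩
          ⟨q', carrier_subset (P.left_mem hq')⟩ h1 h2 h3 hq'
        exact ⟨t.1, h4, h5⟩)
    rw [(ih _ _ _ _ h1 h4).2 ⟨t, ht, h6⟩]
    exact mem_nameVal.2 ⟨_, _, hG.upward t ht _ h5, h4, rfl⟩

/-- The truth lemma for equality. -/
theorem nameVal_eq_iff (hG : P.IsGenericFilter constructible G) (o : Ordinal.{u}) :
    ∀ {σ τ : ZFSet.{u}}, σ.rank = o → σ ∈ constructible → τ ∈ constructible →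
    (nameVal G σ = nameVal G τ ↔ ∃ p ∈ G, P.condForcesEq p σ τ) := by
  induction o using WellFoundedLT.induction with
  | ind o ih =>
    rintro σ τ rfl hσ hτ
    have h1 := nameVal_subset_iff hG hσ hτ fun π r π' r' h h' =>
      ih _ (rank_lt_of_pair_mem h) rfl (PairClosed.mem_of_pair_mem hσ h).1
        (PairClosed.mem_of_pair_mem hτ h').1
    -- The induction is on the rank of `σ` alone, so for the reverse inclusion the equality is
    -- turned round before the induction hypothesis is applied.
    have h2 := nameVal_subset_iff hG hτ hσ fun π r π' r' h h' => by
      rw [eq_comm, ih _ (rank_lt_of_pair_mem h') rfl (PairClosed.mem_of_pair_mem hσ h').1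
        (PairClosed.mem_of_pair_mem hτ h).1]
      exact exists_congr fun p => and_congr_right fun _ => condForcesEq_comm
    have h3 : nameVal G σ = nameVal G τ ↔ nameVal G σ ⊆ nameVal G τ ∧ nameVal G τ ⊆ nameVal G σ :=
      ⟨fun h => by rw [h]; exact ⟨subset_rfl, subset_rfl⟩,
        fun h => by ext z; exact ⟨fun hz => h.1 hz, fun hz => h.2 hz⟩⟩
    rw [h3, h1, h2]
    constructor
    · rintro ⟨⟨p, hp, hp'⟩, q, hq, hq'⟩
      obtain ⟨r, hr, hrp, hrq⟩ := exists_mem_le hG hp hq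
      exact ⟨r, hr, (condForcesEq_iff hσ hτ).2
        ⟨condForcesSubset_mono hp' hrp, condForcesSubset_mono hq' hrq⟩⟩
    · rintro ⟨p, hp, h⟩
      obtain ⟨h1, h2⟩ := (condForcesEq_iff hσ hτ).1 h
      exact ⟨⟨p, hp, h1⟩, p, hp, h2⟩

end

/-! ## The truth lemma -/

section
variable {N A : Set ZFSet.{u}} {Γ Δ : Type (u + 1)} [Ctx N Γ] [Ctx N Δ]

/-- A single tuple is definable. -/
instance Dfn.eq_point (a : Γ) : Dfn N A fun γ : Γ => γ = a := by
  obtain ⟨n, ⟨e⟩⟩ := Finite.exists_equiv_fin (Ctx.ι N Γ)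
  have h : ∀ i : Fin n, Dfn N A fun γ : Γ =>
      (Ctx.e (N := N) γ (e.symm i)).1 = (Ctx.e (N := N) a (e.symm i)).1 := fun i =>
    Dfn.eq_const (fun γ : Γ => Ctx.e (N := N) γ (e.symm i)) (hf := ⟨fun _ => e.symm i, fun _ _ => rfl⟩) _
  refine Dfn.congr (Dfn.forallFin h) fun γ => ⟨by rintro rfl i; rfl, fun H => ?_⟩
  apply (Ctx.e (N := N)).injective
  funext i
  have := H (e i)
  rw [e.symm_apply_apply] at this
  exact Subtype.ext this

/-- Substitution of a constant tuple. -/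
theorem Dfn.specialize {p : Γ × Δ → Prop} (hp : Dfn N A p) (a : Γ) :
    Dfn N A fun δ => p (a, δ) := by
  have h : Dfn N A fun z : Δ × Γ => z.2 = a := (Dfn.eq_point a).reindex fun z : Δ × Γ => z.2
  have h' : Dfn N A fun z : Δ × Γ => p (z.2, z.1) := hp.reindex fun z : Δ × Γ => (z.2, z.1)
  exact Dfn.congr (q := fun δ => ∃ γ, γ = a ∧ p (γ, δ)) inferInstance fun δ => by simp

end

/-- There is a definable relation, inherited by stronger conditions, that relates `γ` to some condition
in the filter if and only if `T γ`. -/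
def Forceable (P : ForcingNotion.{u}) (G : Set ZFSet.{u}) {Γ : Type (u + 1)} [Ctx constructible Γ]
    (T : Γ → Prop) : Prop :=
  ∃ F : Γ → ZFSet.{u} → Prop, Dfn constructible P.graph (fun z : Γ × El constructible => F z.1 z.2.1) ∧
    (∀ γ p q, F γ p → P.le q p → F γ q) ∧ ∀ γ, T γ ↔ ∃ p ∈ G, F γ p

section
variable {P : ForcingNotion.{u}} {G : Set ZFSet.{u}} {Γ Δ : Type (u + 1)} [Ctx constructible Γ]
  [Ctx constructible Δ]

theorem Forceable.congr {T T' : Γ → Prop} (h : Forceable P G T) (e : ∀ γ, T' γ ↔ T γ) :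
    Forceable P G T' := by
  rwa [show T' = T from funext fun γ => propext (e γ)]

theorem Forceable.reindex {T : Δ → Prop} (h : Forceable P G T) (f : Γ → Δ) [hf : Mor constructible f] :
    Forceable P G fun γ => T (f γ) := by
  obtain ⟨F, h1, h2, h3⟩ := h
  have : Mor constructible fun z : Γ × El constructible.{u} => f z.1 := Mor.comp hf _
  exact ⟨fun γ p => F (f γ) p, h1.reindex fun z : Γ × El constructible => (f z.1, z.2),
    fun γ => h2 (f γ), fun γ => h3 (f γ)⟩

theorem Forceable.specialize {T : Γ × Δ → Prop} (h : Forceable P G T) (a : Γ) :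
    Forceable P G fun δ => T (a, δ) := by
  obtain ⟨F, h1, h2, h3⟩ := h
  have h4 : Dfn constructible P.graph fun z : Γ × (Δ × El constructible) => F (z.1, z.2.1) z.2.2.1 :=
    h1.reindex fun z : Γ × (Δ × El constructible) => ((z.1, z.2.1), z.2.2)
  exact ⟨fun δ p => F (a, δ) p, h4.specialize a, fun δ => h2 _, fun δ => h3 _⟩

variable [hP : IsTame P] (hG : P.IsGenericFilter constructible G)
include hG

theorem Forceable.const (c : Prop) : Forceable P G fun _ : Γ => c := by
  obtain ⟨p, hp⟩ := exists_mem_generic hG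
  exact ⟨fun _ _ => c, inferInstance, fun _ _ _ h _ => h, fun _ => ⟨fun h => ⟨p, hp, h⟩, fun h => h.choose_spec.2⟩⟩

/-- If no condition in the filter has the definable property `F`, then this is due to a single
condition in the filter. -/
theorem exists_mem_forall_not {F : ZFSet.{u} → Prop}
    (hF : Dfn constructible P.graph fun z : El constructible => F z.1) (H : ¬ ∃ p ∈ G, F p) :
    ∃ p ∈ G, ∀ q : El constructible, P.le q.1 p → ¬ F q.1 := by
  have h : Dfn constructible P.graph fun z : El constructible × El constructible => F z.2.1 :=
    hF.reindex fun z : El constructible × El constructible => z.2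
  obtain ⟨p, hp, h⟩ := exists_mem_dense hG
    (D := fun p => F p ∨ ∀ q : El constructible, P.le q.1 p → ¬ F q.1) inferInstance (by
      intro p hp
      by_cases hc : ∀ q : El constructible, P.le q.1 p → ¬ F q.1
      · exact ⟨p, Or.inr hc, P.refl p hp⟩
      · push Not at hc
        obtain ⟨q, hq, hF⟩ := hc
        exact ⟨q.1, Or.inl hF, hq⟩)
  exact ⟨p, hp, h.resolve_left fun h => H ⟨p, hp, h⟩⟩

/-- Negation is forced by `p` when no extension of `p` is in the relation. Genericity gives one
direction, and inheritance by common extensions the other. -/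
theorem Forceable.not {T : Γ → Prop} (h : Forceable P G T) : Forceable P G fun γ => ¬ T γ := by
  obtain ⟨F, h1, h2, h3⟩ := h
  have h4 : Dfn constructible P.graph fun z : (Γ × El constructible) × El constructible =>
    F z.1.1 z.2.1 := h1.reindex fun z : (Γ × El constructible) × El constructible => (z.1.1, z.2)
  refine ⟨fun γ p => ∀ q : El constructible, P.le q.1 p → ¬ F γ q.1, inferInstance,
    fun γ p q h hq r hr => h r (P.trans hr hq), fun γ => ?_⟩
  beta_reduce
  rw [h3]
  constructor
  · exact exists_mem_forall_not hG (h1.specialize γ)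
  · rintro ⟨p, hp, H⟩ ⟨q, hq, hF⟩
    obtain ⟨r, hr, hrp, hrq⟩ := exists_mem_le hG hp hq
    exact H ⟨r, carrier_subset (hG.subset hr)⟩ hrp (h2 _ _ _ hF hrq)

theorem Forceable.and {T T' : Γ → Prop} (h : Forceable P G T) (h' : Forceable P G T') :
    Forceable P G fun γ => T γ ∧ T' γ := by
  obtain ⟨F, h1, h2, h3⟩ := h
  obtain ⟨F', h1', h2', h3'⟩ := h'
  refine ⟨fun γ p => F γ p ∧ F' γ p, inferInstance,
    fun γ p q h hq => ⟨h2 _ _ _ h.1 hq, h2' _ _ _ h.2 hq⟩, fun γ => ?_⟩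
  beta_reduce
  rw [h3, h3']
  constructor
  · rintro ⟨⟨p, hp, hF⟩, q, hq, hF'⟩
    obtain ⟨r, hr, hrp, hrq⟩ := exists_mem_le hG hp hq
    exact ⟨r, hr, h2 _ _ _ hF hrp, h2' _ _ _ hF' hrq⟩
  · rintro ⟨p, hp, h, h'⟩
    exact ⟨⟨p, hp, h⟩, p, hp, h'⟩

theorem Forceable.imp {T T' : Γ → Prop} (h : Forceable P G T) (h' : Forceable P G T') :
    Forceable P G fun γ => T γ → T' γ :=
  ((h.and hG (h'.not hG)).not hG).congr fun γ => by tauto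

omit hP hG in
-- No density is needed: only agreement with truth along the filter is demanded, so existential
-- quantifiers simply commute.
theorem Forceable.ex {T : Γ × Δ → Prop} (h : Forceable P G T) :
    Forceable P G fun γ => ∃ δ, T (γ, δ) := by
  obtain ⟨F, h1, h2, h3⟩ := h
  have h4 : Dfn constructible P.graph fun z : (Γ × El constructible) × Δ => F (z.1.1, z.2) z.1.2.1 :=
    h1.reindex fun z : (Γ × El constructible) × Δ => ((z.1.1, z.2), z.1.2)
  refine ⟨fun γ p => ∃ δ, F (γ, δ) p, inferInstance,
    fun γ p q ⟨δ, h⟩ hq => ⟨δ, h2 _ _ _ h hq⟩, fun γ => ?_⟩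
  simp only [h3]
  constructor
  · rintro ⟨δ, p, hp, h⟩
    exact ⟨p, hp, δ, h⟩
  · rintro ⟨p, hp, δ, h⟩
    exact ⟨δ, p, hp, h⟩

theorem Forceable.all {T : Γ × Δ → Prop} (h : Forceable P G T) :
    Forceable P G fun γ => ∀ δ, T (γ, δ) :=
  ((h.not hG).ex.not hG).congr fun γ => by simp

theorem Forceable.eq (f g : Γ → El constructible) [Mor constructible f] [Mor constructible g] :
    Forceable P G fun γ => nameVal G (f γ).1 = nameVal G (g γ).1 := by
  have : Mor constructible fun z : Γ × El constructible.{u} => f z.1 := Mor.comp ‹Mor _ f› _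
  have : Mor constructible fun z : Γ × El constructible.{u} => g z.1 := Mor.comp ‹Mor _ g› _
  exact ⟨fun γ p => P.condForcesEq p (f γ).1 (g γ).1, inferInstance,
    fun γ p q h hq => condForcesEq_mono (f γ).2 (g γ).2 h hq,
    fun γ => nameVal_eq_iff hG _ rfl (f γ).2 (g γ).2⟩

/-- Membership of a value in another is equality with the value of a component whose condition is in
`G`, so it reduces to the truth lemma for equality. -/
theorem Forceable.mem (f g : Γ → El constructible) [Mor constructible f] [Mor constructible g] :
    Forceable P G fun γ => nameVal G (f γ).1 ∈ nameVal G (g γ).1 := by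
  have : Mor constructible fun z : Γ × El constructible.{u} => f z.1 := Mor.comp ‹Mor _ f› _
  have : Mor constructible fun z : Γ × El constructible.{u} => g z.1 := Mor.comp ‹Mor _ g› _
  refine ⟨fun γ p => P.stronglyForcesMem p (f γ).1 (g γ).1, inferInstance, ?_, fun γ => ?_⟩
  · rintro γ p q ⟨π, r, h1, h2, h3⟩ hq
    exact ⟨π, r, h1, P.trans hq h2, condForcesEq_mono (f γ).2 π.2 h3 hq⟩
  · beta_reduce
    rw [mem_nameVal]
    constructor
    · rintro ⟨π, r, hr, h, e⟩
      obtain ⟨hπ, hrL⟩ := PairClosed.mem_of_pair_mem (g γ).2 h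
      obtain ⟨p, hp, hpe⟩ := (nameVal_eq_iff hG _ rfl (f γ).2 hπ).1 e
      obtain ⟨q, hq, hqp, hqr⟩ := exists_mem_le hG hp hr
      exact ⟨q, hq, ⟨π, hπ⟩, ⟨r, hrL⟩, h, hqr, condForcesEq_mono (f γ).2 hπ hpe hqp⟩
    · rintro ⟨p, hp, π, r, h1, h2, h3⟩
      exact ⟨π.1, r.1, hG.upward p hp _ h2, h1, (nameVal_eq_iff hG _ rfl (f γ).2 π.2).2 ⟨p, hp, h3⟩⟩

/-- Membership of the value of a name in a definable class of the ground model. -/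
theorem Forceable.mem_class {B : Set ZFSet.{u}} (hB : B ⊆ constructible)
    (hdB : Dfn constructible P.graph fun x : El constructible => x.1 ∈ B) :
    Forceable P G fun x : El constructible => nameVal G x.1 ∈ B := by
  obtain ⟨p₀, hp₀⟩ := exists_mem_generic hG
  have hc : ∀ A : Set ZFSet.{u}, DT constructible A fun x : El constructible => checkName p₀ x.1 :=
    fun _ => DT.checkName (carrier_subset (hG.subset hp₀))
  have h1 : Dfn constructible P.graph fun z : (El constructible × El constructible) × El constructible =>
    z.2.1 ∈ B := hdB.reindex fun z : (El constructible × El constructible) × El constructible => z.2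
  have h2 : DT constructible P.graph fun z : (El constructible × El constructible) × El constructible =>
    checkName p₀ z.2.1 :=
    (hc _).reindex fun z : (El constructible × El constructible) × El constructible => z.2
  -- The value of `σ` is in `B` iff some condition in `G` equates `σ` with the check name of an
  -- element of `B`.
  refine ⟨fun σ p => ∃ x : El constructible, x.1 ∈ B ∧ P.condForcesEq p σ.1 (checkName p₀ x.1),
    inferInstance, ?_, fun σ => ?_⟩
  · rintro σ p q ⟨x, h, h'⟩ hq
    exact ⟨x, h, condForcesEq_mono σ.2 ((hc ∅).mem x) h' hq⟩
  · constructor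
    · intro h
      obtain ⟨p, hp, h'⟩ := (nameVal_eq_iff hG _ rfl σ.2 ((hc ∅).mem ⟨_, hB h⟩)).1
        (nameVal_checkName hp₀ _).symm
      exact ⟨p, hp, ⟨_, hB h⟩, h, h'⟩
    · rintro ⟨p, hp, x, h, h'⟩
      rw [(nameVal_eq_iff hG _ rfl σ.2 ((hc ∅).mem x)).2 ⟨p, hp, h'⟩, nameVal_checkName hp₀]
      exact h

/-- The truth lemma for formulas relativized to a class. -/
theorem Forceable.of_definableOver {K B D : Set ZFSet.{u}} (hKG : K ⊆ genericExt constructible G)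
    (hK : Forceable P G fun x : El constructible => nameVal G x.1 ∈ K)
    (hB : Forceable P G fun x : El constructible => nameVal G x.1 ∈ B)
    (hD : DefinableOver K B D) :
    Forceable P G fun x : El constructible => nameVal G x.1 ∈ K → nameVal G x.1 ∈ D := by
  obtain ⟨n, φ, s, hs, hφ⟩ := definableOver_iff_realizeIn.1 hD
  have hval : ∀ y ∈ K, ∃ x : El constructible, nameVal G x.1 = y := fun y hy => by
    obtain ⟨x, hx, rfl⟩ := hKG hy
    exact ⟨⟨x, hx⟩, rfl⟩
  -- Names stand for the elements of the extension: quantifiers over `K` become quantifiers over the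
  -- names whose value is in `K`, which are forceable by hypothesis.
  have key := realizeIn_closure (I := El constructible) (fun x => nameVal G x.1) hval
    (A := B) (fun n p => Forceable P G p) (fun n => Forceable.const hG _)
    (fun n i j => Forceable.eq hG _ _) (fun n i j => Forceable.mem hG _ _)
    (fun n i => hB.reindex fun v : Fin n → El constructible => v i)
    (fun n p q hp hq => hp.imp hG hq)
    (fun n p hp => Forceable.all hG (Forceable.imp hG
      (hK.reindex fun z : (Fin n → El constructible) × El constructible => z.2)
      (hp.reindex fun z : (Fin n → El constructible) × El constructible => Fin.snoc z.1 z.2))) φ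
  -- The parameters in `K` are replaced by names, which are parameters in `L`.
  choose w hw using fun i => hval (s i) (hs i)
  have h1 := (key.reindex fun z : (Fin n → El constructible) × El constructible =>
    (Fin.snoc z.1 z.2 : Fin (n + 1) → El constructible)).specialize w
  refine (hK.imp hG h1).congr fun x => forall_congr' fun hx => ?_
  rw [hφ _ hx]
  have : (fun i => nameVal G (Fin.snoc (α := fun _ => El constructible) w x i).1) =
      Fin.snoc (α := fun _ => ZFSet.{u}) s (nameVal G x.1) := by
    funext i
    induction i using Fin.lastCases <;> simp [hw]
  rw [this]

/-- If the extension is an inner model containing `R`, then every class definable over `⟨L[R], P⟩`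
has a definable forcing relation for its intersection with the ground model. -/
theorem exists_forcing_relation {R : ZFSet.{u}} {D : Set ZFSet.{u}}
    (hN : IsInnerModel (genericExt constructible G)) (hR : R ∈ genericExt constructible G)
    (hD : DefinableOver (relConstructible {n | n ∈ R}) P.graph D) :
    ∃ F : ZFSet.{u} → ZFSet.{u} → Prop,
      Dfn constructible P.graph (fun z : El constructible × El constructible => F z.1.1 z.2.1) ∧
      (∀ x p q, F x p → P.le q p → F x q) ∧ ∀ x ∈ constructible, x ∈ D ↔ ∃ p ∈ G, F x p := by
  have : Fact (IsInnerModel (genericExt constructible G)) := ⟨hN⟩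
  obtain ⟨p₀, hp₀⟩ := exists_mem_generic hG
  have hK : Forceable P G fun x : El constructible => nameVal G x.1 ∈ relConstructible {n | n ∈ R} := by
    -- First use of the truth lemma: `L[R]` is definable over `⟨L[G], ∈⟩`. Its result allows a
    -- second use, relativized to `L[R]` and with predicate `P`.
    have h := Forceable.of_definableOver hG (K := genericExt constructible G) (B := ∅) subset_rfl
      ((Forceable.const hG True).congr fun x => by
        simpa using ⟨x.1, x.2, rfl⟩)
      ((Forceable.const hG False).congr fun x => by simp)
      (definableOver_iff_dfn.2 (Dfn.mem_relConstructible hR))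
    exact h.congr fun x => ⟨fun h _ => h, fun h => h ⟨x.1, x.2, rfl⟩⟩
  obtain ⟨F, h1, h2, h3⟩ := Forceable.of_definableOver hG (relConstructible_subset hR) hK
    (Forceable.mem_class hG hP.amenable.1 inferInstance) hD
  have hc : ∀ {A : Set ZFSet.{u}}, DT constructible A fun x : El constructible => checkName p₀ x.1 :=
    DT.checkName (carrier_subset (hG.subset hp₀))
  -- The truth lemma speaks about names; elements of the ground model are fed to it through their
  -- check names.
  refine ⟨fun x p => ∃ y : El constructible, y.1 = checkName p₀ x ∧ F y p, ?_, ?_, ?_⟩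
  · have h4 : DT constructible P.graph fun z : (El constructible × El constructible) × El constructible =>
        checkName p₀ z.1.1.1 :=
      hc.reindex fun z : (El constructible × El constructible) × El constructible => z.1.1
    have h5 : Dfn constructible P.graph
        fun z : (El constructible × El constructible) × El constructible => F z.2 z.1.2.1 :=
      h1.reindex fun z : (El constructible × El constructible) × El constructible => (z.2, z.1.2)
    infer_instance
  · rintro x p q ⟨y, h, h'⟩ hq
    exact ⟨y, h, h2 _ _ _ h' hq⟩
  · intro x hx
    have h4 := h3 ⟨checkName p₀ x, hc.mem (A := ∅) ⟨x, hx⟩⟩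
    simp only [nameVal_checkName hp₀, constructible_subset hx, forall_const] at h4
    rw [h4]
    constructor
    · rintro ⟨p, hp, h⟩
      exact ⟨p, hp, _, rfl, h⟩
    · rintro ⟨p, hp, ⟨y, hy⟩, e, h⟩
      simp only at e
      subst e
      exact ⟨p, hp, h⟩

end

/-! ## Undefinability of truth -/

/-- `c` has the shape of the code of an atomic formula. -/
def IsAtomicCode (c : ZFSet.{u}) : Prop :=
  ∃ k d : El constructible.{u}, (k.1 = natSet 0 ∨ k.1 = natSet 1 ∨ k.1 = natSet 2 ∨ k.1 = natSet 3) ∧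
    c = ZFSet.pair k.1 d.1

/-- The atomic formula coded by `c` holds of the sequence `s`, with `B` as the predicate. -/
def AtomicTrue (B : Set ZFSet.{u}) (c s : ZFSet.{u}) : Prop :=
  (∃ i j a : El constructible.{u}, c = ZFSet.pair (natSet 1) (ZFSet.pair i.1 j.1) ∧
    ZFSet.pair i.1 a.1 ∈ s ∧ ZFSet.pair j.1 a.1 ∈ s) ∨
  (∃ i j a b : El constructible.{u}, c = ZFSet.pair (natSet 2) (ZFSet.pair i.1 j.1) ∧
    ZFSet.pair i.1 a.1 ∈ s ∧ ZFSet.pair j.1 b.1 ∈ s ∧ a.1 ∈ b.1) ∨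
  (∃ i a : El constructible.{u}, c = ZFSet.pair (natSet 3) i.1 ∧ ZFSet.pair i.1 a.1 ∈ s ∧ a.1 ∈ B)

/-! ### Atomic truth and inversion of formula codes -/

section
variable {B : Set ZFSet.{u}}

theorem isAtomicCode_imp {n : ℕ} {φ ψ : setLang.BoundedFormula Empty n} :
    ¬ IsAtomicCode (fmlCode (.imp φ ψ)) := by
  rintro ⟨⟨k, hk⟩, d, h, e⟩
  simp only [fmlCode, ZFSet.pair_inj] at e
  obtain ⟨rfl, -⟩ := e
  simp [natSet_inj] at h

theorem isAtomicCode_all {n : ℕ} {φ : setLang.BoundedFormula Empty (n + 1)} :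
    ¬ IsAtomicCode (fmlCode (.all φ)) := by
  rintro ⟨⟨k, hk⟩, d, h, e⟩
  simp only [fmlCode, ZFSet.pair_inj] at e
  obtain ⟨rfl, -⟩ := e
  simp [natSet_inj] at h

theorem pair_termVar_mem {n : ℕ} (t : setLang.Term (Empty ⊕ Fin n)) {v : Fin n → ZFSet.{u}}
    {a : ZFSet.{u}} : ZFSet.pair (natSet (varIndex t)) a ∈ seqSet v ↔ a = v (termVar t) := by
  rw [varIndex_eq, pair_mem_seqSet]

theorem atomicTrue_equal {n : ℕ} {s t : setLang.Term (Empty ⊕ Fin n)} {v : Fin n → ZFSet.{u}}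
    (hv : ∀ i, v i ∈ constructible) :
    AtomicTrue B (fmlCode (.equal s t)) (seqSet v) ↔ v (termVar s) = v (termVar t) := by
  constructor
  · rintro (⟨⟨i, hi⟩, ⟨j, hj⟩, a, e, h⟩ | ⟨i, j, a, b, e, h⟩ | ⟨i, a, e, h⟩) <;>
      simp [fmlCode, ZFSet.pair_inj, natSet_inj] at e
    obtain ⟨rfl, rfl⟩ := e
    simp only [pair_termVar_mem] at h
    rw [← h.1, ← h.2]
  · intro h
    refine Or.inl ⟨⟨_, natSet_mem _⟩, ⟨_, natSet_mem _⟩, ⟨_, hv (termVar s)⟩, rfl, ?_⟩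
    simp only [pair_termVar_mem, h, and_self]

theorem atomicTrue_mem {n : ℕ} {ts : Fin 2 → setLang.Term (Empty ⊕ Fin n)} {v : Fin n → ZFSet.{u}}
    (hv : ∀ i, v i ∈ constructible) :
    AtomicTrue B (fmlCode (.rel SetSymbol.mem ts)) (seqSet v) ↔
      v (termVar (ts 0)) ∈ v (termVar (ts 1)) := by
  constructor
  · rintro (⟨i, j, a, e, h⟩ | ⟨⟨i, hi⟩, ⟨j, hj⟩, a, b, e, h⟩ | ⟨i, a, e, h⟩) <;>
      simp [fmlCode, ZFSet.pair_inj, natSet_inj] at e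
    obtain ⟨rfl, rfl⟩ := e
    simp only [pair_termVar_mem] at h
    rw [← h.1, ← h.2.1]
    exact h.2.2
  · intro h
    refine Or.inr (Or.inl ⟨⟨_, natSet_mem _⟩, ⟨_, natSet_mem _⟩, ⟨_, hv (termVar (ts 0))⟩,
      ⟨_, hv (termVar (ts 1))⟩, rfl, ?_⟩)
    simpa only [pair_termVar_mem, true_and] using h

theorem atomicTrue_pred {n : ℕ} {ts : Fin 1 → setLang.Term (Empty ⊕ Fin n)} {v : Fin n → ZFSet.{u}}
    (hv : ∀ i, v i ∈ constructible) :
    AtomicTrue B (fmlCode (.rel SetSymbol.pred ts)) (seqSet v) ↔ v (termVar (ts 0)) ∈ B := by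
  constructor
  · rintro (⟨i, j, a, e, h⟩ | ⟨i, j, a, b, e, h⟩ | ⟨⟨i, hi⟩, a, e, h⟩) <;>
      simp [fmlCode, ZFSet.pair_inj, natSet_inj] at e
    subst e
    simp only [pair_termVar_mem] at h
    rw [← h.1]
    exact h.2
  · intro h
    refine Or.inr (Or.inr ⟨⟨_, natSet_mem _⟩, ⟨_, hv (termVar (ts 0))⟩, rfl, ?_⟩)
    simpa only [pair_termVar_mem, true_and] using h

theorem atomicTrue_falsum {n : ℕ} {s : ZFSet.{u}} :
    ¬ AtomicTrue B (fmlCode (.falsum : setLang.BoundedFormula Empty n)) s := by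
  rintro (⟨i, j, a, e, h⟩ | ⟨i, j, a, b, e, h⟩ | ⟨i, a, e, h⟩) <;>
    simp [fmlCode, ZFSet.pair_inj, natSet_inj] at e

theorem atomicTrue_iff {n : ℕ} {φ : setLang.BoundedFormula Empty n} {v : Fin n → ZFSet.{u}}
    (hv : ∀ i, v i ∈ constructible) (hφ : IsAtomicCode (fmlCode φ)) :
    AtomicTrue B (fmlCode φ) (seqSet v) ↔ realizeIn constructible B φ v := by
  cases φ with
  | falsum => exact iff_of_false atomicTrue_falsum id
  | equal => exact atomicTrue_equal hv
  | rel r ts =>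
    cases r with
    | mem => exact atomicTrue_mem hv
    | pred => exact atomicTrue_pred hv
  | imp => exact absurd hφ isAtomicCode_imp
  | all => exact absurd hφ isAtomicCode_all

theorem fmlCode_eq_imp {n : ℕ} {φ : setLang.BoundedFormula Empty n} {a b : ZFSet.{u}}
    (h : fmlCode φ = ZFSet.pair (natSet 4) (ZFSet.pair a b)) :
    ∃ ψ χ, φ = .imp ψ χ ∧ a = fmlCode ψ ∧ b = fmlCode χ := by
  cases φ with
  | imp ψ χ =>
    simp only [fmlCode, ZFSet.pair_inj] at h
    exact ⟨ψ, χ, rfl, h.2.1.symm, h.2.2.symm⟩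
  | rel r ts => cases r <;> simp [fmlCode, ZFSet.pair_inj, natSet_inj] at h
  | _ => simp [fmlCode, ZFSet.pair_inj, natSet_inj] at h

theorem fmlCode_eq_all {n : ℕ} {φ : setLang.BoundedFormula Empty n} {a : ZFSet.{u}}
    (h : fmlCode φ = ZFSet.pair (natSet 5) a) : ∃ ψ, φ = .all ψ ∧ a = fmlCode ψ := by
  cases φ with
  | all ψ =>
    simp only [fmlCode, ZFSet.pair_inj] at h
    exact ⟨ψ, rfl, h.2.symm⟩
  | rel r ts => cases r <;> simp [fmlCode, ZFSet.pair_inj, natSet_inj] at h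
  | _ => simp [fmlCode, ZFSet.pair_inj, natSet_inj] at h

theorem mem_of_seqSet_mem {N : Set ZFSet.{u}} [PairClosed N] {n : ℕ} {v : Fin n → ZFSet.{u}}
    (h : seqSet v ∈ N) (i : Fin n) : v i ∈ N :=
  (PairClosed.mem_of_pair_mem h (pair_mem_seqSet.2 rfl)).2

end

/-! ### Conditions that contradict Tarski's clauses -/

section
variable (P : ForcingNotion.{u}) (F : ZFSet.{u} → ZFSet.{u} → Prop)

/-- No extension of `p` is related to `x` by `F`. -/
def Refutes (p x : ZFSet.{u}) : Prop := ∀ q : El constructible.{u}, P.le q.1 p → ¬ F x q.1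

/-- The condition `p`, with `F` as the forcing relation, contradicts the recursive clauses in the
definition of truth at the formula `c` with `n` variables and the sequence `s`. -/
def MisdecidesAt (p n c s : ZFSet.{u}) : Prop :=
  (IsAtomicCode c ∧ ((F (ZFSet.pair c s) p ∧ ¬ AtomicTrue P.graph c s) ∨
    (Refutes P F p (ZFSet.pair c s) ∧ AtomicTrue P.graph c s))) ∨
  (∃ a b : El constructible.{u}, c = ZFSet.pair (natSet 4) (ZFSet.pair a.1 b.1) ∧
    ((F (ZFSet.pair c s) p ∧ F (ZFSet.pair a.1 s) p ∧ Refutes P F p (ZFSet.pair b.1 s)) ∨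
     (Refutes P F p (ZFSet.pair c s) ∧ Refutes P F p (ZFSet.pair a.1 s)) ∨
     (Refutes P F p (ZFSet.pair c s) ∧ F (ZFSet.pair b.1 s) p))) ∨
  (∃ a : El constructible.{u}, c = ZFSet.pair (natSet 5) a.1 ∧
    ((F (ZFSet.pair c s) p ∧ ∃ t : El constructible.{u},
        Refutes P F p (ZFSet.pair a.1 (insert (ZFSet.pair n t.1) s))) ∨
     (Refutes P F p (ZFSet.pair c s) ∧ ∀ t q : El constructible.{u}, P.le q.1 p →
        ¬ Refutes P F q.1 (ZFSet.pair a.1 (insert (ZFSet.pair n t.1) s)))))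

/-- The condition `p` contradicts the recursive clauses in the definition of truth. -/
def Misdecides (p : ZFSet.{u}) : Prop :=
  ∃ n c s x S : El constructible.{u}, IsTruthSet constructible ∅ ∅ n.1 c.1 S.1 ∧
    IsSeqOn n.1 x.1 s.1 ∧ MisdecidesAt P F p n.1 c.1 s.1

variable {P F}

theorem Refutes.mono {p q x : ZFSet.{u}} (h : Refutes P F p x) (hqp : P.le q p) : Refutes P F q x :=
  fun r hr => h r (P.trans hr hqp)

-- Being a formula code, atomic truth and the clauses for `F` are all first-order over `⟨L, P⟩`;
-- truth itself is not mentioned. This is what lets genericity be applied to misdeciding conditions.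
set_option synthInstance.maxHeartbeats 2000000 in
theorem Dfn.misdecides
    (hF : Dfn constructible P.graph fun z : El constructible × El constructible => F z.1.1 z.2.1) :
    Dfn constructible P.graph fun p : El constructible => Misdecides P F p.1 := by
  have hF' : ∀ {Γ : Type (u + 1)} [Ctx constructible Γ] {s t : Γ → ZFSet.{u}}
      [DT constructible P.graph s] [DT constructible P.graph t],
      Dfn constructible P.graph fun γ => F (s γ) (t γ) :=
    fun {Γ _ s t hs ht} => Dfn.subst₂ hF hs ht
  have hR : ∀ {Γ : Type (u + 1)} [Ctx constructible Γ] {s t : Γ → ZFSet.{u}}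
      [DT constructible P.graph s] [DT constructible P.graph t],
      Dfn constructible P.graph fun γ => Refutes P F (s γ) (t γ) :=
    fun {Γ _ s t hs ht} => Dfn.subst₂ (p := Refutes P F) (by unfold Refutes; infer_instance) hs ht
  have hT : ∀ {Γ : Type (u + 1)} [Ctx constructible Γ] {s t : Γ → ZFSet.{u}}
      [DT constructible P.graph s] [DT constructible P.graph t],
      Dfn constructible P.graph fun γ => AtomicTrue P.graph (s γ) (t γ) :=
    fun {Γ _ s t hs ht} => Dfn.subst₂ (p := AtomicTrue P.graph)
      (by unfold AtomicTrue; infer_instance) hs ht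
  have hA : ∀ {Γ : Type (u + 1)} [Ctx constructible Γ] {s : Γ → ZFSet.{u}}
      [DT constructible P.graph s], Dfn constructible P.graph fun γ => IsAtomicCode (s γ) :=
    fun {Γ _ s hs} => Dfn.subst₁ (p := IsAtomicCode) (by unfold IsAtomicCode; infer_instance) hs
  have h0 : ∀ {Γ : Type (u + 1)} [Ctx constructible Γ],
      DT constructible P.graph fun _ : Γ => (∅ : ZFSet.{u}) := DT.const empty_mem
  unfold Misdecides MisdecidesAt
  infer_instance

variable [hP : IsTame P] {G : Set ZFSet.{u}} (hG : P.IsGenericFilter constructible G)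
  (hFd : Dfn constructible P.graph fun z : El constructible × El constructible => F z.1.1 z.2.1)
  (hFm : ∀ x p q, F x p → P.le q p → F x q)
include hFm

section
variable (hFt : ∀ x ∈ constructible, x ∈ Sat constructible P.graph ↔ ∃ p ∈ G, F x p)
include hG hFd hFt

theorem not_mem_Sat_iff {x : ZFSet.{u}} (hx : x ∈ constructible) :
    x ∉ Sat constructible P.graph ↔ ∃ p ∈ G, Refutes P F p x := by
  rw [hFt x hx]
  have h := Dfn.specialize hFd ⟨x, hx⟩
  refine ⟨exists_mem_forall_not hG h, ?_⟩
  rintro ⟨p, hp, H⟩ ⟨q, hq, hF⟩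
  obtain ⟨r, hr, hrp, hrq⟩ := exists_mem_le hG hp hq
  exact H ⟨r, carrier_subset (hG.subset hr)⟩ hrp (hFm _ _ _ hF hrq)

/-- For `p ∈ G`, what `F` affirms at `p` is true and what `p` refutes is false, and genuine truth
obeys the recursive clauses. -/
theorem not_misdecides {p : ZFSet.{u}} (hp : p ∈ G) : ¬ Misdecides P F p := by
  rintro ⟨⟨n, hn⟩, ⟨c, hc⟩, ⟨s, hsL⟩, x, S, hc', hs, h⟩
  -- Having a truth set over the empty structure is used only as the definition, inside `L`, of
  -- being the code of a formula in `n` variables.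
  obtain ⟨n, φ, rfl, rfl, -⟩ := hc'.sound empty_mem _ rfl
  obtain ⟨v, -, rfl⟩ := isSeqOn_natSet.1 hs
  have hv := mem_of_seqSet_mem hsL
  have pos : ∀ {k} {ψ : setLang.BoundedFormula Empty k} {w : Fin k → ZFSet.{u}},
      (∀ i, w i ∈ constructible) → F (ZFSet.pair (fmlCode ψ) (seqSet w)) p →
      realizeIn constructible P.graph ψ w := fun {k ψ w} hw h =>
    (pair_mem_Sat hw).1 ((hFt _ (PairClosed.pair_mem (fmlCode_mem ψ) (seqSet_mem hw))).2 ⟨p, hp, h⟩)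
  have neg : ∀ {k} {ψ : setLang.BoundedFormula Empty k} {w : Fin k → ZFSet.{u}},
      (∀ i, w i ∈ constructible) → Refutes P F p (ZFSet.pair (fmlCode ψ) (seqSet w)) →
      ¬ realizeIn constructible P.graph ψ w := fun {k ψ w} hw h => by
    rw [← pair_mem_Sat hw, not_mem_Sat_iff hG hFd hFm hFt
      (PairClosed.pair_mem (fmlCode_mem ψ) (seqSet_mem hw))]
    exact ⟨p, hp, h⟩
  rcases h with ⟨hat, h⟩ | ⟨⟨a, ha⟩, ⟨b, hb⟩, e, h⟩ | ⟨⟨a, ha⟩, e, h⟩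
  · dsimp only at hat h
    rw [atomicTrue_iff hv hat] at h
    rcases h with ⟨h, h'⟩ | ⟨h, h'⟩
    · exact h' (pos hv h)
    · exact neg hv h h'
  · dsimp only at e h
    obtain ⟨ψ, χ, rfl, rfl, rfl⟩ := fmlCode_eq_imp e
    rcases h with ⟨h1, h2, h3⟩ | ⟨h1, h2⟩ | ⟨h1, h2⟩
    · exact neg hv h3 (pos hv h1 (pos hv h2))
    · exact neg hv h1 fun h => absurd h (neg hv h2)
    · exact neg hv h1 fun _ => pos hv h2
  · dsimp only at e h
    obtain ⟨ψ, rfl, rfl⟩ := fmlCode_eq_all e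
    simp only [← seqSet_snoc] at h
    rcases h with ⟨h1, ⟨t, ht⟩, h2⟩ | ⟨h1, h2⟩
    · exact neg (forall_snoc_mem_class hv ht) h2 (pos hv h1 t ht)
    · refine neg hv h1 fun t ht => ?_
      -- A false instance would be refuted by some `q ∈ G`, hence by a common extension of `p` and
      -- `q`, which the clause excludes.
      by_contra hcon
      rw [← pair_mem_Sat (forall_snoc_mem_class hv ht), not_mem_Sat_iff hG hFd hFm hFt
        (PairClosed.pair_mem (fmlCode_mem ψ) (seqSet_mem (forall_snoc_mem_class hv ht)))] at hcon
      obtain ⟨q, hq, hR⟩ := hcon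
      obtain ⟨r, hr, hrp, hrq⟩ := exists_mem_le hG hp hq
      exact h2 ⟨t, ht⟩ ⟨r, carrier_subset (hG.subset hr)⟩ hrp (hR.mono hrq)

end

omit hP in
/-- Below a condition without misdeciding extensions, `F` decides truth correctly. -/
theorem decides_correctly {p : ZFSet.{u}}
    (hp : ∀ q : El constructible, P.le q.1 p → ¬ Misdecides P F q.1)
    {n : ℕ} (φ : setLang.BoundedFormula Empty n) :
    ∀ v : Fin n → ZFSet.{u}, (∀ i, v i ∈ constructible) → ∀ q : El constructible, P.le q.1 p →
      (F (ZFSet.pair (fmlCode φ) (seqSet v)) q.1 → realizeIn constructible P.graph φ v) ∧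
      (Refutes P F q.1 (ZFSet.pair (fmlCode φ) (seqSet v)) → ¬ realizeIn constructible P.graph φ v) := by
  have hp' : ∀ {n : ℕ} (φ : setLang.BoundedFormula Empty n) {v : Fin n → ZFSet.{u}},
      (∀ i, v i ∈ constructible) → ∀ q : El constructible, P.le q.1 p →
      ¬ MisdecidesAt P F q.1 (natSet n) (fmlCode φ) (seqSet v) := by
    intro n φ v hv q hq h
    have hs := seqSet_mem hv
    obtain ⟨S, hS⟩ := exists_isTruthSet (N := constructible) empty_mem empty_mem φ
    have hSL : S ∈ constructible := by
      obtain ⟨X, -, hX⟩ := hS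
      exact (PairClosed.of_pair_mem (PairClosed.mem_of_pair_mem X.2 hX).2).2
    -- The entries of a sequence `s` of Kuratowski pairs all lie in `⋃⋃s`, which serves as the set
    -- the sequence runs in.
    refine hp q hq ⟨⟨_, natSet_mem n⟩, ⟨_, fmlCode_mem φ⟩, ⟨_, hs⟩,
      ⟨_, PairClosed.union _ (PairClosed.union _ hs)⟩, ⟨S, hSL⟩, hS, isSeqOn_seqSet.2 fun i => ?_, h⟩
    refine ZFSet.mem_sUnion.2 ⟨{natSet i, v i}, ZFSet.mem_sUnion.2
      ⟨_, (pair_mem_seqSet (i := i)).2 rfl, ?_⟩, ?_⟩ <;> simp [ZFSet.pair]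
  have atomic : ∀ {n : ℕ} (φ : setLang.BoundedFormula Empty n), IsAtomicCode (fmlCode φ) →
      ∀ v : Fin n → ZFSet.{u}, (∀ i, v i ∈ constructible) → ∀ q : El constructible, P.le q.1 p →
      (F (ZFSet.pair (fmlCode φ) (seqSet v)) q.1 → realizeIn constructible P.graph φ v) ∧
      (Refutes P F q.1 (ZFSet.pair (fmlCode φ) (seqSet v)) →
        ¬ realizeIn constructible P.graph φ v) := by
    intro n φ hφ v hv q hq
    rw [← atomicTrue_iff hv hφ]
    refine ⟨fun h => ?_, fun h h' => hp' φ hv q hq (Or.inl ⟨hφ, Or.inr ⟨h, h'⟩⟩)⟩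
    by_contra h'
    exact hp' φ hv q hq (Or.inl ⟨hφ, Or.inl ⟨h, h'⟩⟩)
  have ext : ∀ {q : El constructible.{u}} {x : ZFSet.{u}}, ¬ Refutes P F q.1 x →
      ∃ r : El constructible.{u}, P.le r.1 q.1 ∧ F x r.1 := by
    intro q x h
    rw [Refutes] at h
    push Not at h
    exact h
  induction φ with
  | falsum => exact atomic _ ⟨⟨_, natSet_mem 0⟩, ⟨_, natSet_mem 0⟩, Or.inl rfl, rfl⟩
  | equal s t =>
    exact atomic _ ⟨⟨_, natSet_mem 1⟩, ⟨_, PairClosed.pair_mem (natSet_mem _) (natSet_mem _)⟩,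
      Or.inr (Or.inl rfl), rfl⟩
  | rel r ts =>
    cases r with
    | mem =>
      exact atomic _ ⟨⟨_, natSet_mem 2⟩, ⟨_, PairClosed.pair_mem (natSet_mem _) (natSet_mem _)⟩,
        Or.inr (Or.inr (Or.inl rfl)), rfl⟩
    | pred =>
      exact atomic _ ⟨⟨_, natSet_mem 3⟩, ⟨_, natSet_mem _⟩, Or.inr (Or.inr (Or.inr rfl)), rfl⟩
  | imp φ ψ ih1 ih2 =>
    intro v hv q hq
    have key := fun r hr => hp' (.imp φ ψ) hv r hr
    refine ⟨fun h h1 => ?_, fun h h' => ?_⟩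
    · by_contra h2
      -- As `φ` is true, `q` does not refute it, so some `r ≤ q` affirms it. As `ψ` is false, no
      -- extension of `r` affirms it, so `r` refutes `ψ` while affirming the implication.
      obtain ⟨r, hr, hFr⟩ := ext fun hR => (ih1 v hv q hq).2 hR h1
      refine key r (P.trans hr hq) (Or.inr (Or.inl ⟨⟨_, fmlCode_mem φ⟩, ⟨_, fmlCode_mem ψ⟩, rfl,
        Or.inl ⟨hFm _ _ _ h hr, hFr, fun s hs hFs => ?_⟩⟩))
      exact h2 ((ih2 v hv s (P.trans hs (P.trans hr hq))).1 hFs)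
    · by_cases h1 : realizeIn constructible P.graph φ v
      · obtain ⟨r, hr, hFr⟩ := ext fun hR => (ih2 v hv q hq).2 hR (h' h1)
        exact key r (P.trans hr hq) (Or.inr (Or.inl ⟨⟨_, fmlCode_mem φ⟩, ⟨_, fmlCode_mem ψ⟩, rfl,
          Or.inr (Or.inr ⟨h.mono hr, hFr⟩)⟩))
      · exact key q hq (Or.inr (Or.inl ⟨⟨_, fmlCode_mem φ⟩, ⟨_, fmlCode_mem ψ⟩, rfl,
          Or.inr (Or.inl ⟨h, fun s hs hFs => h1 ((ih1 v hv s (P.trans hs hq)).1 hFs)⟩)⟩))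
  | @all n φ ih =>
    intro v hv q hq
    have key := fun r hr => hp' (.all φ) hv r hr
    refine ⟨fun h t ht => ?_, fun h h' => ?_⟩
    · by_contra h1
      -- By induction no extension of `q` affirms the false instance at `t`, so `q` refutes it while
      -- affirming the universal formula.
      refine key q hq (Or.inr (Or.inr ⟨⟨_, fmlCode_mem φ⟩, rfl, Or.inl ⟨h, ⟨t, ht⟩,
        fun s hs hFs => h1 ?_⟩⟩))
      rw [← seqSet_snoc] at hFs
      exact (ih _ (forall_snoc_mem_class hv ht) s (P.trans hs hq)).1 hFs
    · refine key q hq (Or.inr (Or.inr ⟨⟨_, fmlCode_mem φ⟩, rfl, Or.inr ⟨h, fun t r hr hR => ?_⟩⟩))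
      rw [← seqSet_snoc] at hR
      exact (ih _ (forall_snoc_mem_class hv t.2) r (P.trans hr hq)).2 hR (h' t.1 t.2)

include hFd in
/-- The forcing relation cannot decide truth in `⟨L, P⟩`. -/
theorem exists_mem_Sat_not_iff (hG : P.IsGenericFilter constructible G) :
    ¬ ∀ x ∈ constructible, x ∈ Sat constructible P.graph ↔ ∃ p ∈ G, F x p := by
  intro hFt
  -- Since no condition in `G` misdecides, a single condition in `G` has no misdeciding extension at
  -- all.
  obtain ⟨p, hpG, hp⟩ := exists_mem_forall_not hG (F := Misdecides P F) (Dfn.misdecides hFd)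
    fun ⟨p, hp, h⟩ => not_misdecides hG hFd hFm hFt hp h
  have hpL := carrier_subset (hG.subset hpG)
  -- This eliminates `G`: truth in `⟨L, P⟩` is now defined over `⟨L, P⟩` from the parameter `p`.
  have truth : ∀ {n : ℕ} (φ : setLang.BoundedFormula Empty n) {v : Fin n → ZFSet.{u}},
      (∀ i, v i ∈ constructible) → (realizeIn constructible P.graph φ v ↔
        ∃ q : El constructible, P.le q.1 p ∧ F (ZFSet.pair (fmlCode φ) (seqSet v)) q.1) := by
    intro n φ v hv
    refine ⟨fun h => ?_, fun ⟨q, hq, h⟩ => (decides_correctly hFm hp φ v hv q hq).1 h⟩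
    have := (decides_correctly hFm hp φ v hv ⟨p, hpL⟩ (P.refl p (hG.subset hpG))).2
    by_contra H
    exact this (fun q hq hF => H ⟨q, hq, hF⟩) h
  have hdp : ∀ {Γ : Type (u + 1)} [Ctx constructible Γ], DT constructible P.graph fun _ : Γ => p :=
    DT.const hpL
  have hF' : ∀ {Γ : Type (u + 1)} [Ctx constructible Γ] {s t : Γ → ZFSet.{u}}
      [DT constructible P.graph s] [DT constructible P.graph t],
      Dfn constructible P.graph fun γ => F (s γ) (t γ) :=
    fun {Γ _ s t hs ht} => Dfn.subst₂ hFd hs ht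
  -- The diagonal class consists of the `y = ⟨c, ⟨n, s⟩⟩` such that the formula coded by `c` fails,
  -- in the sense of the new truth definition, for `s` extended by `y` itself in place `n`. Applying
  -- a definition of this class to its own code and parameters gives the contradiction.
  have hD : DefinableOver constructible P.graph {y | ∃ c n s : El constructible,
      y = ZFSet.pair c.1 (ZFSet.pair n.1 s.1) ∧ ¬ ∃ q : El constructible, P.le q.1 p ∧
        F (ZFSet.pair c.1 (insert (ZFSet.pair n.1 y) s.1)) q.1} :=
    definableOver_iff_dfn.2 (by simp only [Set.mem_ofPred_eq]; infer_instance)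
  obtain ⟨n, φ, v, hv, h⟩ := definableOver_iff_realizeIn.1 hD
  have hy : ZFSet.pair (fmlCode φ) (ZFSet.pair (natSet n) (seqSet v)) ∈ constructible :=
    PairClosed.pair_mem (fmlCode_mem φ) (PairClosed.pair_mem (natSet_mem n) (seqSet_mem hv))
  have h1 := h _ hy
  rw [truth φ (forall_snoc_mem_class hv hy), seqSet_snoc] at h1
  refine iff_not_self (h1.symm.trans ⟨?_, fun H => ⟨⟨_, fmlCode_mem φ⟩, ⟨_, natSet_mem n⟩,
    ⟨_, seqSet_mem hv⟩, rfl, H⟩⟩)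
  rintro ⟨⟨c, hc⟩, ⟨m, hm⟩, ⟨s, hs⟩, e, H⟩
  simp only [ZFSet.pair_inj] at e
  obtain ⟨rfl, rfl, rfl⟩ := e
  exact H

end

theorem lemma1 (R : ZFSet.{u}) (hR : R ⊆ ZFSet.omega)
    (hgen : IsGenericOver constructible R) :
    ∃ A : Set ZFSet.{u}, IsAmenable constructible A ∧
      ¬ DefinableOver (relConstructible {n | n ∈ R}) A (Sat constructible A) := by
  obtain ⟨N, ⟨hN, P, G, hA, hΔ, hG, rfl⟩, hRN⟩ := hgen
  have : IsTame P := ⟨hA, hΔ⟩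
  -- The witness is the forcing notion itself, whose amenability is part of the definition of a
  -- generic extension.
  refine ⟨P.graph, hA, fun hD => ?_⟩
  obtain ⟨F, h1, h2, h3⟩ := exists_forcing_relation hG hN hRN hD
  exact exists_mem_Sat_not_iff h1 h2 hG h3
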